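/- **Setting.** Let $K\ge1$ machines be given; machine $k$ has a data distribution $\mathbb P_k$ of pairs $z=(x,y)$ with $y\in\{1,-1\}$, and $\Pr_{\mathbb P_k}(y=1)=p\in(0,1)$ for every $k$. Let $h(w;x)$, $w\in\mathbb R^d$, be a score, $v=(w,a,b)\in\mathbb R^{d+2}$, and $$F(v,\alpha;z)=(1-p)(h(w;x)-a)^2\mathbb I_{[y=1]}+p(h(w;x)-b)^2\mathbb I_{[y=-1]}+2(1+\alpha)\big(p\,h(w;x)\mathbb I_{[y=-1]}-(1-p)h(w;x)\mathbb I_{[y=1]}\big)-p(1-p)\alpha^2,$$ $$f(v,\alpha)=\frac1K\sum_{k=1}^K\mathbb E_{z\sim\mathbb P_k}F(v,\alpha;z),\qquad \phi(v)=\max_{\alpha\in\mathbb R} f(v,\alpha),\qquad \phi^*=\inf_v\phi(v).$$ **Assumption 1.** (i) $\phi(v_0)-\phi^*\le\Delta_0$ for $v_0=0$, with $\Delta_0>0$; (ii) $\|\nabla_w h(w;x)\|\le G_h$; (iii) on the set $\{|a|\le1,|b|\le1\}$ (which contains all iterates of the algorithm below) $\phi$ is $L_1$-smooth, i.e. differentiable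 with $\|\nabla\phi(v_1)-\nabla\phi(v_2)\|\le L_1\|v_1-v_2\|$, and satisfies the $\mu$-PL condition $\mu(\phi(v)-\phi^*)\le\frac12\|\nabla\phi(v)\|^2$, with $\mu>0$; (iv) $h(\cdot;x)$ is $L_h$-smooth and $h(w;x)\in[0,1]$. **Algorithm (CoDA).** Start with $v_0=0$, $\alpha_0=0$. In stage $s=1,2,\dots$ set $v_0^k=v_{s-1}$, $\alpha_0^k=\alpha_{s-1}$ for all $k$; for $t=0,\dots,T_s-1$ each machine draws $z_t^k\sim\mathbb P_k$ and sets $$v_{t+1}^k=\arg\min_v\Big[\nabla_vF(v_t^k,\alpha_t^k;z_t^k)^Tv+\tfrac1{2\eta_s}\|v-v_t^k\|^2+\tfrac1{2\gamma}\|v-v_{s-1}\|^2\Big],\qquad \alpha_{t+1}^k=\alpha_t^k+\eta_s\nabla_\alpha F(v_t^k,\alpha_t^k;z_t^k),$$ and whenever $I_s$ divides $t+1$ all $v_{t+1}^k$, and all $\alpha_{t+1}^k$, are replaced by their averages over $k$. The stage returns $v_s=\frac1{KT_s}\sum_{k=1}^K\sum_{t=1}^{T_s}v_t^k$. Then each machine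 draws a minibatch $z_1^k,\dots,z_{m_s}^k\sim\mathbb P_k$ and $$\alpha_s=\frac1K\sum_{k=1}^K\Big[\frac{\sum_i h(w_s;x_i^k)\mathbb I_{[y_i^k=-1]}}{\sum_i\mathbb I_{[y_i^k=-1]}}-\frac{\sum_i h(w_s;x_i^k)\mathbb I_{[y_i^k=1]}}{\sum_i\mathbb I_{[y_i^k=1]}}\Big]\qquad(\text{with }0/0:=0).$$ All samples are mutually independent. **Theorem.** For all $p\in(0,1)$ and $G_h,L_h,L_1\ge0$ there are positive constants $L_v\ge L_1$, $H$, $B$, $\sigma_v$, $\sigma_\alpha$, $\bar\eta$, $\mathcal C$, depending only on $p,G_h,L_h,L_1$, such that the following holds for all $d$, $K$, $h$, $\mathbb P_k$, $\mu$, $\Delta_0$ satisfying Assumption 1 and all $\eta_0>0$ with $\eta_0K\le\bar\eta$. Run CoDA with $\gamma=\frac1{2L_v}$, $c=\frac{\mu/L_v}{5+\mu/L_v}$, $$\eta_s=\eta_0K e^{-(s-1)c},\quad T_s=\Big\lceil\tfrac{\max(8,8G_h^2)}{L_v\eta_0K}e^{(s-1)c}\Big\rceil,\quad I_s=\max\Big(1,\Big\lfloor\tfrac1{\sqrt{K\eta_s}}\Big\rfloor\Big),\quad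 m_s=\Big\lceil\max\Big(\tfrac{1+C}{\eta_{s+1}^2T_{s+1}p^2(1-p)^2},\tfrac{\log K}{\log(1/\tilde p)}\Big)\Big\rceil,$$ where $\tilde p=\max(p,1-p)$ and $C=\frac{3\tilde p^{1/\ln(1/\tilde p)}}{2\ln(1/\tilde p)}$. (a) For every $\epsilon>0$ and every integer $S\ge1$ with $$S\ge\frac{5L_v+\mu}{\mu}\max\Big\{\log\frac{2\Delta_0}{\epsilon},\ \log S+\log\Big[\frac{2\eta_0}{\epsilon}\cdot\frac{6HB^2+12(\sigma_v^2+\sigma_\alpha^2)}5\Big]\Big\}\qquad(*)$$ one has $\mathbb E[\phi(v_S)-\phi^*]\le\epsilon$. (b) Let $0<\epsilon\le\Delta_0$ and $\Lambda=\log\big(3+\frac1\mu+\frac{\Delta_0+1}{\epsilon}\big)$. There is a smallest integer $S\ge1$ satisfying $(*)$. For this $S$, the number of iterations $\sum_{s=1}^ST_s$ on each machine is at most $$\mathcal C\,\Lambda\,\max\Big(\frac{\Delta_0}{\mu\epsilon\eta_0K},\ \frac{L_v}{\mu^2K\epsilon}\Big),$$ and the number of communication rounds (the averaging steps, plus one round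 per stage for its output and one for $\alpha_s$) is at most $$\mathcal C\,\Lambda\,\max\Big(\frac K\mu+\frac{\Delta_0^{1/2}}{\mu(\eta_0\epsilon)^{1/2}},\ \frac K\mu+\frac{L_v^{1/2}}{\mu^{3/2}\epsilon^{1/2}}\Big).$$ -/

import Mathlib

open MeasureTheory ProbabilityTheory

noncomputable section

namespace CoDA

/-! ### The min-max objective -/

/-- Model weights `w ∈ ℝ^d`. -/
abbrev Weights (d : ℕ) := EuclideanSpace ℝ (Fin d)

/-- The primal variable `v = (w, a, b) ∈ ℝ^(d+2)`, with the Euclidean norm. -/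
abbrev Primal (d : ℕ) := EuclideanSpace ℝ (Fin d ⊕ Fin 2)

/-- The component `w` of `v = (w, a, b)`. -/
def wPart {d : ℕ} (v : Primal d) : Weights d := WithLp.toLp 2 fun i => v (Sum.inl i)

/-- The component `a` of `v = (w, a, b)`. -/
def aPart {d : ℕ} (v : Primal d) : ℝ := v (Sum.inr 0)

/-- The component `b` of `v = (w, a, b)`. -/
def bPart {d : ℕ} (v : Primal d) : ℝ := v (Sum.inr 1)

/-- The set of all `v = (w, a, b)` with `|a| ≤ 1` and `|b| ≤ 1`. -/
def box (d : ℕ) : Set (Primal d) := {v | |aPart v| ≤ 1 ∧ |bPart v| ≤ 1}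

variable {X : Type*}

/-- Indicator of the label `y = 1`. A data point is `z = (x, y)`; `true` stands for the label `1`
and `false` for the label `-1`. -/
def posInd (z : X × Bool) : ℝ := if z.2 = true then 1 else 0

/-- Indicator of the label `y = -1`. -/
def negInd (z : X × Bool) : ℝ := if z.2 = false then 1 else 0

/-- The integrand `F(v, α; z)`. -/
def lossF {d : ℕ} (p : ℝ) (h : Weights d → X → ℝ) (v : Primal d) (α : ℝ) (z : X × Bool) : ℝ :=
  (1 - p) * (h (wPart v) z.1 - aPart v) ^ 2 * posInd z
    + p * (h (wPart v) z.1 - bPart v) ^ 2 * negInd z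
    + 2 * (1 + α) * (p * h (wPart v) z.1 * negInd z - (1 - p) * h (wPart v) z.1 * posInd z)
    - p * (1 - p) * α ^ 2

/-- The stochastic primal gradient `∇_v F(v, α; z)`. -/
def gradV {d : ℕ} (p : ℝ) (h : Weights d → X → ℝ) (v : Primal d) (α : ℝ) (z : X × Bool) :
    Primal d :=
  gradient (fun u => lossF p h u α z) v

/-- The stochastic dual gradient `∇_α F(v, α; z)`. -/
def gradAlpha {d : ℕ} (p : ℝ) (h : Weights d → X → ℝ) (v : Primal d) (α : ℝ) (z : X × Bool) : ℝ :=
  deriv (fun β => lossF p h v β z) α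

/-- `f(v, α) = (1/K) ∑ₖ f_k(v, α)` with `f_k(v, α) = E_{z ∼ P_k} F(v, α; z)`. -/
def objF {d K : ℕ} [MeasurableSpace X] (p : ℝ) (h : Weights d → X → ℝ)
    (P : Fin K → Measure (X × Bool)) (v : Primal d) (α : ℝ) : ℝ :=
  (1 / (K : ℝ)) * ∑ k, ∫ z, lossF p h v α z ∂(P k)

/-- `φ(v) = max_α f(v, α)`. -/
def phi {d K : ℕ} [MeasurableSpace X] (p : ℝ) (h : Weights d → X → ℝ)
    (P : Fin K → Measure (X × Bool)) (v : Primal d) : ℝ :=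
  ⨆ α : ℝ, objF p h P v α

/-- The optimal value `φ* = min_v φ(v)`. -/
def phiStar {d K : ℕ} [MeasurableSpace X] (p : ℝ) (h : Weights d → X → ℝ)
    (P : Fin K → Measure (X × Bool)) : ℝ :=
  ⨅ v : Primal d, phi p h P v

/-- The standing assumptions on the score `h`, the data distributions `P_k` and the objective. -/
structure Assumptions {d K : ℕ} [MeasurableSpace X] (p Gh Lh L1 μ Δ₀ : ℝ)
    (h : Weights d → X → ℝ) (P : Fin K → Measure (X × Bool)) : Prop where
  /-- `p` is the probability of the positive label, on every machine. -/
  label : ∀ k, (P k).real {z | z.2 = true} = p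
  measurable_score : ∀ w, Measurable (h w)
  score_mem : ∀ w x, h w x ∈ Set.Icc (0 : ℝ) 1
  score_differentiable : ∀ x, Differentiable ℝ fun w => h w x
  score_grad_le : ∀ x w, ‖gradient (fun u => h u x) w‖ ≤ Gh
  score_smooth : ∀ x w₁ w₂,
    ‖gradient (fun u => h u x) w₁ - gradient (fun u => h u x) w₂‖ ≤ Lh * ‖w₁ - w₂‖
  phi_differentiable : ∀ v ∈ box d, DifferentiableAt ℝ (phi p h P) v
  phi_smooth : ∀ v₁ ∈ box d, ∀ v₂ ∈ box d,
    ‖gradient (phi p h P) v₁ - gradient (phi p h P) v₂‖ ≤ L1 * ‖v₁ - v₂‖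
  /-- The `μ`-PL condition. -/
  phi_PL : ∀ v ∈ box d, μ * (phi p h P v - phiStar p h P) ≤ (1 / 2) * ‖gradient (phi p h P) v‖ ^ 2
  /-- The initial gap at `v₀ = 0`. -/
  init_gap : phi p h P 0 - phiStar p h P ≤ Δ₀

/-! ### The inner algorithm DSG -/

/-- The objective of the proximal step:
`⟨g, u⟩ + ‖u - v‖² / (2η) + ‖u - v₀‖² / (2γ)`. -/
def proxObj {d : ℕ} (γ η : ℝ) (v₀ v g u : Primal d) : ℝ :=
  inner ℝ g u + 1 / (2 * η) * ‖u - v‖ ^ 2 + 1 / (2 * γ) * ‖u - v₀‖ ^ 2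

/-- The minimizer over `u` of `proxObj γ η v₀ v g u`, in closed form. -/
def proxStep {d : ℕ} (γ η : ℝ) (v₀ v g : Primal d) : Primal d :=
  (γ / (η + γ)) • v + (η / (η + γ)) • v₀ - (η * γ / (η + γ)) • g

theorem proxObj_eq {d : ℕ} {γ η : ℝ} (hγ : 0 < γ) (hη : 0 < η) (v₀ v g u : Primal d) :
    proxObj γ η v₀ v g u = proxObj γ η v₀ v g (proxStep γ η v₀ v g)
      + (η + γ) / (2 * η * γ) * ‖u - proxStep γ η v₀ v g‖ ^ 2 := by
  have hs : η + γ ≠ 0 := by positivity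
  simp only [proxObj, EuclideanSpace.norm_sq_eq, PiLp.inner_apply, Finset.mul_sum,
    ← Finset.sum_add_distrib]
  refine Finset.sum_congr rfl fun i _ => ?_
  simp only [proxStep, PiLp.sub_apply, PiLp.add_apply, PiLp.smul_apply, smul_eq_mul,
    Real.norm_eq_abs, sq_abs, RCLike.inner_apply, conj_trivial]
  field_simp
  ring

/-- `proxStep` is the unique minimizer of the proximal objective. -/
theorem proxObj_proxStep_lt {d : ℕ} {γ η : ℝ} (hγ : 0 < γ) (hη : 0 < η) (v₀ v g u : Primal d)
    (hu : u ≠ proxStep γ η v₀ v g) :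
    proxObj γ η v₀ v g (proxStep γ η v₀ v g) < proxObj γ η v₀ v g u := by
  rw [proxObj_eq hγ hη v₀ v g u]
  have h1 : 0 < ‖u - proxStep γ η v₀ v g‖ := norm_pos_iff.mpr (sub_ne_zero.mpr hu)
  have h2 : 0 < (η + γ) / (2 * η * γ) * ‖u - proxStep γ η v₀ v g‖ ^ 2 := by positivity
  linarith

/-- The local variables `(v_t^k, α_t^k)` of the `K` machines after `t` iterations of DSG, started
from `(v₀, α₀)`, where machine `k` uses the sample `z t k` in iteration `t`. The local variables are
averaged after every `I` iterations. -/
def dsgState {d K : ℕ} (p : ℝ) (h : Weights d → X → ℝ) (γ η : ℝ) (I : ℕ) (v₀ : Primal d) (α₀ : ℝ)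
    (z : ℕ → Fin K → X × Bool) : ℕ → Fin K → Primal d × ℝ
  | 0 => fun _ => (v₀, α₀)
  | t + 1 =>
    let cur := dsgState p h γ η I v₀ α₀ z t
    let new : Fin K → Primal d × ℝ := fun k =>
      (proxStep γ η v₀ (cur k).1 (gradV p h (cur k).1 (cur k).2 (z t k)),
        (cur k).2 + η * gradAlpha p h (cur k).1 (cur k).2 (z t k))
    if (t + 1) % I = 0 then
      fun _ => ((1 / (K : ℝ)) • ∑ k, (new k).1, (1 / (K : ℝ)) * ∑ k, (new k).2)
    else new

/-- The output of DSG: the average of `v_t^k` over all machines `k` and `t = 1, …, T`. -/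
def dsgOutput {d K : ℕ} (p : ℝ) (h : Weights d → X → ℝ) (γ η : ℝ) (T I : ℕ) (v₀ : Primal d)
    (α₀ : ℝ) (z : ℕ → Fin K → X × Bool) : Primal d :=
  (1 / (K : ℝ)) • ∑ k, (1 / (T : ℝ)) • ∑ t ∈ Finset.Icc 1 T, (dsgState p h γ η I v₀ α₀ z t k).1

/-- The number of averaging steps within `T` iterations of DSG with period `I`. -/
def dsgComm (T I : ℕ) : ℕ := ((Finset.range T).filter fun t => (t + 1) % I = 0).card

/-! ### The outer algorithm CoDA -/

/-- The estimate `(1/K) ∑ₖ (h₋ᵏ / N₋ᵏ - h₊ᵏ / N₊ᵏ)` of the dual variable from minibatches of size `m`.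
A ratio over an empty class (`0 / 0`) counts as `0`. -/
def dualEstimate {d K : ℕ} (h : Weights d → X → ℝ) (m : ℕ) (v : Primal d)
    (z : ℕ → Fin K → X × Bool) : ℝ :=
  (1 / (K : ℝ)) * ∑ k,
    ((∑ i ∈ Finset.Icc 1 m, h (wPart v) (z i k).1 * negInd (z i k))
        / (∑ i ∈ Finset.Icc 1 m, negInd (z i k))
      - (∑ i ∈ Finset.Icc 1 m, h (wPart v) (z i k).1 * posInd (z i k))
        / (∑ i ∈ Finset.Icc 1 m, posInd (z i k)))

/-- The pair `(v_s, α_s)` after `s` stages of CoDA, with prox parameter `γ`, step sizes `η s`, stage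
lengths `T s`, communication periods `I s` and minibatch sizes `m s`. Here `train s t k` is the
sample that machine `k` uses in iteration `t` of stage `s`, and `mini s i k` is the `i`-th member of
the minibatch that it draws at the end of stage `s`. -/
def coda {d K : ℕ} (p : ℝ) (h : Weights d → X → ℝ) (γ : ℝ) (η : ℕ → ℝ) (T I m : ℕ → ℕ)
    (train mini : ℕ → ℕ → Fin K → X × Bool) : ℕ → Primal d × ℝ
  | 0 => (0, 0)
  | s + 1 =>
    let prev := coda p h γ η T I m train mini s
    let v := dsgOutput p h γ (η (s + 1)) (T (s + 1)) (I (s + 1)) prev.1 prev.2 (train (s + 1))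
    (v, dualEstimate h (m (s + 1)) v (mini (s + 1)))

/-- All samples are mutually independent, and those of machine `k` have the law `P k`. -/
structure IsSampling {K : ℕ} [MeasurableSpace X] {Ω : Type*} [MeasurableSpace Ω] (Pr : Measure Ω)
    (P : Fin K → Measure (X × Bool)) (train mini : ℕ → ℕ → Fin K → Ω → X × Bool) : Prop where
  measurable_train : ∀ s t k, Measurable (train s t k)
  measurable_mini : ∀ s i k, Measurable (mini s i k)
  law_train : ∀ s t k, Pr.map (train s t k) = P k
  law_mini : ∀ s i k, Pr.map (mini s i k) = P k
  indep : iIndepFun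
    (Sum.elim (fun j : ℕ × ℕ × Fin K => train j.1 j.2.1 j.2.2)
      (fun j : ℕ × ℕ × Fin K => mini j.1 j.2.1 j.2.2)) Pr

/-! ### The parameter schedule -/

/-- `c = (μ/L_v) / (5 + μ/L_v)`. -/
def rate (μ Lv : ℝ) : ℝ := (μ / Lv) / (5 + μ / Lv)

/-- `η_s = η₀ K exp(-(s-1)c)`. -/
def stepSize (K : ℕ) (η₀ c : ℝ) (s : ℕ) : ℝ := η₀ * K * Real.exp (-(((s : ℝ) - 1) * c))

/-- `T_s = max(8, 8 G_h²) / (L_v η₀ K) · exp((s-1)c)`, rounded up. -/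
def stageLength (K : ℕ) (Gh Lv η₀ c : ℝ) (s : ℕ) : ℕ :=
  ⌈max 8 (8 * Gh ^ 2) / (Lv * η₀ * K) * Real.exp (((s : ℝ) - 1) * c)⌉₊

/-- `I_s = max(1, 1/√(K η_s))`, with the second entry rounded down. -/
def commPeriod (K : ℕ) (η₀ c : ℝ) (s : ℕ) : ℕ :=
  max 1 ⌊1 / √((K : ℝ) * stepSize K η₀ c s)⌋₊

/-- `C = 3 p̃^(1/ln(1/p̃)) / (2 ln(1/p̃))`. -/
def batchConst (q : ℝ) : ℝ := 3 * q ^ (1 / Real.log (1 / q)) / (2 * Real.log (1 / q))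

/-- `m_s = max((1+C) / (η_{s+1}² T_{s+1} p² (1-p)²), log K / log(1/p̃))`, rounded up, where
`p̃ = max(p, 1-p)`. -/
def batchSize (K : ℕ) (p Gh Lv η₀ c : ℝ) (s : ℕ) : ℕ :=
  ⌈max ((1 + batchConst (max p (1 - p)))
        / (stepSize K η₀ c (s + 1) ^ 2 * (stageLength K Gh Lv η₀ c (s + 1) : ℝ)
            * p ^ 2 * (1 - p) ^ 2))
      (Real.log K / Real.log (1 / max p (1 - p)))⌉₊

/-- The stage output `v_s` of CoDA run with `γ = 1/(2 L_v)` and the above schedule. -/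
def codaIterate {d K : ℕ} (p Gh Lv μ η₀ : ℝ) (h : Weights d → X → ℝ)
    (train mini : ℕ → ℕ → Fin K → X × Bool) (s : ℕ) : Primal d :=
  (coda p h (1 / (2 * Lv)) (stepSize K η₀ (rate μ Lv)) (stageLength K Gh Lv η₀ (rate μ Lv))
    (commPeriod K η₀ (rate μ Lv)) (batchSize K p Gh Lv η₀ (rate μ Lv)) train mini s).1

/-- The number of iterations (on each machine) of `S` stages. -/
def totalIterations (K : ℕ) (Gh Lv μ η₀ : ℝ) (S : ℕ) : ℕ :=
  ∑ s ∈ Finset.Icc 1 S, stageLength K Gh Lv η₀ (rate μ Lv) s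

/-- The number of communication rounds of `S` stages. In each stage these are the averaging steps
within DSG, one round for its averaged output, and one round for the dual estimate. -/
def totalCommunications (K : ℕ) (Gh Lv μ η₀ : ℝ) (S : ℕ) : ℕ :=
  ∑ s ∈ Finset.Icc 1 S,
    (dsgComm (stageLength K Gh Lv η₀ (rate μ Lv) s) (commPeriod K η₀ (rate μ Lv) s) + 2)

/-- The requirement on the number of stages:
`S ≥ (5L_v+μ)/μ · max{log(2Δ₀/ε), log S + log[(2η₀/ε) (6HB² + 12(σ_v²+σ_α²))/5]}`, with `S ≥ 1`. -/
def EnoughStages (Lv H B σv σα μ Δ₀ η₀ ε : ℝ) (S : ℕ) : Prop :=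
  1 ≤ S ∧
    (5 * Lv + μ) / μ * max (Real.log (2 * Δ₀ / ε))
      (Real.log S
        + Real.log (2 * η₀ / ε * ((6 * H * B ^ 2 + 12 * (σv ^ 2 + σα ^ 2)) / 5))) ≤ (S : ℝ)

/-- The logarithmic factor that the soft-O notation suppresses. -/
def logFactor (μ Δ₀ ε : ℝ) : ℝ := Real.log (3 + 1 / μ + (Δ₀ + 1) / ε)

end CoDA

end

/-! A whole stage is analysed as one inexact gradient step on `phi`.

Because all machines share the class probability p, f(v, ·) is a concave parabola of curvature
p(1-p), centred at the machine average D(w) of the differences of class means (`objF_eq`). So φ(v) =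
f(v, D(w)), and by the envelope argument ∇φ(v) is the averaged expected gradient at (v, D(w))
(`gradient_phi`).

Fix a stage started at (v₀, α₀) and put g = ∇φ(v₀), θ = γ/(η+γ), λ = 2p(1-p)η. Synchronization does
not change the mean over the machines, so the mean displacement x_t from v₀ and the mean dual error
β_t relative to D(w₀) obey x_{t+1} = θ(x_t - η(g + b_t + ξ_t)), β_{t+1} = (1-λ)β_t + λδ_t + ηζ_t.
Without bias and noise, x_t = -γ(1-θ^t)g. The biases b_t, δ_t are controlled by x_t, β_t and the
drift between machines. The noises ξ_t, ζ_t are means of K orthogonal terms. As ηT ≤ 1, the noise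
accumulated in a stage has second moment O(η/K), and the communication period keeps the squared
drift at that level too. `coupled_recursion_bound` closes the resulting bootstrap. Averaging over t
gives v_s = v_{s-1} - Wg + R with W between 15γ/16 and γ and R small in mean square. Smoothness
turns this into `stage_bound`, and the PL inequality into a contraction of the gap
(`expGap_succ_le`).

The dual restart is a ratio estimator. Its bias comes only from empty classes and is at most 2 p̃^m,
and its variance is O(1/(Km)); the batch size makes the squared error O(η_{s+1}/K) = O(η₀ e^{-sc}).
The first start α₀ = 0 is no estimate, but for fixed w the function φ is an explicit quadratic in
(a, b), so D(0)² is dominated by the initial gap. Solving the outer recursion bounds the gap after S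
stages by e^{-c(S-1)}(5Δ₀/4 + S N η₀) with a constant N, and (*) makes this at most ε.

For the complexity, an elementary logarithm inequality shows that S of order Λ/μ suffices for (*).
Minimality of S means that S-1 violates (*), which bounds e^{c(S-1)} from above. Stage lengths grow
like e^{cs} and communications per stage like e^{cs/2}, so both totals are geometric sums. The
constants stay free of μ because the PL inequality at one explicit point bounds μ (`mu_le`). -/

noncomputable section

namespace CoDA

set_option linter.unusedSectionVars false

/-! ### Coordinates of the primal variable -/

/-- The primal variable with components `w`, `a`, `b`. -/
def mkPrimal {d : ℕ} (w : Weights d) (a b : ℝ) : Primal d :=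
  WithLp.toLp 2 (Sum.elim (fun i => w i) ![a, b])

section coordinates

variable {d : ℕ}

@[simp] theorem wPart_mkPrimal (w : Weights d) (a b : ℝ) : wPart (mkPrimal w a b) = w := by
  ext i; simp [wPart, mkPrimal]

@[simp] theorem aPart_mkPrimal (w : Weights d) (a b : ℝ) : aPart (mkPrimal w a b) = a := by
  simp [aPart, mkPrimal]

@[simp] theorem bPart_mkPrimal (w : Weights d) (a b : ℝ) : bPart (mkPrimal w a b) = b := by
  simp [bPart, mkPrimal]

theorem wPart_add (u v : Primal d) : wPart (u + v) = wPart u + wPart v := by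
  ext i; simp [wPart]

theorem wPart_sub (u v : Primal d) : wPart (u - v) = wPart u - wPart v := by
  ext i; simp [wPart]

theorem wPart_smul (c : ℝ) (v : Primal d) : wPart (c • v) = c • wPart v := by
  ext i; simp [wPart]

@[simp] theorem aPart_add (u v : Primal d) : aPart (u + v) = aPart u + aPart v := by simp [aPart]
@[simp] theorem aPart_sub (u v : Primal d) : aPart (u - v) = aPart u - aPart v := by simp [aPart]
@[simp] theorem aPart_smul (c : ℝ) (v : Primal d) : aPart (c • v) = c * aPart v := by simp [aPart]
@[simp] theorem bPart_add (u v : Primal d) : bPart (u + v) = bPart u + bPart v := by simp [bPart]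
@[simp] theorem bPart_sub (u v : Primal d) : bPart (u - v) = bPart u - bPart v := by simp [bPart]
@[simp] theorem bPart_smul (c : ℝ) (v : Primal d) : bPart (c • v) = c * bPart v := by simp [bPart]

theorem aPart_sum {ι : Type*} (s : Finset ι) (f : ι → Primal d) :
    aPart (∑ i ∈ s, f i) = ∑ i ∈ s, aPart (f i) := by
  simp [aPart, WithLp.ofLp_sum]

theorem bPart_sum {ι : Type*} (s : Finset ι) (f : ι → Primal d) :
    bPart (∑ i ∈ s, f i) = ∑ i ∈ s, bPart (f i) := by
  simp [bPart, WithLp.ofLp_sum]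

theorem norm_sq_primal (v : Primal d) :
    ‖v‖ ^ 2 = ‖wPart v‖ ^ 2 + aPart v ^ 2 + bPart v ^ 2 := by
  simp [EuclideanSpace.norm_sq_eq, wPart, aPart, bPart, add_assoc]

theorem norm_wPart_le (v : Primal d) : ‖wPart v‖ ≤ ‖v‖ := by
  have := norm_sq_primal v
  exact abs_le_of_sq_le_sq (by nlinarith [sq_nonneg (aPart v), sq_nonneg (bPart v)])
    (norm_nonneg _) |> (le_abs_self _).trans

theorem abs_aPart_le (v : Primal d) : |aPart v| ≤ ‖v‖ := by
  have := norm_sq_primal v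
  exact abs_le_of_sq_le_sq (by nlinarith [sq_nonneg (‖wPart v‖), sq_nonneg (bPart v)])
    (norm_nonneg _)

theorem abs_bPart_le (v : Primal d) : |bPart v| ≤ ‖v‖ := by
  have := norm_sq_primal v
  exact abs_le_of_sq_le_sq (by nlinarith [sq_nonneg (‖wPart v‖), sq_nonneg (aPart v)])
    (norm_nonneg _)

theorem norm_primal_le (v : Primal d) : ‖v‖ ≤ ‖wPart v‖ + |aPart v| + |bPart v| := by
  refine abs_le_of_sq_le_sq ?_ (by positivity) |> (le_abs_self _).trans
  rw [norm_sq_primal]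
  nlinarith [mul_nonneg (norm_nonneg (wPart v)) (abs_nonneg (aPart v)),
    mul_nonneg (norm_nonneg (wPart v)) (abs_nonneg (bPart v)),
    mul_nonneg (abs_nonneg (aPart v)) (abs_nonneg (bPart v)), sq_abs (aPart v), sq_abs (bPart v)]

theorem inner_mkPrimal (w : Weights d) (a b : ℝ) (u : Primal d) :
    inner ℝ (mkPrimal w a b) u = inner ℝ w (wPart u) + a * aPart u + b * bPart u := by
  simp [PiLp.inner_apply, mkPrimal, wPart, aPart, bPart]
  ring

/-- `wPart` as a continuous linear map. -/
def wPartL (d : ℕ) : Primal d →L[ℝ] Weights d :=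
  LinearMap.toContinuousLinearMap
    { toFun := wPart, map_add' := wPart_add, map_smul' := wPart_smul }

/-- `aPart` as a continuous linear map. -/
def aPartL (d : ℕ) : Primal d →L[ℝ] ℝ :=
  LinearMap.toContinuousLinearMap
    { toFun := aPart, map_add' := aPart_add, map_smul' := aPart_smul }

/-- `bPart` as a continuous linear map. -/
def bPartL (d : ℕ) : Primal d →L[ℝ] ℝ :=
  LinearMap.toContinuousLinearMap
    { toFun := bPart, map_add' := bPart_add, map_smul' := bPart_smul }

@[simp] theorem wPartL_apply (v : Primal d) : wPartL d v = wPart v := rfl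
@[simp] theorem aPartL_apply (v : Primal d) : aPartL d v = aPart v := rfl
@[simp] theorem bPartL_apply (v : Primal d) : bPartL d v = bPart v := rfl

@[fun_prop] theorem continuous_wPart : Continuous (wPart : Primal d → Weights d) :=
  (wPartL d).continuous
@[fun_prop] theorem continuous_aPart : Continuous (aPart : Primal d → ℝ) := (aPartL d).continuous
@[fun_prop] theorem continuous_bPart : Continuous (bPart : Primal d → ℝ) := (bPartL d).continuous

@[fun_prop] theorem measurable_wPart : Measurable (wPart : Primal d → Weights d) :=
  continuous_wPart.measurable
@[fun_prop] theorem measurable_aPart : Measurable (aPart : Primal d → ℝ) :=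
  continuous_aPart.measurable
@[fun_prop] theorem measurable_bPart : Measurable (bPart : Primal d → ℝ) :=
  continuous_bPart.measurable

theorem continuous_mkPrimal :
    Continuous fun q : Weights d × ℝ × ℝ => mkPrimal q.1 q.2.1 q.2.2 := by
  refine (PiLp.continuous_toLp 2 _).comp (continuous_pi fun i => ?_)
  rcases i with i | i
  · simp only [Sum.elim_inl]; fun_prop
  · fin_cases i <;> simp <;> fun_prop

end coordinates

/-! ### The score and its gradient -/

section labels

variable {X : Type*}

theorem negInd_eq (z : X × Bool) : negInd z = 1 - posInd z := by
  rcases z with ⟨x, _ | _⟩ <;> simp [negInd, posInd]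

theorem posInd_mem (z : X × Bool) : posInd z = 0 ∨ posInd z = 1 := by
  rcases z with ⟨x, _ | _⟩ <;> simp [posInd]

@[fun_prop] theorem measurable_posInd [MeasurableSpace X] :
    Measurable (posInd : X × Bool → ℝ) := by
  refine Measurable.ite ?_ measurable_const measurable_const
  exact measurable_snd (measurableSet_singleton true)

@[fun_prop] theorem measurable_negInd [MeasurableSpace X] :
    Measurable (negInd : X × Bool → ℝ) := by
  refine Measurable.ite ?_ measurable_const measurable_const
  exact measurable_snd (measurableSet_singleton false)

end labels

section score

variable {d K : ℕ} {X : Type*} [MeasurableSpace X] {p Gh Lh L1 μ Δ₀ : ℝ}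
  {h : Weights d → X → ℝ} {P : Fin K → Measure (X × Bool)}

theorem Assumptions.hasGradientAt_score (hA : Assumptions p Gh Lh L1 μ Δ₀ h P) (x : X)
    (w : Weights d) : HasGradientAt (fun u => h u x) (gradient (fun u => h u x) w) w :=
  (hA.score_differentiable x w).hasGradientAt

theorem Assumptions.score_lipschitz (hA : Assumptions p Gh Lh L1 μ Δ₀ h P) (x : X)
    (w w' : Weights d) : |h w x - h w' x| ≤ Gh * ‖w - w'‖ := by
  have := Convex.norm_image_sub_le_of_norm_hasFDerivWithin_le (𝕜 := ℝ) (s := Set.univ)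
    (f := fun u => h u x) (C := Gh) (x := w') (y := w)
    (f' := fun u => InnerProductSpace.toDual ℝ _ (gradient (fun u => h u x) u))
    (fun u _ => (hA.hasGradientAt_score x u).hasFDerivAt.hasFDerivWithinAt)
    (fun u _ => by rw [LinearIsometryEquiv.norm_map]; exact hA.score_grad_le x u) convex_univ trivial trivial
  simpa using this

theorem Assumptions.continuous_score (hA : Assumptions p Gh Lh L1 μ Δ₀ h P) (x : X) :
    Continuous fun w => h w x :=
  (hA.score_differentiable x).continuous

theorem Assumptions.continuous_gradient (hA : Assumptions p Gh Lh L1 μ Δ₀ h P) (x : X) :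
    Continuous fun w => gradient (fun u => h u x) w := by
  have : LipschitzWith (Real.toNNReal Lh) fun w => gradient (fun u => h u x) w := by
    refine LipschitzWith.of_dist_le_mul fun a b => ?_
    rw [dist_eq_norm, dist_eq_norm]
    exact (hA.score_smooth x a b).trans
      (mul_le_mul_of_nonneg_right (Real.le_coe_toNNReal _) (norm_nonneg _))
  exact this.continuous

/-- Each coordinate of the gradient is a pointwise limit of difference quotients, which are
measurable in x. -/
theorem Assumptions.measurable_gradient (hA : Assumptions p Gh Lh L1 μ Δ₀ h P)
    (w : Weights d) : Measurable fun x => gradient (fun u => h u x) w := by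
  have key : ∀ i, Measurable fun x => gradient (fun u => h u x) w i := by
    intro i
    refine measurable_of_tendsto_metrizable (f := fun (n : ℕ) x =>
      ((1 / ((n : ℝ) + 1))⁻¹ • (h (w + (1 / ((n : ℝ) + 1)) • EuclideanSpace.single i 1) x - h w x)))
      ?_ ?_
    · intro n
      simp only [smul_eq_mul]
      exact ((hA.measurable_score _).sub (hA.measurable_score w)).const_mul _
    · rw [tendsto_pi_nhds]
      intro x
      have h1 := (hA.hasGradientAt_score x w).hasFDerivAt.hasLineDerivAt
        (EuclideanSpace.single i (1 : ℝ))
      have h2 := h1.tendsto_slope_zero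
      have h3 : Filter.Tendsto (fun n : ℕ => 1 / ((n : ℝ) + 1)) Filter.atTop
          (nhdsWithin 0 {0}ᶜ) := by
        refine tendsto_nhdsWithin_iff.mpr ⟨tendsto_one_div_add_atTop_nhds_zero_nat, ?_⟩
        refine Filter.Eventually.of_forall fun n => ?_
        simp only [Set.mem_compl_iff, Set.mem_singleton_iff]
        positivity
      have h4 := h2.comp h3
      have h5 : (InnerProductSpace.toDual ℝ (Weights d)) (gradient (fun u => h u x) w)
          (EuclideanSpace.single i (1 : ℝ)) = gradient (fun u => h u x) w i := by
        rw [InnerProductSpace.toDual_apply_apply, EuclideanSpace.inner_single_right]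
        simp
      rw [h5] at h4
      refine h4.congr fun n => ?_
      simp
  have h1 : Measurable fun x => (fun i => gradient (fun u => h u x) w i) :=
    measurable_pi_lambda _ key
  exact (PiLp.continuous_toLp 2 _).measurable.comp h1

/-- A Carathéodory function: continuous in w and measurable in x, hence jointly measurable. This is
needed because scores are evaluated at random iterates. -/
theorem Assumptions.measurable_score_uncurry (hA : Assumptions p Gh Lh L1 μ Δ₀ h P) :
    Measurable fun q : Weights d × X => h q.1 q.2 :=
  measurable_uncurry_of_continuous_of_measurable (u := h) hA.continuous_score hA.measurable_score

theorem Assumptions.measurable_gradient_uncurry (hA : Assumptions p Gh Lh L1 μ Δ₀ h P) :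
    Measurable fun q : Weights d × X => gradient (fun u => h u q.2) q.1 :=
  measurable_uncurry_of_continuous_of_measurable
    (u := fun w x => gradient (fun u => h u x) w) hA.continuous_gradient hA.measurable_gradient

end score

/-! ### The stochastic gradients -/

section gradients

variable {d : ℕ} {X : Type*}

/-- The factor of `∇_w h` in `∇_w F`. -/
def scoreCoef (p : ℝ) (h : Weights d → X → ℝ) (v : Primal d) (α : ℝ) (z : X × Bool) : ℝ :=
  2 * (1 - p) * (h (wPart v) z.1 - aPart v) * posInd z
    + 2 * p * (h (wPart v) z.1 - bPart v) * negInd z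
    + 2 * (1 + α) * (p * negInd z - (1 - p) * posInd z)

/-- Closed form of `∇_v F`. -/
def lossGrad (p : ℝ) (h : Weights d → X → ℝ) (v : Primal d) (α : ℝ) (z : X × Bool) : Primal d :=
  mkPrimal (scoreCoef p h v α z • gradient (fun u => h u z.1) (wPart v))
    (-(2 * (1 - p) * (h (wPart v) z.1 - aPart v) * posInd z))
    (-(2 * p * (h (wPart v) z.1 - bPart v) * negInd z))

/-- Closed form of `∇_α F`. -/
def lossGradDual (p : ℝ) (h : Weights d → X → ℝ) (v : Primal d) (α : ℝ) (z : X × Bool) : ℝ :=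
  2 * (p * h (wPart v) z.1 * negInd z - (1 - p) * h (wPart v) z.1 * posInd z)
    - 2 * (p * (1 - p)) * α

theorem gradAlpha_eq (p : ℝ) (h : Weights d → X → ℝ) (v : Primal d) (α : ℝ) (z : X × Bool) :
    gradAlpha p h v α z = lossGradDual p h v α z := by
  unfold gradAlpha lossF lossGradDual
  set A := (1 - p) * (h (wPart v) z.1 - aPart v) ^ 2 * posInd z
    + p * (h (wPart v) z.1 - bPart v) ^ 2 * negInd z
  set B := p * h (wPart v) z.1 * negInd z - (1 - p) * h (wPart v) z.1 * posInd z
  have h1 : HasDerivAt (fun β : ℝ => A + 2 * (1 + β) * B - p * (1 - p) * β ^ 2)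
      (0 + 2 * (0 + 1) * B - p * (1 - p) * (2 * α ^ 1 * 1)) α := by
    refine ((hasDerivAt_const _ _).add ((((hasDerivAt_const _ _).add (hasDerivAt_id _)).const_mul
      2).mul_const B)).sub (((hasDerivAt_id α).pow 2).const_mul _)
  rw [h1.deriv]
  ring

variable {K : ℕ} [MeasurableSpace X] {p Gh Lh L1 μ Δ₀ : ℝ}
  {h : Weights d → X → ℝ} {P : Fin K → Measure (X × Bool)}

theorem Assumptions.hasGradientAt_lossF (hA : Assumptions p Gh Lh L1 μ Δ₀ h P) (v : Primal d)
    (α : ℝ) (z : X × Bool) :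
    HasGradientAt (fun u => lossF p h u α z) (lossGrad p h v α z) v := by
  have hw : HasFDerivAt (fun u : Primal d => h (wPart u) z.1)
      ((InnerProductSpace.toDual ℝ _ (gradient (fun u => h u z.1) (wPart v))).comp (wPartL d)) v :=
    (hA.hasGradientAt_score z.1 (wPart v)).hasFDerivAt.comp v (wPartL d).hasFDerivAt
  have ha : HasFDerivAt (fun u : Primal d => aPart u) (aPartL d) v := (aPartL d).hasFDerivAt
  have hb : HasFDerivAt (fun u : Primal d => bPart u) (bPartL d) v := (bPartL d).hasFDerivAt
  have h1 := ((((hw.sub ha).pow 2).const_mul (1 - p)).mul_const (posInd z)).add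
    ((((hw.sub hb).pow 2).const_mul p).mul_const (negInd z))
  have h2 := (((hw.const_mul p).mul_const (negInd z)).sub
    ((hw.const_mul (1 - p)).mul_const (posInd z))).const_mul (2 * (1 + α))
  have h3 := (h1.add h2).sub_const (p * (1 - p) * α ^ 2)
  rw [hasGradientAt_iff_hasFDerivAt]
  refine h3.congr_fderiv ?_
  ext u
  simp [lossGrad, inner_mkPrimal, scoreCoef, inner_smul_left]
  ring

theorem Assumptions.gradV_eq (hA : Assumptions p Gh Lh L1 μ Δ₀ h P) (v : Primal d)
    (α : ℝ) (z : X × Bool) : gradV p h v α z = lossGrad p h v α z :=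
  (hA.hasGradientAt_lossF v α z).gradient

theorem Assumptions.measurable_score_comp (hA : Assumptions p Gh Lh L1 μ Δ₀ h P)
    {Ω : Type*} [MeasurableSpace Ω] {v : Ω → Primal d} {z : Ω → X × Bool} (hv : Measurable v)
    (hz : Measurable z) : Measurable fun ω => h (wPart (v ω)) (z ω).1 :=
  hA.measurable_score_uncurry.comp ((measurable_wPart.comp hv).prodMk (measurable_fst.comp hz))

theorem Assumptions.measurable_lossF (hA : Assumptions p Gh Lh L1 μ Δ₀ h P)
    {Ω : Type*} [MeasurableSpace Ω] {v : Ω → Primal d} {α : Ω → ℝ} {z : Ω → X × Bool}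
    (hv : Measurable v) (hα : Measurable α) (hz : Measurable z) :
    Measurable fun ω => lossF p h (v ω) (α ω) (z ω) := by
  have h1 := hA.measurable_score_comp hv hz
  have h2 : Measurable fun ω => posInd (z ω) := measurable_posInd.comp hz
  have h3 : Measurable fun ω => negInd (z ω) := measurable_negInd.comp hz
  have h4 : Measurable fun ω => aPart (v ω) := measurable_aPart.comp hv
  have h5 : Measurable fun ω => bPart (v ω) := measurable_bPart.comp hv
  have key : ∀ s a b q n β : Ω → ℝ, Measurable s → Measurable a → Measurable b → Measurable q →
      Measurable n → Measurable β → Measurable fun ω =>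
        (1 - p) * (s ω - a ω) ^ 2 * q ω + p * (s ω - b ω) ^ 2 * n ω
          + 2 * (1 + β ω) * (p * s ω * n ω - (1 - p) * s ω * q ω) - p * (1 - p) * β ω ^ 2 := by
    intros; fun_prop
  exact key _ _ _ _ _ _ h1 h4 h5 h2 h3 hα

theorem Assumptions.measurable_lossGrad (hA : Assumptions p Gh Lh L1 μ Δ₀ h P)
    {Ω : Type*} [MeasurableSpace Ω] {v : Ω → Primal d} {α : Ω → ℝ} {z : Ω → X × Bool}
    (hv : Measurable v) (hα : Measurable α) (hz : Measurable z) :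
    Measurable fun ω => lossGrad p h (v ω) (α ω) (z ω) := by
  have h1 := hA.measurable_score_comp hv hz
  have h2 : Measurable fun ω => posInd (z ω) := measurable_posInd.comp hz
  have h3 : Measurable fun ω => negInd (z ω) := measurable_negInd.comp hz
  have h4 : Measurable fun ω => aPart (v ω) := measurable_aPart.comp hv
  have h5 : Measurable fun ω => bPart (v ω) := measurable_bPart.comp hv
  have h6 : Measurable fun ω => gradient (fun u => h u (z ω).1) (wPart (v ω)) :=
    hA.measurable_gradient_uncurry.comp
      ((measurable_wPart.comp hv).prodMk (measurable_fst.comp hz))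
  have h7 : Measurable fun ω => scoreCoef p h (v ω) (α ω) (z ω) := by
    have key : ∀ s a b q n β : Ω → ℝ, Measurable s → Measurable a → Measurable b → Measurable q →
        Measurable n → Measurable β → Measurable fun ω =>
          2 * (1 - p) * (s ω - a ω) * q ω + 2 * p * (s ω - b ω) * n ω
            + 2 * (1 + β ω) * (p * n ω - (1 - p) * q ω) := by
      intros; fun_prop
    exact key _ _ _ _ _ _ h1 h4 h5 h2 h3 hα
  have key : ∀ (c : ℝ) (s a q : Ω → ℝ), Measurable s → Measurable a → Measurable q →
      Measurable fun ω => -(c * (s ω - a ω) * q ω) := by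
    intros; fun_prop
  exact continuous_mkPrimal.measurable.comp ((h7.smul h6).prodMk
    ((key _ _ _ _ h1 h4 h2).prodMk (key _ _ _ _ h1 h5 h3)))

theorem Assumptions.measurable_lossGradDual (hA : Assumptions p Gh Lh L1 μ Δ₀ h P)
    {Ω : Type*} [MeasurableSpace Ω] {v : Ω → Primal d} {α : Ω → ℝ} {z : Ω → X × Bool}
    (hv : Measurable v) (hα : Measurable α) (hz : Measurable z) :
    Measurable fun ω => lossGradDual p h (v ω) (α ω) (z ω) := by
  have h1 := hA.measurable_score_comp hv hz
  have h2 : Measurable fun ω => posInd (z ω) := measurable_posInd.comp hz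
  have h3 : Measurable fun ω => negInd (z ω) := measurable_negInd.comp hz
  have key : ∀ s q n β : Ω → ℝ, Measurable s → Measurable q → Measurable n → Measurable β →
      Measurable fun ω => 2 * (p * s ω * n ω - (1 - p) * s ω * q ω) - 2 * (p * (1 - p)) * β ω := by
    intros; fun_prop
  exact key _ _ _ _ h1 h2 h3 hα

end gradients

/-! ### Bounds for the stochastic gradients -/

/-- An a priori bound for the dual variable. -/
def dualBound (p : ℝ) : ℝ := 1 / (p * (1 - p))

/-- A bound for `∇_v F`. -/
def gradBound (p Gh : ℝ) : ℝ := (8 + 2 * dualBound p) * Gh + 12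

/-- A Lipschitz constant for `∇_v F`. -/
def gradLip (p Gh Lh : ℝ) : ℝ :=
  (4 * Gh + 4) * Gh + (8 + 2 * dualBound p) * Lh + 4 * (Gh + 1) + 2 * Gh

theorem one_le_dualBound {p : ℝ} (hp0 : 0 < p) (hp1 : p < 1) : 1 ≤ dualBound p := by
  have : 0 < p * (1 - p) := mul_pos hp0 (by linarith)
  rw [dualBound, le_div_iff₀ this]
  nlinarith

theorem dualBound_mul {p : ℝ} (hp0 : 0 < p) (hp1 : p < 1) : p * (1 - p) * dualBound p = 1 := by
  have : 0 < p * (1 - p) := mul_pos hp0 (by linarith)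
  rw [dualBound, mul_one_div_cancel this.ne']

theorem gradBound_pos {p Gh : ℝ} (hp0 : 0 < p) (hp1 : p < 1) (hGh : 0 ≤ Gh) :
    0 < gradBound p Gh := by
  have := one_le_dualBound hp0 hp1
  unfold gradBound; positivity

theorem gradLip_pos {p Gh Lh : ℝ} (hp0 : 0 < p) (hp1 : p < 1) (hGh : 0 ≤ Gh) (hLh : 0 ≤ Lh) :
    0 < gradLip p Gh Lh := by
  have := one_le_dualBound hp0 hp1
  unfold gradLip; positivity

section bounds

variable {d K : ℕ} {X : Type*} [MeasurableSpace X] {p Gh Lh L1 μ Δ₀ : ℝ}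
  {h : Weights d → X → ℝ} {P : Fin K → Measure (X × Bool)}

theorem Assumptions.abs_scoreCoef_le (hA : Assumptions p Gh Lh L1 μ Δ₀ h P) (hp0 : 0 < p)
    (hp1 : p < 1) {R A α : ℝ} {v : Primal d} (ha : |aPart v| ≤ R) (hb : |bPart v| ≤ R)
    (hα : |α| ≤ A) (z : X × Bool) : |scoreCoef p h v α z| ≤ 2 * (1 + R) + 2 * (1 + A) := by
  obtain ⟨h0, h1⟩ := hA.score_mem (wPart v) z.1
  have hR : 0 ≤ R := (abs_nonneg _).trans ha
  have hA0 : 0 ≤ A := (abs_nonneg _).trans hα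
  rw [abs_le] at ha hb hα
  unfold scoreCoef
  rw [negInd_eq]
  set s := h (wPart v) z.1
  have e1 : |s - aPart v| ≤ 1 + R := by rw [abs_le]; constructor <;> linarith
  have e2 : |s - bPart v| ≤ 1 + R := by rw [abs_le]; constructor <;> linarith
  have e3 : |1 + α| ≤ 1 + A := by rw [abs_le]; constructor <;> linarith
  rcases posInd_mem z with hz | hz <;> rw [hz]
  · have : 2 * (1 - p) * (s - aPart v) * 0 + 2 * p * (s - bPart v) * (1 - 0)
        + 2 * (1 + α) * (p * (1 - 0) - (1 - p) * 0) = p * (2 * (s - bPart v) + 2 * (1 + α)) := by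
      ring
    rw [this, abs_mul, abs_of_pos hp0]
    have : |2 * (s - bPart v) + 2 * (1 + α)| ≤ 2 * (1 + R) + 2 * (1 + A) := by
      refine (abs_add_le _ _).trans ?_
      rw [abs_mul, abs_mul, abs_two]; linarith
    nlinarith [abs_nonneg (2 * (s - bPart v) + 2 * (1 + α))]
  · have : 2 * (1 - p) * (s - aPart v) * 1 + 2 * p * (s - bPart v) * (1 - 1)
        + 2 * (1 + α) * (p * (1 - 1) - (1 - p) * 1)
        = (1 - p) * (2 * (s - aPart v) - 2 * (1 + α)) := by ring
    rw [this, abs_mul, abs_of_pos (by linarith : (0:ℝ) < 1 - p)]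
    have : |2 * (s - aPart v) - 2 * (1 + α)| ≤ 2 * (1 + R) + 2 * (1 + A) := by
      refine (abs_sub _ _).trans ?_
      rw [abs_mul, abs_mul, abs_two]; linarith
    nlinarith [abs_nonneg (2 * (s - aPart v) - 2 * (1 + α))]

theorem abs_const_mul_ind_le {c s i R : ℝ} (hc0 : 0 ≤ c) (hc1 : c ≤ 2) (hs : |s| ≤ R)
    (hi : i = 0 ∨ i = 1) : |c * s * i| ≤ 2 * R := by
  have hR : 0 ≤ R := (abs_nonneg _).trans hs
  rcases hi with rfl | rfl
  · simp [hR]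
  · rw [mul_one, abs_mul, abs_of_nonneg hc0]
    exact mul_le_mul hc1 hs (abs_nonneg _) (by norm_num)

theorem negInd_mem {X : Type*} (z : X × Bool) : negInd z = 0 ∨ negInd z = 1 := by
  rw [negInd_eq]
  rcases posInd_mem z with hz | hz <;> rw [hz] <;> simp

theorem Assumptions.norm_lossGrad_le' (hA : Assumptions p Gh Lh L1 μ Δ₀ h P) (hp0 : 0 < p)
    (hp1 : p < 1) {R A α : ℝ} {v : Primal d} (ha : |aPart v| ≤ R) (hb : |bPart v| ≤ R)
    (hα : |α| ≤ A) (z : X × Bool) :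
    ‖lossGrad p h v α z‖ ≤ (2 * (1 + R) + 2 * (1 + A)) * Gh + 4 * (1 + R) := by
  have hc := hA.abs_scoreCoef_le hp0 hp1 ha hb hα z
  obtain ⟨h0, h1⟩ := hA.score_mem (wPart v) z.1
  rw [abs_le] at ha hb
  refine (norm_primal_le _).trans ?_
  simp only [lossGrad, wPart_mkPrimal, aPart_mkPrimal, bPart_mkPrimal, abs_neg, norm_smul,
    Real.norm_eq_abs]
  have e1 := mul_le_mul hc (hA.score_grad_le z.1 (wPart v)) (norm_nonneg _)
    ((abs_nonneg _).trans hc)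
  have e2 : |2 * (1 - p) * (h (wPart v) z.1 - aPart v) * posInd z| ≤ 2 * (1 + R) :=
    abs_const_mul_ind_le (by linarith) (by linarith)
      (abs_le.mpr ⟨by linarith, by linarith⟩) (posInd_mem z)
  have e3 : |2 * p * (h (wPart v) z.1 - bPart v) * negInd z| ≤ 2 * (1 + R) :=
    abs_const_mul_ind_le (by linarith) (by linarith)
      (abs_le.mpr ⟨by linarith, by linarith⟩) (negInd_mem z)
  linarith

theorem Assumptions.norm_lossGrad_le (hA : Assumptions p Gh Lh L1 μ Δ₀ h P) (hp0 : 0 < p)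
    (hp1 : p < 1) {α : ℝ} {v : Primal d} (hv : v ∈ box d)
    (hα : |α| ≤ dualBound p) (z : X × Bool) : ‖lossGrad p h v α z‖ ≤ gradBound p Gh := by
  have := hA.norm_lossGrad_le' hp0 hp1 (hv.1.trans one_le_two) (hv.2.trans one_le_two) hα z
  unfold gradBound
  linarith

/-- Product rule for coefficient times score gradient. The split below puts the bounded coefficient
at the primed point, so only that point needs an a priori bound; the score gradient is bounded
everywhere. -/
theorem Assumptions.lossGrad_lipschitz (hA : Assumptions p Gh Lh L1 μ Δ₀ h P) (hp0 : 0 < p)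
    (hp1 : p < 1) (hGh : 0 ≤ Gh) (hLh : 0 ≤ Lh) {α α' : ℝ} {v v' : Primal d} (hv' : v' ∈ box d)
    (hα' : |α'| ≤ dualBound p) (z : X × Bool) :
    ‖lossGrad p h v α z - lossGrad p h v' α' z‖ ≤ gradLip p Gh Lh * (‖v - v'‖ + |α - α'|) := by
  have hc := hA.abs_scoreCoef_le hp0 hp1 (hv'.1.trans one_le_two) (hv'.2.trans one_le_two) hα' z
  have hs := hA.score_lipschitz z.1 (wPart v) (wPart v')
  have hw : ‖wPart v - wPart v'‖ ≤ ‖v - v'‖ := by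
    rw [← wPart_sub]; exact norm_wPart_le _
  have ha : |aPart v - aPart v'| ≤ ‖v - v'‖ := by
    rw [← aPart_sub]; exact abs_aPart_le _
  have hb : |bPart v - bPart v'| ≤ ‖v - v'‖ := by
    rw [← bPart_sub]; exact abs_bPart_le _
  have hs' : |h (wPart v) z.1 - h (wPart v') z.1| ≤ Gh * ‖v - v'‖ :=
    hs.trans (mul_le_mul_of_nonneg_left hw hGh)
  set N := ‖v - v'‖
  have hN : 0 ≤ N := norm_nonneg _
  set M := |α - α'|
  have hM : 0 ≤ M := abs_nonneg _
  have ea : |2 * (1 - p) * ((h (wPart v) z.1 - h (wPart v') z.1) - (aPart v - aPart v'))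
      * posInd z| ≤ 2 * (Gh * N + N) :=
    abs_const_mul_ind_le (by linarith) (by linarith)
      ((abs_sub _ _).trans (by linarith)) (posInd_mem z)
  have eb : |2 * p * ((h (wPart v) z.1 - h (wPart v') z.1) - (bPart v - bPart v'))
      * negInd z| ≤ 2 * (Gh * N + N) :=
    abs_const_mul_ind_le (by linarith) (by linarith)
      ((abs_sub _ _).trans (by linarith)) (negInd_mem z)
  have ec : |2 * (α - α') * (p * negInd z - (1 - p) * posInd z)| ≤ 2 * M := by
    have : |p * negInd z - (1 - p) * posInd z| ≤ 1 := by
      rw [negInd_eq]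
      rcases posInd_mem z with hz | hz <;> rw [hz, abs_le] <;> constructor <;> linarith
    rw [abs_mul, abs_mul, abs_two]
    nlinarith [abs_nonneg (p * negInd z - (1 - p) * posInd z)]
  have hcd : |scoreCoef p h v α z - scoreCoef p h v' α' z| ≤ 4 * (Gh * N + N) + 2 * M := by
    have : scoreCoef p h v α z - scoreCoef p h v' α' z =
        2 * (1 - p) * ((h (wPart v) z.1 - h (wPart v') z.1) - (aPart v - aPart v')) * posInd z
        + 2 * p * ((h (wPart v) z.1 - h (wPart v') z.1) - (bPart v - bPart v')) * negInd z
        + 2 * (α - α') * (p * negInd z - (1 - p) * posInd z) := by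
      unfold scoreCoef; ring
    rw [this]
    exact (abs_add_three _ _ _).trans (by linarith)
  refine (norm_primal_le _).trans ?_
  simp only [lossGrad, wPart_sub, aPart_sub, bPart_sub, wPart_mkPrimal, aPart_mkPrimal,
    bPart_mkPrimal]
  have e1 : ‖scoreCoef p h v α z • gradient (fun u => h u z.1) (wPart v)
      - scoreCoef p h v' α' z • gradient (fun u => h u z.1) (wPart v')‖
      ≤ (4 * (Gh * N + N) + 2 * M) * Gh + (8 + 2 * dualBound p) * (Lh * N) := by
    have : scoreCoef p h v α z • gradient (fun u => h u z.1) (wPart v)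
      - scoreCoef p h v' α' z • gradient (fun u => h u z.1) (wPart v')
      = (scoreCoef p h v α z - scoreCoef p h v' α' z) • gradient (fun u => h u z.1) (wPart v)
        + scoreCoef p h v' α' z • (gradient (fun u => h u z.1) (wPart v)
          - gradient (fun u => h u z.1) (wPart v')) := by
      rw [sub_smul, smul_sub]; abel
    rw [this]
    refine (norm_add_le _ _).trans ?_
    rw [norm_smul, norm_smul, Real.norm_eq_abs, Real.norm_eq_abs]
    refine add_le_add ?_ ?_
    · exact mul_le_mul hcd (hA.score_grad_le z.1 (wPart v)) (norm_nonneg _)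
        ((abs_nonneg _).trans hcd)
    · refine mul_le_mul (hc.trans (by linarith)) ?_ (norm_nonneg _) ?_
      · exact (hA.score_smooth z.1 _ _).trans (mul_le_mul_of_nonneg_left hw hLh)
      · have := one_le_dualBound hp0 hp1
        linarith
  have e2 : |-(2 * (1 - p) * (h (wPart v) z.1 - aPart v) * posInd z)
      - -(2 * (1 - p) * (h (wPart v') z.1 - aPart v') * posInd z)| ≤ 2 * (Gh * N + N) := by
    rw [← abs_neg]; convert ea using 2; ring
  have e3 : |-(2 * p * (h (wPart v) z.1 - bPart v) * negInd z)
      - -(2 * p * (h (wPart v') z.1 - bPart v') * negInd z)| ≤ 2 * (Gh * N + N) := by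
    rw [← abs_neg]; convert eb using 2; ring
  have hD := one_le_dualBound hp0 hp1
  -- The true estimate has different constants for the primal and the dual distance; `gradLip` is
  -- their sum, and the surplus terms are nonnegative.
  have e4 : 0 ≤ ((4 * Gh + 4) * Gh + (8 + 2 * dualBound p) * Lh + 4 * (Gh + 1)) * M := by
    positivity
  have e5 : 0 ≤ 2 * Gh * N := by positivity
  unfold gradLip
  nlinarith

theorem Assumptions.abs_lossGradDual_le (hA : Assumptions p Gh Lh L1 μ Δ₀ h P) (hp0 : 0 < p)
    (hp1 : p < 1) {α : ℝ} (v : Primal d) (hα : |α| ≤ dualBound p) (z : X × Bool) :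
    |lossGradDual p h v α z| ≤ 4 := by
  obtain ⟨h0, h1⟩ := hA.score_mem (wPart v) z.1
  have hk : 0 < p * (1 - p) := mul_pos hp0 (by linarith)
  have e1 : |2 * (p * (1 - p)) * α| ≤ 2 := by
    rw [abs_mul, abs_of_pos (by linarith)]
    have := mul_le_mul_of_nonneg_left hα hk.le
    rw [dualBound_mul hp0 hp1] at this
    linarith
  have e2 : |2 * (p * h (wPart v) z.1 * negInd z - (1 - p) * h (wPart v) z.1 * posInd z)| ≤ 2 := by
    rw [negInd_eq]
    rcases posInd_mem z with hz | hz <;> rw [hz, abs_le] <;> constructor <;> nlinarith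
  unfold lossGradDual
  exact (abs_sub _ _).trans (by linarith)

theorem Assumptions.abs_lossF_le (hA : Assumptions p Gh Lh L1 μ Δ₀ h P) (hp0 : 0 < p)
    (hp1 : p < 1) {R A α : ℝ} {v : Primal d} (ha : |aPart v| ≤ R) (hb : |bPart v| ≤ R)
    (hα : |α| ≤ A) (z : X × Bool) :
    |lossF p h v α z| ≤ (1 + R) ^ 2 + 2 * (1 + A) + A ^ 2 := by
  obtain ⟨h0, h1⟩ := hA.score_mem (wPart v) z.1
  have hR : 0 ≤ R := (abs_nonneg _).trans ha
  have hA0 : 0 ≤ A := (abs_nonneg _).trans hα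
  have hk : 0 < p * (1 - p) := mul_pos hp0 (by linarith)
  have hα2 : α ^ 2 ≤ A ^ 2 := sq_le_sq' (abs_le.mp hα).1 (abs_le.mp hα).2
  rw [abs_le] at ha hb hα
  unfold lossF
  rw [negInd_eq]
  set s := h (wPart v) z.1
  have e1 : (s - aPart v) ^ 2 ≤ (1 + R) ^ 2 := sq_le_sq' (by linarith) (by linarith)
  have e2 : (s - bPart v) ^ 2 ≤ (1 + R) ^ 2 := sq_le_sq' (by linarith) (by linarith)
  have e3 : p * (1 - p) * α ^ 2 ≤ A ^ 2 :=
    (mul_le_of_le_one_left (sq_nonneg α) (by nlinarith)).trans hα2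
  have e4 : 0 ≤ p * (1 - p) * α ^ 2 := by positivity
  have key : ∀ q B : ℝ, 0 < q → q < 1 → 0 ≤ B → B ≤ (1 + R) ^ 2 →
      -(2 * (1 + A)) ≤ 2 * (1 + α) * (q * s) ∧ 2 * (1 + α) * (q * s) ≤ 2 * (1 + A) ∧
      0 ≤ q * B ∧ q * B ≤ (1 + R) ^ 2 := by
    intro q B hq0 hq1 hB0 hB
    have h2 : q * s ≤ 1 := by nlinarith
    have h3 : 0 ≤ q * s := by positivity
    refine ⟨by nlinarith, by nlinarith, by positivity, by nlinarith⟩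
  rcases posInd_mem z with hz | hz <;> rw [hz, abs_le]
  · obtain ⟨k1, k2, k3, k4⟩ := key p _ hp0 hp1 (sq_nonneg (s - bPart v)) e2
    constructor <;> nlinarith
  · obtain ⟨k1, k2, k3, k4⟩ := key (1 - p) _ (by linarith) (by linarith)
      (sq_nonneg (s - aPart v)) e1
    constructor <;> nlinarith

end bounds

/-! ### Expected gradients and the primal objective -/

section expectations

variable {d K : ℕ} {X : Type*} [MeasurableSpace X]

/-- The conditional mean of the score in the positive class. -/
def posMean (p : ℝ) (h : Weights d → X → ℝ) (Q : Measure (X × Bool)) (w : Weights d) : ℝ :=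
  (∫ z, h w z.1 * posInd z ∂Q) / p

/-- The conditional mean of the score in the negative class. -/
def negMean (p : ℝ) (h : Weights d → X → ℝ) (Q : Measure (X × Bool)) (w : Weights d) : ℝ :=
  (∫ z, h w z.1 * negInd z ∂Q) / (1 - p)

/-- The difference of the conditional means, which maximizes `E_Q F(v, ·; z)`. -/
def classGap (p : ℝ) (h : Weights d → X → ℝ) (Q : Measure (X × Bool)) (w : Weights d) : ℝ :=
  negMean p h Q w - posMean p h Q w

/-- The maximizer `α` of `f(v, ·)`. -/
def dualOpt (p : ℝ) (h : Weights d → X → ℝ) (P : Fin K → Measure (X × Bool)) (w : Weights d) : ℝ :=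
  (1 / (K : ℝ)) * ∑ k, classGap p h (P k) w

/-- The expected primal gradient. -/
def meanGrad (p : ℝ) (h : Weights d → X → ℝ) (Q : Measure (X × Bool)) (v : Primal d) (α : ℝ) :
    Primal d :=
  ∫ z, lossGrad p h v α z ∂Q

/-- The gradient of `φ` on the box, by the envelope theorem. -/
def phiGrad (p : ℝ) (h : Weights d → X → ℝ) (P : Fin K → Measure (X × Bool)) (v : Primal d) :
    Primal d :=
  (1 / (K : ℝ)) • ∑ k, meanGrad p h (P k) v (dualOpt p h P (wPart v))

theorem abs_average_le {K : ℕ} {f : Fin K → ℝ} {C : ℝ} (hC : 0 ≤ C) (hf : ∀ k, |f k| ≤ C) :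
    |(1 / (K : ℝ)) * ∑ k, f k| ≤ C := by
  rcases Nat.eq_zero_or_pos K with rfl | hK
  · simpa using hC
  have hK' : (0 : ℝ) < K := by exact_mod_cast hK
  rw [abs_mul, abs_of_pos (by positivity : 0 < 1 / (K : ℝ)), one_div, inv_mul_le_iff₀ hK']
  refine (Finset.abs_sum_le_sum_abs _ _).trans ?_
  refine (Finset.sum_le_sum fun k _ => hf k).trans ?_
  simp

theorem norm_average_le {K : ℕ} {E : Type*} [NormedAddCommGroup E] [NormedSpace ℝ E]
    {f : Fin K → E} {C : ℝ} (hC : 0 ≤ C) (hf : ∀ k, ‖f k‖ ≤ C) :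
    ‖(1 / (K : ℝ)) • ∑ k, f k‖ ≤ C := by
  rcases Nat.eq_zero_or_pos K with rfl | hK
  · simpa using hC
  have hK' : (0 : ℝ) < K := by exact_mod_cast hK
  rw [norm_smul, Real.norm_eq_abs, abs_of_pos (by positivity : 0 < 1 / (K : ℝ)), one_div,
    inv_mul_le_iff₀ hK']
  refine (norm_sum_le _ _).trans ?_
  refine (Finset.sum_le_sum fun k _ => hf k).trans ?_
  simp

theorem average_const {K : ℕ} (hK : 0 < K) {E : Type*} [AddCommGroup E] [Module ℝ E] (x : E) :
    (1 / (K : ℝ)) • ∑ _k : Fin K, x = x := by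
  have hK' : (K : ℝ) ≠ 0 := by exact_mod_cast hK.ne'
  rw [Finset.sum_const, Finset.card_univ, Fintype.card_fin, ← Nat.cast_smul_eq_nsmul ℝ, smul_smul,
    one_div_mul_cancel hK', one_smul]

variable {p Gh Lh L1 μ Δ₀ : ℝ} {h : Weights d → X → ℝ} {P : Fin K → Measure (X × Bool)}

theorem Assumptions.integral_posInd (hA : Assumptions p Gh Lh L1 μ Δ₀ h P) (k : Fin K) :
    ∫ z, posInd z ∂P k = p := by
  have hm : MeasurableSet {z : X × Bool | z.2 = true} :=
    measurable_snd (measurableSet_singleton true)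
  rw [← hA.label k, ← integral_indicator_one hm]
  refine integral_congr_ae (Filter.Eventually.of_forall fun z => ?_)
  simp [posInd, Set.indicator]

theorem Assumptions.measurable_score_fst (hA : Assumptions p Gh Lh L1 μ Δ₀ h P) (w : Weights d) :
    Measurable fun z : X × Bool => h w z.1 :=
  (hA.measurable_score w).comp measurable_fst

theorem integral_score_posInd (hp0 : 0 < p)
    (k : Fin K) (w : Weights d) :
    ∫ z, h w z.1 * posInd z ∂P k = p * posMean p h (P k) w := by
  rw [posMean, mul_div_cancel₀ _ hp0.ne']

theorem integral_score_negInd (hp1 : p < 1)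
    (k : Fin K) (w : Weights d) :
    ∫ z, h w z.1 * negInd z ∂P k = (1 - p) * negMean p h (P k) w := by
  rw [negMean, mul_div_cancel₀ _ (by linarith)]

variable [∀ k, IsProbabilityMeasure (P k)]

theorem integrable_posInd (k : Fin K) : Integrable (posInd : X × Bool → ℝ) (P k) :=
  Integrable.of_bound measurable_posInd.aestronglyMeasurable 1
    (Filter.Eventually.of_forall fun z => by rcases posInd_mem z with h | h <;> simp [h])

theorem integrable_negInd (k : Fin K) : Integrable (negInd : X × Bool → ℝ) (P k) :=
  Integrable.of_bound measurable_negInd.aestronglyMeasurable 1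
    (Filter.Eventually.of_forall fun z => by rcases negInd_mem z with h | h <;> simp [h])

theorem Assumptions.integral_negInd (hA : Assumptions p Gh Lh L1 μ Δ₀ h P) (k : Fin K) :
    ∫ z, negInd z ∂P k = 1 - p := by
  simp_rw [negInd_eq]
  rw [integral_sub (integrable_const _) (integrable_posInd k), hA.integral_posInd k]
  simp

theorem Assumptions.integrable_score_posInd (hA : Assumptions p Gh Lh L1 μ Δ₀ h P) (k : Fin K)
    (w : Weights d) : Integrable (fun z => h w z.1 * posInd z) (P k) := by
  refine Integrable.of_bound ((hA.measurable_score_fst w).mul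
    measurable_posInd).aestronglyMeasurable 1 (Filter.Eventually.of_forall fun z => ?_)
  obtain ⟨h0, h1⟩ := hA.score_mem w z.1
  rcases posInd_mem z with h | h
  · simp [h]
  · simpa [h, abs_of_nonneg h0] using h1

theorem Assumptions.integrable_score_negInd (hA : Assumptions p Gh Lh L1 μ Δ₀ h P) (k : Fin K)
    (w : Weights d) : Integrable (fun z => h w z.1 * negInd z) (P k) := by
  refine Integrable.of_bound ((hA.measurable_score_fst w).mul
    measurable_negInd).aestronglyMeasurable 1 (Filter.Eventually.of_forall fun z => ?_)
  obtain ⟨h0, h1⟩ := hA.score_mem w z.1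
  rcases negInd_mem z with h | h
  · simp [h]
  · simpa [h, abs_of_nonneg h0] using h1

theorem Assumptions.posMean_mem (hA : Assumptions p Gh Lh L1 μ Δ₀ h P) (hp0 : 0 < p)
    (k : Fin K) (w : Weights d) : posMean p h (P k) w ∈ Set.Icc (0 : ℝ) 1 := by
  constructor
  · refine div_nonneg (integral_nonneg fun z => ?_) hp0.le
    obtain ⟨h0, h1⟩ := hA.score_mem w z.1
    rcases posInd_mem z with h | h <;> simp [h, h0]
  · rw [posMean, div_le_one hp0]
    refine (integral_mono (hA.integrable_score_posInd k w) (integrable_posInd k)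
      fun z => ?_).trans_eq (hA.integral_posInd k)
    obtain ⟨h0, h1⟩ := hA.score_mem w z.1
    rcases posInd_mem z with h | h <;> simp [h, h1]

theorem Assumptions.negMean_mem (hA : Assumptions p Gh Lh L1 μ Δ₀ h P) (hp1 : p < 1)
    (k : Fin K) (w : Weights d) : negMean p h (P k) w ∈ Set.Icc (0 : ℝ) 1 := by
  constructor
  · refine div_nonneg (integral_nonneg fun z => ?_) (by linarith)
    obtain ⟨h0, h1⟩ := hA.score_mem w z.1
    rcases negInd_mem z with h | h <;> simp [h, h0]
  · rw [negMean, div_le_one (by linarith)]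
    refine (integral_mono (hA.integrable_score_negInd k w) (integrable_negInd k)
      fun z => ?_).trans_eq (hA.integral_negInd k)
    obtain ⟨h0, h1⟩ := hA.score_mem w z.1
    rcases negInd_mem z with h | h <;> simp [h, h1]

theorem Assumptions.abs_classGap_le (hA : Assumptions p Gh Lh L1 μ Δ₀ h P) (hp0 : 0 < p)
    (hp1 : p < 1) (k : Fin K) (w : Weights d) : |classGap p h (P k) w| ≤ 1 := by
  obtain ⟨a0, a1⟩ := hA.posMean_mem hp0 k w
  obtain ⟨b0, b1⟩ := hA.negMean_mem hp1 k w
  rw [classGap, abs_le]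
  constructor <;> linarith

theorem Assumptions.abs_dualOpt_le (hA : Assumptions p Gh Lh L1 μ Δ₀ h P) (hp0 : 0 < p)
    (hp1 : p < 1) (w : Weights d) : |dualOpt p h P w| ≤ 1 :=
  abs_average_le zero_le_one fun k => hA.abs_classGap_le hp0 hp1 k w

/-- Each conditional mean inherits the Lipschitz constant of the score, since the class probability
cancels against the normalization. -/
theorem Assumptions.classGap_lipschitz (hA : Assumptions p Gh Lh L1 μ Δ₀ h P) (hp0 : 0 < p)
    (hp1 : p < 1) (k : Fin K) (w w' : Weights d) :
    |classGap p h (P k) w - classGap p h (P k) w'| ≤ 2 * Gh * ‖w - w'‖ := by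
  have key : ∀ i : X × Bool → ℝ, (∀ z, i z = 0 ∨ i z = 1) → Integrable i (P k) →
      Integrable (fun z => h w z.1 * i z) (P k) → Integrable (fun z => h w' z.1 * i z) (P k) →
      |∫ z, h w z.1 * i z ∂P k - ∫ z, h w' z.1 * i z ∂P k| ≤ Gh * ‖w - w'‖ * ∫ z, i z ∂P k := by
    intro i hi hint h1 h2
    rw [← integral_sub h1 h2, ← integral_const_mul]
    refine abs_integral_le_integral_abs.trans (integral_mono (h1.sub h2).abs
      (hint.const_mul _) fun z => ?_)
    have := hA.score_lipschitz z.1 w w'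
    rcases hi z with h | h <;> simp [h, this]
  have e1 := key posInd posInd_mem (integrable_posInd k) (hA.integrable_score_posInd k w)
    (hA.integrable_score_posInd k w')
  have e2 := key negInd negInd_mem (integrable_negInd k) (hA.integrable_score_negInd k w)
    (hA.integrable_score_negInd k w')
  rw [hA.integral_posInd] at e1
  rw [hA.integral_negInd] at e2
  have f1 : |posMean p h (P k) w - posMean p h (P k) w'| ≤ Gh * ‖w - w'‖ := by
    rw [posMean, posMean, ← sub_div, abs_div, abs_of_pos hp0, div_le_iff₀ hp0]
    exact e1
  have f2 : |negMean p h (P k) w - negMean p h (P k) w'| ≤ Gh * ‖w - w'‖ := by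
    have : 0 < 1 - p := by linarith
    rw [negMean, negMean, ← sub_div, abs_div, abs_of_pos this, div_le_iff₀ this]
    exact e2
  rw [classGap, classGap, sub_sub_sub_comm]
  exact (abs_sub _ _).trans (by linarith)

theorem Assumptions.measurable_classGap (hA : Assumptions p Gh Lh L1 μ Δ₀ h P) (k : Fin K) :
    Measurable fun w => classGap p h (P k) w := by
  have h1 : Measurable fun q : Weights d × (X × Bool) => h q.1 q.2.1 :=
    hA.measurable_score_uncurry.comp
      (measurable_fst.prodMk (measurable_fst.comp measurable_snd))
  have h2 : Measurable fun q : Weights d × (X × Bool) => posInd q.2 :=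
    measurable_posInd.comp measurable_snd
  have h3 : Measurable fun q : Weights d × (X × Bool) => negInd q.2 :=
    measurable_negInd.comp measurable_snd
  have e1 := (h1.mul h2).stronglyMeasurable.integral_prod_right' (ν := P k)
  have e2 := (h1.mul h3).stronglyMeasurable.integral_prod_right' (ν := P k)
  exact (e2.measurable.div_const _).sub (e1.measurable.div_const _)

theorem Assumptions.measurable_dualOpt (hA : Assumptions p Gh Lh L1 μ Δ₀ h P) :
    Measurable fun w => dualOpt p h P w :=
  (Finset.measurable_sum _ fun k _ => hA.measurable_classGap k).const_mul _

theorem Assumptions.integral_lossGradDual (hA : Assumptions p Gh Lh L1 μ Δ₀ h P) (hp0 : 0 < p)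
    (hp1 : p < 1) (k : Fin K) (v : Primal d) (α : ℝ) :
    ∫ z, lossGradDual p h v α z ∂P k = 2 * (p * (1 - p)) * (classGap p h (P k) (wPart v) - α) := by
  have e : ∀ z, lossGradDual p h v α z = 2 * p * (h (wPart v) z.1 * negInd z)
      - 2 * (1 - p) * (h (wPart v) z.1 * posInd z) - 2 * (p * (1 - p)) * α := by
    intro z; unfold lossGradDual; ring
  have i1 : Integrable (fun z => 2 * p * (h (wPart v) z.1 * negInd z)) (P k) :=
    (hA.integrable_score_negInd k _).const_mul _
  have i2 : Integrable (fun z => 2 * (1 - p) * (h (wPart v) z.1 * posInd z)) (P k) :=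
    (hA.integrable_score_posInd k _).const_mul _
  have i3 : Integrable (fun z => 2 * p * (h (wPart v) z.1 * negInd z)
      - 2 * (1 - p) * (h (wPart v) z.1 * posInd z)) (P k) := i1.sub i2
  simp_rw [e]
  rw [integral_sub i3 (integrable_const _), integral_sub i1 i2, integral_const_mul,
    integral_const_mul, integral_score_negInd hp1, integral_score_posInd hp0, classGap]
  simp
  ring

theorem Assumptions.integrable_lossF (hA : Assumptions p Gh Lh L1 μ Δ₀ h P) (hp0 : 0 < p)
    (hp1 : p < 1) (k : Fin K) (v : Primal d) (α : ℝ) :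
    Integrable (fun z => lossF p h v α z) (P k) :=
  Integrable.of_bound (hA.measurable_lossF measurable_const measurable_const
    measurable_id).aestronglyMeasurable _ (Filter.Eventually.of_forall fun z =>
      hA.abs_lossF_le hp0 hp1 (le_max_left |aPart v| |bPart v|) (le_max_right |aPart v| |bPart v|)
        le_rfl z)

theorem Assumptions.integrable_lossGrad (hA : Assumptions p Gh Lh L1 μ Δ₀ h P) (hp0 : 0 < p)
    (hp1 : p < 1) (k : Fin K) (v : Primal d) (α : ℝ) :
    Integrable (fun z => lossGrad p h v α z) (P k) :=
  Integrable.of_bound (hA.measurable_lossGrad measurable_const measurable_const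
    measurable_id).aestronglyMeasurable _ (Filter.Eventually.of_forall fun z =>
      hA.norm_lossGrad_le' hp0 hp1 (le_max_left |aPart v| |bPart v|)
        (le_max_right |aPart v| |bPart v|) le_rfl z)

theorem Assumptions.measurable_meanGrad (hA : Assumptions p Gh Lh L1 μ Δ₀ h P) (k : Fin K)
    {Ω : Type*} [MeasurableSpace Ω] {v : Ω → Primal d} {α : Ω → ℝ} (hv : Measurable v)
    (hα : Measurable α) : Measurable fun ω => meanGrad p h (P k) (v ω) (α ω) := by
  have : Measurable fun r : Ω × (X × Bool) => lossGrad p h (v r.1) (α r.1) r.2 :=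
    hA.measurable_lossGrad (hv.comp measurable_fst) (hα.comp measurable_fst) measurable_snd
  exact (this.stronglyMeasurable.integral_prod_right' (ν := P k)).measurable

theorem Assumptions.norm_meanGrad_le (hA : Assumptions p Gh Lh L1 μ Δ₀ h P) (hp0 : 0 < p)
    (hp1 : p < 1) (k : Fin K) {α : ℝ} {v : Primal d} (hv : v ∈ box d)
    (hα : |α| ≤ dualBound p) : ‖meanGrad p h (P k) v α‖ ≤ gradBound p Gh := by
  have := norm_integral_le_of_norm_le_const (μ := P k) (Filter.Eventually.of_forall fun z =>
    hA.norm_lossGrad_le hp0 hp1 hv hα z)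
  simpa [meanGrad] using this

theorem Assumptions.meanGrad_lipschitz (hA : Assumptions p Gh Lh L1 μ Δ₀ h P) (hp0 : 0 < p)
    (hp1 : p < 1) (hGh : 0 ≤ Gh) (hLh : 0 ≤ Lh) (k : Fin K) {α α' : ℝ} {v v' : Primal d}
    (hv' : v' ∈ box d) (hα' : |α'| ≤ dualBound p) :
    ‖meanGrad p h (P k) v α - meanGrad p h (P k) v' α'‖
      ≤ gradLip p Gh Lh * (‖v - v'‖ + |α - α'|) := by
  rw [meanGrad, meanGrad, ← integral_sub (hA.integrable_lossGrad hp0 hp1 k v α)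
    (hA.integrable_lossGrad hp0 hp1 k v' α')]
  have := norm_integral_le_of_norm_le_const (μ := P k) (Filter.Eventually.of_forall fun z =>
    hA.lossGrad_lipschitz hp0 hp1 hGh hLh (v := v) (α := α) hv' hα' z)
  simpa using this

theorem Assumptions.hasGradientAt_integral_lossF (hA : Assumptions p Gh Lh L1 μ Δ₀ h P)
    (hp0 : 0 < p) (hp1 : p < 1) (k : Fin K) (v : Primal d) (α : ℝ) :
    HasGradientAt (fun u => ∫ z, lossF p h u α z ∂P k) (meanGrad p h (P k) v α) v := by
  rw [hasGradientAt_iff_hasFDerivAt]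
  have h1 := hasFDerivAt_integral_of_dominated_of_fderiv_le (𝕜 := ℝ) (μ := P k) (x₀ := v)
    (F := fun u z => lossF p h u α z)
    (F' := fun u z => InnerProductSpace.toDual ℝ (Primal d) (lossGrad p h u α z))
    -- On the unit ball about `v` the components a and b grow by at most 1, which gives a constant
    -- dominating function.
    (s := Metric.ball v 1)
    (bound := fun _ => (2 * (1 + (max |aPart v| |bPart v| + 1)) + 2 * (1 + |α|)) * Gh
      + 4 * (1 + (max |aPart v| |bPart v| + 1)))
    (Metric.ball_mem_nhds _ one_pos)
    (Filter.Eventually.of_forall fun u => (hA.integrable_lossF hp0 hp1 k u α).1)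
    (hA.integrable_lossF hp0 hp1 k v α)
    ((LinearIsometryEquiv.continuous _).comp_aestronglyMeasurable
      (hA.integrable_lossGrad hp0 hp1 k v α).1)
    (Filter.Eventually.of_forall fun z u hu => by
      rw [LinearIsometryEquiv.norm_map]
      have hu' : ‖u - v‖ ≤ 1 := by
        rw [← dist_eq_norm]; exact (Metric.mem_ball.mp hu).le
      refine hA.norm_lossGrad_le' hp0 hp1 ?_ ?_ le_rfl z
      · have h1 := (abs_aPart_le (u - v)).trans hu'
        rw [aPart_sub] at h1
        have h2 := abs_sub_abs_le_abs_sub (aPart u) (aPart v)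
        have h3 := le_max_left |aPart v| |bPart v|
        linarith
      · have h1 := (abs_bPart_le (u - v)).trans hu'
        rw [bPart_sub] at h1
        have h2 := abs_sub_abs_le_abs_sub (bPart u) (bPart v)
        have h3 := le_max_right |aPart v| |bPart v|
        linarith)
    (integrable_const _)
    (Filter.Eventually.of_forall fun z u _ => (hA.hasGradientAt_lossF u α z).hasFDerivAt)
  refine h1.congr_fderiv ?_
  rw [meanGrad]
  exact ((InnerProductSpace.toDual ℝ (Primal d)).toContinuousLinearEquiv.toContinuousLinearMap
    |>.integral_comp_comm (hA.integrable_lossGrad hp0 hp1 k v α))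

/-! ### The primal objective: maximization over the dual variable and the envelope theorem. -/

theorem Assumptions.hasGradientAt_objF (hA : Assumptions p Gh Lh L1 μ Δ₀ h P)
    (hp0 : 0 < p) (hp1 : p < 1) (v : Primal d) (α : ℝ) :
    HasGradientAt (fun u => objF p h P u α) ((1 / (K : ℝ)) • ∑ k, meanGrad p h (P k) v α) v := by
  rw [hasGradientAt_iff_hasFDerivAt]
  have h1 := (HasFDerivAt.fun_sum (u := Finset.univ) fun k _ =>
    (hA.hasGradientAt_integral_lossF hp0 hp1 k v α).hasFDerivAt).const_mul (1 / (K : ℝ))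
  refine h1.congr_fderiv ?_
  ext u
  simp

/-- Completing the square. Every machine has the same curvature p(1-p) in α because p is common to
all, so the centre of the averaged parabola is the plain average of the local centres. -/
theorem Assumptions.objF_eq (hA : Assumptions p Gh Lh L1 μ Δ₀ h P) (hK : 0 < K)
    (hp0 : 0 < p) (hp1 : p < 1) (v : Primal d) (α : ℝ) :
    objF p h P v α = objF p h P v (dualOpt p h P (wPart v))
      - p * (1 - p) * (α - dualOpt p h P (wPart v)) ^ 2 := by
  set D := dualOpt p h P (wPart v) with hD
  have e : ∀ k, ∫ z, lossF p h v α z ∂P k = ∫ z, lossF p h v D z ∂P k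
      + (2 * (p * (1 - p)) * (α - D) * classGap p h (P k) (wPart v)
        - p * (1 - p) * (α ^ 2 - D ^ 2)) := by
    intro k
    have : ∀ z, lossF p h v α z = lossF p h v D z + ((α - D) * lossGradDual p h v 0 z
      - p * (1 - p) * (α ^ 2 - D ^ 2)) := by
      intro z; unfold lossF lossGradDual; ring
    have hi : Integrable (fun z => lossGradDual p h v 0 z) (P k) := by
      refine Integrable.of_bound (hA.measurable_lossGradDual measurable_const measurable_const
        measurable_id).aestronglyMeasurable 4 (Filter.Eventually.of_forall fun z => ?_)
      refine hA.abs_lossGradDual_le hp0 hp1 v ?_ z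
      have := one_le_dualBound hp0 hp1
      rw [abs_zero]; linarith
    have hi1 : Integrable (fun z => (α - D) * lossGradDual p h v 0 z) (P k) := hi.const_mul _
    have hi2 : Integrable (fun z => (α - D) * lossGradDual p h v 0 z
        - p * (1 - p) * (α ^ 2 - D ^ 2)) (P k) := hi1.sub (integrable_const _)
    simp_rw [this]
    rw [integral_add (hA.integrable_lossF hp0 hp1 k v D) hi2, integral_sub hi1
      (integrable_const _), integral_const_mul, hA.integral_lossGradDual hp0 hp1]
    simp
    ring
  unfold objF
  simp_rw [e]
  have hK' : (K : ℝ) ≠ 0 := by exact_mod_cast hK.ne'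
  have hDK : ∑ k, classGap p h (P k) (wPart v) = K * D := by
    rw [hD, dualOpt]; field_simp
  rw [Finset.sum_add_distrib, Finset.sum_sub_distrib, ← Finset.mul_sum, hDK]
  simp only [Finset.sum_const, Finset.card_univ, Fintype.card_fin, nsmul_eq_mul]
  field_simp
  ring

theorem Assumptions.objF_le (hA : Assumptions p Gh Lh L1 μ Δ₀ h P) (hK : 0 < K)
    (hp0 : 0 < p) (hp1 : p < 1) (v : Primal d) (α : ℝ) :
    objF p h P v α ≤ objF p h P v (dualOpt p h P (wPart v)) := by
  rw [hA.objF_eq hK hp0 hp1 v α]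
  have : 0 ≤ p * (1 - p) * (α - dualOpt p h P (wPart v)) ^ 2 :=
    mul_nonneg (mul_nonneg hp0.le (by linarith)) (sq_nonneg _)
  linarith

theorem Assumptions.phi_eq (hA : Assumptions p Gh Lh L1 μ Δ₀ h P) (hK : 0 < K)
    (hp0 : 0 < p) (hp1 : p < 1) (v : Primal d) :
    phi p h P v = objF p h P v (dualOpt p h P (wPart v)) :=
  le_antisymm (ciSup_le fun α => hA.objF_le hK hp0 hp1 v α)
    (le_ciSup (f := fun α => objF p h P v α)
      ⟨_, Set.forall_mem_range.mpr fun α => hA.objF_le hK hp0 hp1 v α⟩ _)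

theorem Assumptions.objF_le_phi (hA : Assumptions p Gh Lh L1 μ Δ₀ h P) (hK : 0 < K)
    (hp0 : 0 < p) (hp1 : p < 1) (v : Primal d) (α : ℝ) :
    objF p h P v α ≤ phi p h P v := by
  rw [hA.phi_eq hK hp0 hp1]; exact hA.objF_le hK hp0 hp1 v α

/-- At α = -1 the indefinite term of the loss vanishes and only squares and -p(1-p) remain.
Boundedness below makes `phiStar` a genuine infimum instead of the default value of an unbounded
`⨅`. -/
theorem Assumptions.neg_one_le_phi (hA : Assumptions p Gh Lh L1 μ Δ₀ h P) (hK : 0 < K)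
    (hp0 : 0 < p) (hp1 : p < 1) (v : Primal d) : -1 ≤ phi p h P v := by
  refine le_trans ?_ (hA.objF_le_phi hK hp0 hp1 v (-1))
  have hK' : (0 : ℝ) < K := by exact_mod_cast hK
  have h1 : ∀ k, -1 ≤ ∫ z, lossF p h v (-1) z ∂P k := by
    intro k
    have : ∫ _z, (-1 : ℝ) ∂P k = -1 := by simp
    refine this.symm.trans_le
      (integral_mono (integrable_const _) (hA.integrable_lossF hp0 hp1 k v _) fun z => ?_)
    unfold lossF
    have h2 : 0 ≤ (1 - p) * (h (wPart v) z.1 - aPart v) ^ 2 * posInd z :=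
      mul_nonneg (mul_nonneg (by linarith) (sq_nonneg _))
        (by rcases posInd_mem z with h | h <;> simp [h])
    have h3 : 0 ≤ p * (h (wPart v) z.1 - bPart v) ^ 2 * negInd z :=
      mul_nonneg (mul_nonneg (by linarith) (sq_nonneg _))
        (by rcases negInd_mem z with h | h <;> simp [h])
    nlinarith
  calc (-1 : ℝ) = (1 / (K : ℝ)) • ∑ _k : Fin K, (-1 : ℝ) := (average_const hK _).symm
    _ ≤ _ := by
      rw [smul_eq_mul]
      exact mul_le_mul_of_nonneg_left (Finset.sum_le_sum fun k _ => h1 k) (by positivity)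

theorem Assumptions.phiStar_le (hA : Assumptions p Gh Lh L1 μ Δ₀ h P) (hK : 0 < K)
    (hp0 : 0 < p) (hp1 : p < 1) (v : Primal d) : phiStar p h P ≤ phi p h P v :=
  ciInf_le ⟨-1, Set.forall_mem_range.mpr fun u => hA.neg_one_le_phi hK hp0 hp1 u⟩ v

theorem Assumptions.abs_phi_le (hA : Assumptions p Gh Lh L1 μ Δ₀ h P) (hK : 0 < K)
    (hp0 : 0 < p) (hp1 : p < 1) {v : Primal d} (hv : v ∈ box d) : |phi p h P v| ≤ 9 := by
  rw [hA.phi_eq hK hp0 hp1]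
  refine abs_average_le (by norm_num) fun k => ?_
  have := norm_integral_le_of_norm_le_const (μ := P k) (Filter.Eventually.of_forall fun z =>
    (Real.norm_eq_abs _).trans_le <| hA.abs_lossF_le hp0 hp1 hv.1 hv.2 (hA.abs_dualOpt_le hp0 hp1 (wPart v)) z)
  rw [Real.norm_eq_abs] at this
  refine this.trans ?_
  norm_num

theorem Assumptions.measurable_phi (hA : Assumptions p Gh Lh L1 μ Δ₀ h P) (hK : 0 < K)
    (hp0 : 0 < p) (hp1 : p < 1) : Measurable (phi p h P) := by
  have : phi p h P = fun v => objF p h P v (dualOpt p h P (wPart v)) :=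
    funext fun v => hA.phi_eq hK hp0 hp1 v
  rw [this]
  refine (Finset.measurable_sum _ fun k _ => ?_).const_mul _
  have h1 : Measurable fun r : Primal d × (X × Bool) =>
      lossF p h r.1 (dualOpt p h P (wPart r.1)) r.2 :=
    hA.measurable_lossF measurable_fst
      (hA.measurable_dualOpt.comp (measurable_wPart.comp measurable_fst)) measurable_snd
  exact (h1.stronglyMeasurable.integral_prod_right' (ν := P k)).measurable

/-- Envelope argument: with D frozen at its value for v, the function φ - f(·, D) is nonnegative and
vanishes at v, so its derivative there is zero. No derivative of the maximizer is needed. -/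
theorem Assumptions.gradient_phi (hA : Assumptions p Gh Lh L1 μ Δ₀ h P) (hK : 0 < K)
    (hp0 : 0 < p) (hp1 : p < 1) {v : Primal d} (hv : v ∈ box d) :
    gradient (phi p h P) v = phiGrad p h P v := by
  set D := dualOpt p h P (wPart v) with hD
  have h1 := (hA.phi_differentiable v hv).hasGradientAt.hasFDerivAt
  have h2 := (hA.hasGradientAt_objF hp0 hp1 v D).hasFDerivAt
  have h3 : IsLocalMin (fun u => phi p h P u - objF p h P u D) v := by
    refine Filter.Eventually.of_forall fun u => ?_
    have e1 : phi p h P v - objF p h P v D = 0 := by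
      rw [hA.phi_eq hK hp0 hp1]; exact sub_self _
    simp only [e1]
    exact sub_nonneg.mpr (hA.objF_le_phi hK hp0 hp1 u D)
  have h4 := h3.hasFDerivAt_eq_zero (h1.sub h2)
  rw [← map_sub, LinearIsometryEquiv.map_eq_zero_iff, sub_eq_zero] at h4
  exact h4

theorem Assumptions.norm_phiGrad_le (hA : Assumptions p Gh Lh L1 μ Δ₀ h P)
    (hp0 : 0 < p) (hp1 : p < 1) (hGh : 0 ≤ Gh) {v : Primal d} (hv : v ∈ box d) :
    ‖phiGrad p h P v‖ ≤ gradBound p Gh :=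
  norm_average_le (gradBound_pos hp0 hp1 hGh).le fun k => hA.norm_meanGrad_le hp0 hp1 k hv
    ((hA.abs_dualOpt_le hp0 hp1 _).trans (one_le_dualBound hp0 hp1))

theorem Assumptions.measurable_phiGrad (hA : Assumptions p Gh Lh L1 μ Δ₀ h P) :
    Measurable (phiGrad p h P) := by
  have : Measurable fun v : Primal d => ∑ k, meanGrad p h (P k) v (dualOpt p h P (wPart v)) :=
    Finset.measurable_sum _ fun k _ => hA.measurable_meanGrad k measurable_id
      (hA.measurable_dualOpt.comp measurable_wPart)
  have h2 := this.const_smul (1 / (K : ℝ))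
  exact h2

theorem convex_box (d : ℕ) : Convex ℝ (box d) := by
  have h1 : Convex ℝ {v : Primal d | aPart v ∈ Set.Icc (-1 : ℝ) 1} :=
    (convex_Icc (-1 : ℝ) 1).linear_preimage (aPartL d).toLinearMap
  have h2 : Convex ℝ {v : Primal d | bPart v ∈ Set.Icc (-1 : ℝ) 1} :=
    (convex_Icc (-1 : ℝ) 1).linear_preimage (bPartL d).toLinearMap
  have : box d = {v | aPart v ∈ Set.Icc (-1 : ℝ) 1} ∩ {v | bPart v ∈ Set.Icc (-1 : ℝ) 1} := by
    ext v; simp [box, abs_le]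
  rw [this]
  exact h1.inter h2

/-- Mean value theorem along the segment, which stays in the convex box. This costs the constant L₁
instead of L₁/2 but requires no integration of the gradient. -/
theorem Assumptions.phi_descent (hA : Assumptions p Gh Lh L1 μ Δ₀ h P) (hK : 0 < K)
    (hp0 : 0 < p) (hp1 : p < 1) (hL1 : 0 ≤ L1) {u v : Primal d} (hu : u ∈ box d) (hv : v ∈ box d) :
    phi p h P u ≤ phi p h P v + inner ℝ (phiGrad p h P v) (u - v) + L1 * ‖u - v‖ ^ 2 := by
  have hseg : ∀ t ∈ Set.Icc (0 : ℝ) 1, v + t • (u - v) ∈ box d := fun t ht =>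
    (convex_box d).add_smul_sub_mem hv hu ht
  have hder : ∀ t ∈ Set.Icc (0 : ℝ) 1, HasDerivAt (fun t : ℝ => phi p h P (v + t • (u - v)))
      (inner ℝ (gradient (phi p h P) (v + t • (u - v))) (u - v)) t := by
    intro t ht
    have h1 := (hA.phi_differentiable _ (hseg t ht)).hasGradientAt.hasFDerivAt
    have h2 : HasDerivAt (fun t : ℝ => v + t • (u - v)) ((1 : ℝ) • (u - v)) t :=
      ((hasDerivAt_id t).smul_const (u - v)).const_add v
    have h3 := h1.comp_hasDerivAt t h2
    rw [one_smul, InnerProductSpace.toDual_apply_apply] at h3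
    exact h3
  obtain ⟨t, ht, hs⟩ := exists_hasDerivAt_eq_slope (fun t : ℝ => phi p h P (v + t • (u - v)))
    (fun t => inner ℝ (gradient (phi p h P) (v + t • (u - v))) (u - v)) zero_lt_one
    (fun t ht => (hder t ht).continuousAt.continuousWithinAt)
    (fun t ht => hder t (Set.Ioo_subset_Icc_self ht))
  have ht' := Set.Ioo_subset_Icc_self ht
  simp only [one_smul, zero_smul, add_zero, sub_zero, div_one, add_sub_cancel] at hs
  have h1 : inner ℝ (gradient (phi p h P) (v + t • (u - v))) (u - v)
      = inner ℝ (phiGrad p h P v) (u - v)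
        + inner ℝ (gradient (phi p h P) (v + t • (u - v)) - gradient (phi p h P) v) (u - v) := by
    rw [← hA.gradient_phi hK hp0 hp1 hv, inner_sub_left]; ring
  have h2 : inner ℝ (gradient (phi p h P) (v + t • (u - v)) - gradient (phi p h P) v) (u - v)
      ≤ L1 * ‖u - v‖ ^ 2 := by
    refine (real_inner_le_norm _ _).trans ?_
    have h3 := hA.phi_smooth _ (hseg t ht') v hv
    rw [add_sub_cancel_left, norm_smul, Real.norm_eq_abs, abs_of_nonneg ht'.1] at h3
    have h4 : L1 * (t * ‖u - v‖) ≤ L1 * ‖u - v‖ :=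
      mul_le_mul_of_nonneg_left (mul_le_of_le_one_left (norm_nonneg _) ht'.2) hL1
    have := mul_le_mul_of_nonneg_right (h3.trans h4) (norm_nonneg (u - v))
    nlinarith
  linarith

/-! ### The dependence of φ on (a, b): initial dual error and an upper bound for μ. -/

theorem Assumptions.phi_mkPrimal_sub (hA : Assumptions p Gh Lh L1 μ Δ₀ h P) (hK : 0 < K)
    (hp0 : 0 < p) (hp1 : p < 1) (w : Weights d) (a b a' b' : ℝ) :
    phi p h P (mkPrimal w a b) - phi p h P (mkPrimal w a' b')
      = p * (1 - p) * ((a - (1 / (K : ℝ)) * ∑ k, posMean p h (P k) w) ^ 2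
          - (a' - (1 / (K : ℝ)) * ∑ k, posMean p h (P k) w) ^ 2
          + (b - (1 / (K : ℝ)) * ∑ k, negMean p h (P k) w) ^ 2
          - (b' - (1 / (K : ℝ)) * ∑ k, negMean p h (P k) w) ^ 2) := by
  rw [hA.phi_eq hK hp0 hp1, hA.phi_eq hK hp0 hp1]
  simp only [wPart_mkPrimal]
  set D := dualOpt p h P w
  have hK' : (K : ℝ) ≠ 0 := by exact_mod_cast hK.ne'
  have e : ∀ k, ∫ z, lossF p h (mkPrimal w a b) D z ∂P k
      - ∫ z, lossF p h (mkPrimal w a' b') D z ∂P k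
      = p * (1 - p) * (a ^ 2 - a' ^ 2 + b ^ 2 - b' ^ 2)
        - 2 * (p * (1 - p)) * (a - a') * posMean p h (P k) w
        - 2 * (p * (1 - p)) * (b - b') * negMean p h (P k) w := by
    intro k
    rw [← integral_sub (hA.integrable_lossF hp0 hp1 k _ D) (hA.integrable_lossF hp0 hp1 k _ D)]
    have : ∀ z, lossF p h (mkPrimal w a b) D z - lossF p h (mkPrimal w a' b') D z
        = ((1 - p) * (a ^ 2 - a' ^ 2) * posInd z + p * (b ^ 2 - b' ^ 2) * negInd z)
          - (2 * (1 - p) * (a - a') * (h w z.1 * posInd z)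
          + 2 * p * (b - b') * (h w z.1 * negInd z)) := by
      intro z; unfold lossF; simp; ring
    simp_rw [this]
    have i1 := (integrable_posInd (P := P) k).const_mul ((1 - p) * (a ^ 2 - a' ^ 2))
    have i2 := (integrable_negInd (P := P) k).const_mul (p * (b ^ 2 - b' ^ 2))
    have i3 := (hA.integrable_score_posInd k w).const_mul (2 * (1 - p) * (a - a'))
    have i4 := (hA.integrable_score_negInd k w).const_mul (2 * p * (b - b'))
    have i5 : Integrable (fun z => (1 - p) * (a ^ 2 - a' ^ 2) * posInd z
        + p * (b ^ 2 - b' ^ 2) * negInd z) (P k) := i1.add i2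
    have i6 : Integrable (fun z => 2 * (1 - p) * (a - a') * (h w z.1 * posInd z)
        + 2 * p * (b - b') * (h w z.1 * negInd z)) (P k) := i3.add i4
    rw [integral_sub i5 i6, integral_add i1 i2, integral_add i3 i4]
    simp only [integral_const_mul]
    rw [hA.integral_posInd, hA.integral_negInd, integral_score_posInd hp0,
      integral_score_negInd hp1]
    ring
  unfold objF
  rw [← mul_sub, ← Finset.sum_sub_distrib, Finset.sum_congr rfl fun k _ => e k]
  simp only [Finset.sum_sub_distrib, ← Finset.mul_sum, Finset.sum_const, Finset.card_univ, Fintype.card_fin, nsmul_eq_mul]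
  field_simp
  ring

/-- Replacing (a, b) = (0, 0) by the averaged class means (A, B) lowers φ by p(1-p)(A² + B²), while
D(0) = B - A and (B - A)² ≤ 2(A² + B²). This controls the first stage, whose dual start 0 is not an
estimate. -/
theorem Assumptions.dualOpt_zero_sq_le (hA : Assumptions p Gh Lh L1 μ Δ₀ h P) (hK : 0 < K)
    (hp0 : 0 < p) (hp1 : p < 1) :
    p * (1 - p) * dualOpt p h P 0 ^ 2 ≤ 2 * (phi p h P 0 - phiStar p h P) := by
  set A := (1 / (K : ℝ)) * ∑ k, posMean p h (P k) 0 with hA'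
  set B := (1 / (K : ℝ)) * ∑ k, negMean p h (P k) 0 with hB'
  have h0 : (0 : Primal d) = mkPrimal 0 0 0 := by
    ext i
    rcases i with i | i
    · simp [mkPrimal]
    · fin_cases i <;> simp [mkPrimal]
  have h1 := hA.phi_mkPrimal_sub hK hp0 hp1 0 0 0 A B
  have h2 := hA.phiStar_le hK hp0 hp1 (mkPrimal 0 A B)
  have h3 : dualOpt p h P 0 = B - A := by
    rw [hA', hB', dualOpt, ← mul_sub, ← Finset.sum_sub_distrib]; rfl
  rw [h0, h3]
  rw [← hA', ← hB'] at h1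
  have hk : 0 < p * (1 - p) := mul_pos hp0 (by linarith)
  nlinarith [mul_nonneg hk.le (sq_nonneg (A + B))]

/-- Displace the optimal a by one unit: the gap there is at least p(1-p), whereas the gradient is
bounded, so the PL inequality limits μ. This keeps the final constants independent of μ. -/
theorem Assumptions.mu_le (hA : Assumptions p Gh Lh L1 μ Δ₀ h P) (hK : 0 < K)
    (hp0 : 0 < p) (hp1 : p < 1) (hGh : 0 ≤ Gh) (hμ : 0 < μ) :
    μ ≤ gradBound p Gh ^ 2 * dualBound p := by
  set A := (1 / (K : ℝ)) * ∑ k, posMean p h (P k) 0 with hA'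
  set B := (1 / (K : ℝ)) * ∑ k, negMean p h (P k) 0 with hB'
  have hK' : (0 : ℝ) < K := by exact_mod_cast hK
  have memK : ∀ f : Fin K → ℝ, (∀ k, f k ∈ Set.Icc (0 : ℝ) 1) →
      (1 / (K : ℝ)) * ∑ k, f k ∈ Set.Icc (0 : ℝ) 1 := fun f hf =>
    ⟨mul_nonneg (by positivity) (Finset.sum_nonneg fun k _ => (hf k).1),
      (abs_le.mp (abs_average_le zero_le_one fun k =>
        abs_le.mpr ⟨by linarith [(hf k).1], (hf k).2⟩)).2⟩
  have hAm : A ∈ Set.Icc (0 : ℝ) 1 := memK _ fun k => hA.posMean_mem hp0 k 0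
  have hBm : B ∈ Set.Icc (0 : ℝ) 1 := memK _ fun k => hA.negMean_mem hp1 k 0
  -- Since A lies in [0, 1], the displaced value A - 1 lies in [-1, 0]; A + 1 could leave the box.
  have hv : mkPrimal 0 (A - 1) B ∈ box d := by
    simp only [box, Set.mem_ofPred_eq, aPart_mkPrimal, bPart_mkPrimal, abs_le]
    exact ⟨⟨by linarith [hAm.1], by linarith [hAm.2]⟩, by linarith [hBm.1], hBm.2⟩
  have h1 := hA.phi_mkPrimal_sub hK hp0 hp1 0 (A - 1) B A B
  rw [← hA', ← hB'] at h1
  have h2 := hA.phiStar_le hK hp0 hp1 (mkPrimal 0 A B)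
  have h3 := hA.phi_PL _ hv
  rw [hA.gradient_phi hK hp0 hp1 hv] at h3
  have h4 := hA.norm_phiGrad_le hp0 hp1 hGh hv
  have h5 : ‖phiGrad p h P (mkPrimal 0 (A - 1) B)‖ ^ 2 ≤ gradBound p Gh ^ 2 :=
    pow_le_pow_left₀ (norm_nonneg _) h4 2
  have hk : 0 < p * (1 - p) := mul_pos hp0 (by linarith)
  have h6 : p * (1 - p) ≤ phi p h P (mkPrimal 0 (A - 1) B) - phiStar p h P := by nlinarith
  have h7 := mul_le_mul_of_nonneg_left h6 hμ.le
  rw [dualBound, mul_one_div, le_div_iff₀ hk]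
  nlinarith [sq_nonneg (gradBound p Gh)]

end expectations

/-! ### Bounded random variables -/

section bounded

variable {Ω : Type*} [MeasurableSpace Ω] {E : Type*} [NormedAddCommGroup E]
  [MeasurableSpace E] [BorelSpace E] [SecondCountableTopology E]

/-- Bounded measurable functions. -/
structure BddMeas (f : Ω → E) : Prop where
  measurable : Measurable f
  bounded : ∃ C : ℝ, ∀ ω, ‖f ω‖ ≤ C

namespace BddMeas

variable {f g : Ω → E}

theorem integrable {Pr : Measure Ω} [IsFiniteMeasure Pr] (hf : BddMeas f) : Integrable f Pr := by
  obtain ⟨C, hC⟩ := hf.bounded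
  exact Integrable.of_bound hf.measurable.aestronglyMeasurable C (Filter.Eventually.of_forall hC)

theorem add (hf : BddMeas f) (hg : BddMeas g) : BddMeas fun ω => f ω + g ω := by
  obtain ⟨C, hC⟩ := hf.bounded
  obtain ⟨D, hD⟩ := hg.bounded
  exact ⟨hf.measurable.add hg.measurable, C + D, fun ω =>
    (norm_add_le _ _).trans (add_le_add (hC ω) (hD ω))⟩

theorem sub (hf : BddMeas f) (hg : BddMeas g) : BddMeas fun ω => f ω - g ω := by
  obtain ⟨C, hC⟩ := hf.bounded
  obtain ⟨D, hD⟩ := hg.bounded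
  exact ⟨hf.measurable.sub hg.measurable, C + D, fun ω =>
    (norm_sub_le _ _).trans (add_le_add (hC ω) (hD ω))⟩

theorem const (c : E) : BddMeas fun _ : Ω => c := ⟨measurable_const, ‖c‖, fun _ => le_rfl⟩

theorem const_smul [NormedSpace ℝ E] (c : ℝ) (hf : BddMeas f) : BddMeas fun ω => c • f ω := by
  obtain ⟨C, hC⟩ := hf.bounded
  exact ⟨hf.measurable.const_smul c, ‖c‖ * C, fun ω => by
    rw [norm_smul]; exact mul_le_mul_of_nonneg_left (hC ω) (norm_nonneg _)⟩

theorem sum {ι : Type*} {s : Finset ι} {F : ι → Ω → E} (hF : ∀ i ∈ s, BddMeas (F i)) :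
    BddMeas fun ω => ∑ i ∈ s, F i ω := by
  classical
  induction s using Finset.induction_on with
  | empty => simpa using const (0 : E)
  | insert i s hi ih =>
    simp_rw [Finset.sum_insert hi]
    exact (hF i (Finset.mem_insert_self _ _)).add
      (ih fun j hj => hF j (Finset.mem_insert_of_mem hj))

theorem inner [InnerProductSpace ℝ E] (hf : BddMeas f) (hg : BddMeas g) :
    BddMeas fun ω => inner ℝ (f ω) (g ω) := by
  obtain ⟨C, hC⟩ := hf.bounded
  obtain ⟨D, hD⟩ := hg.bounded
  refine ⟨hf.measurable.inner hg.measurable, C * D, fun ω => ?_⟩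
  exact (norm_inner_le_norm _ _).trans
    (mul_le_mul (hC ω) (hD ω) (norm_nonneg _) ((norm_nonneg _).trans (hC ω)))

theorem norm_sq (hf : BddMeas f) : BddMeas fun ω => ‖f ω‖ ^ 2 := by
  obtain ⟨C, hC⟩ := hf.bounded
  refine ⟨hf.measurable.norm.pow_const 2, C ^ 2, fun ω => ?_⟩
  rw [Real.norm_eq_abs, abs_of_nonneg (by positivity)]
  exact pow_le_pow_left₀ (norm_nonneg _) (hC ω) 2

theorem sq {f : Ω → ℝ} (hf : BddMeas f) : BddMeas fun ω => f ω ^ 2 := by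
  simpa using hf.norm_sq

theorem mul {f g : Ω → ℝ} (hf : BddMeas f) (hg : BddMeas g) : BddMeas fun ω => f ω * g ω := by
  simpa [mul_comm] using hf.inner hg

theorem const_mul {f : Ω → ℝ} (c : ℝ) (hf : BddMeas f) : BddMeas fun ω => c * f ω :=
  hf.const_smul c

end BddMeas

end bounded

/-! ### Decoupling of independent samples -/

section decoupling

variable {Ω U Z : Type*} {m mΩ : MeasurableSpace Ω} [MeasurableSpace U] [MeasurableSpace Z]
  {Pr : Measure Ω} [IsProbabilityMeasure Pr]

/-- Fubini for the product law: the past `u` may be frozen while the independent sample is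
integrated out. -/
theorem integral_indepFun {u : Ω → U} {z : Ω → Z} (hu : Measurable u) (hz : Measurable z)
    (hind : IndepFun u z Pr) {Φ : U × Z → ℝ} (hΦ : Measurable Φ)
    (hint : Integrable (fun ω => Φ (u ω, z ω)) Pr) :
    ∫ ω, Φ (u ω, z ω) ∂Pr = ∫ ω, ∫ y, Φ (u ω, y) ∂(Pr.map z) ∂Pr := by
  have hmap := (indepFun_iff_map_prod_eq_prod_map_map hu.aemeasurable hz.aemeasurable).mp hind
  have := Measure.isProbabilityMeasure_map (μ := Pr) hu.aemeasurable
  have := Measure.isProbabilityMeasure_map (μ := Pr) hz.aemeasurable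
  have hint' : Integrable Φ ((Pr.map u).prod (Pr.map z)) := by
    rw [← hmap]
    exact (integrable_map_measure hΦ.aestronglyMeasurable (hu.prodMk hz).aemeasurable).mpr hint
  have h1 : ∫ ω, Φ (u ω, z ω) ∂Pr = ∫ q, Φ q ∂((Pr.map u).prod (Pr.map z)) := by
    rw [← hmap, integral_map (hu.prodMk hz).aemeasurable hΦ.aestronglyMeasurable]
  rw [h1, integral_prod _ hint', integral_map hu.aemeasurable]
  exact hΦ.stronglyMeasurable.integral_prod_right'.aestronglyMeasurable

variable {E : Type*} [NormedAddCommGroup E] [InnerProductSpace ℝ E] [CompleteSpace E]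
  [MeasurableSpace E] [BorelSpace E] [SecondCountableTopology E]

/-- A centred function of a fresh sample is orthogonal to everything that is determined by the
past. -/
theorem integral_inner_fresh_eq_zero (hm : m ≤ mΩ) {Y : Ω → E} {u : Ω → U}
    {z : Ω → Z} (hY : Measurable[m] Y) (hu : Measurable[m] u) (hz : Measurable z)
    (hind : Indep m (MeasurableSpace.comap z inferInstance) Pr) {Φ : U × Z → E}
    (hΦ : Measurable Φ) (hΦi : ∀ a, Integrable (fun y => Φ (a, y)) (Pr.map z))
    (hΦ0 : ∀ a, ∫ y, Φ (a, y) ∂(Pr.map z) = 0) (hYb : ∃ C : ℝ, ∀ ω, ‖Y ω‖ ≤ C)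
    (hΦb : ∃ C : ℝ, ∀ ω, ‖Φ (u ω, z ω)‖ ≤ C) :
    ∫ ω, inner ℝ (Y ω) (Φ (u ω, z ω)) ∂Pr = 0 := by
  -- Both the test vector and the state belong to the past, so they are frozen together as one
  -- variable.
  have hpair : Measurable[m] fun ω => (Y ω, u ω) := hY.prodMk hu
  have hind' : IndepFun (fun ω => (Y ω, u ω)) z Pr := by
    rw [IndepFun_iff_Indep]
    exact indep_of_indep_of_le_left hind hpair.comap_le
  have hYm : Measurable Y := hY.mono hm le_rfl
  have hum : Measurable u := hu.mono hm le_rfl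
  have h1 := integral_indepFun (Φ := fun q : (E × U) × Z => inner ℝ q.1.1 (Φ (q.1.2, q.2)))
    (hpair.mono hm le_rfl) hz hind'
    ((measurable_fst.comp measurable_fst).inner
      (hΦ.comp ((measurable_snd.comp measurable_fst).prodMk measurable_snd)))
    ((BddMeas.mk hYm hYb).inner
      (BddMeas.mk (f := fun ω => Φ (u ω, z ω)) (hΦ.comp (hum.prodMk hz)) hΦb)).integrable
  rw [h1]
  refine integral_eq_zero_of_ae (Filter.Eventually.of_forall fun ω => ?_)
  simp only [Pi.zero_apply]
  rw [integral_inner (hΦi _), hΦ0, inner_zero_right]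

end decoupling

/-! ### Orthogonal noise -/

theorem norm_sq_convex_le {E : Type*} [NormedAddCommGroup E] [InnerProductSpace ℝ E] {θ : ℝ} (hθ0 : 0 ≤ θ) (hθ1 : θ ≤ 1) (x y : E) :
    ‖θ • x + (1 - θ) • y‖ ^ 2 ≤ θ * ‖x‖ ^ 2 + (1 - θ) * ‖y‖ ^ 2 := by
  have h1 : ‖θ • x + (1 - θ) • y‖ ≤ θ * ‖x‖ + (1 - θ) * ‖y‖ := by
    refine (norm_add_le _ _).trans_eq ?_
    rw [norm_smul, norm_smul, Real.norm_of_nonneg hθ0, Real.norm_of_nonneg (by linarith)]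
  have h2 := pow_le_pow_left₀ (norm_nonneg _) h1 2
  nlinarith [mul_nonneg (mul_nonneg hθ0 (sub_nonneg.mpr hθ1)) (sq_nonneg (‖x‖ - ‖y‖))]

section orthogonal

variable {Ω : Type*} [MeasurableSpace Ω] {Pr : Measure Ω} [IsProbabilityMeasure Pr]
  {E : Type*} [NormedAddCommGroup E] [InnerProductSpace ℝ E]
  [MeasurableSpace E] [BorelSpace E] [SecondCountableTopology E]

theorem integral_norm_sq_sum_eq {ι : Type*} [Fintype ι] {ξ : ι → Ω → E} (hξ : ∀ i, BddMeas (ξ i))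
    (hort : ∀ i j, i ≠ j → ∫ ω, inner ℝ (ξ i ω) (ξ j ω) ∂Pr = 0) :
    ∫ ω, ‖∑ i, ξ i ω‖ ^ 2 ∂Pr = ∑ i, ∫ ω, ‖ξ i ω‖ ^ 2 ∂Pr := by
  classical
  have h1 : ∀ ω, ‖∑ i, ξ i ω‖ ^ 2 = ∑ i, ∑ j, inner ℝ (ξ i ω) (ξ j ω) := by
    intro ω
    rw [← real_inner_self_eq_norm_sq, sum_inner]
    exact Finset.sum_congr rfl fun i _ => inner_sum _ _ _
  simp_rw [h1]
  rw [integral_finsetSum _ fun i _ =>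
    (BddMeas.sum fun j _ => (hξ i).inner (hξ j)).integrable]
  refine Finset.sum_congr rfl fun i _ => ?_
  rw [integral_finsetSum _ fun j _ => ((hξ i).inner (hξ j)).integrable]
  rw [Finset.sum_eq_single i (fun j _ hj => hort i j hj.symm)
    (fun h => absurd (Finset.mem_univ i) h)]
  simp_rw [real_inner_self_eq_norm_sq]

theorem integral_norm_sq_average_le {K : ℕ} (hK : 0 < K) {ξ : Fin K → Ω → E} {C : ℝ}
    (hξ : ∀ k, BddMeas (ξ k)) (hC : ∀ k ω, ‖ξ k ω‖ ≤ C)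
    (hort : ∀ k l, k ≠ l → ∫ ω, inner ℝ (ξ k ω) (ξ l ω) ∂Pr = 0) :
    ∫ ω, ‖(1 / (K : ℝ)) • ∑ k, ξ k ω‖ ^ 2 ∂Pr ≤ C ^ 2 / K := by
  have hK' : (0 : ℝ) < K := by exact_mod_cast hK
  simp_rw [norm_smul, mul_pow]
  rw [integral_const_mul, integral_norm_sq_sum_eq hξ hort]
  have h1 : ∀ k, ∫ ω, ‖ξ k ω‖ ^ 2 ∂Pr ≤ C ^ 2 := by
    intro k
    have : ∫ _ω, C ^ 2 ∂Pr = C ^ 2 := by simp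
    rw [← this]
    exact integral_mono (hξ k).norm_sq.integrable (integrable_const _) fun ω =>
      pow_le_pow_left₀ (norm_nonneg _) (hC k ω) 2
  have h2 : ∑ k, ∫ ω, ‖ξ k ω‖ ^ 2 ∂Pr ≤ K * C ^ 2 := by
    refine (Finset.sum_le_sum fun k _ => h1 k).trans_eq ?_
    simp
  rw [Real.norm_eq_abs, sq_abs]
  calc (1 / (K : ℝ)) ^ 2 * _ ≤ (1 / (K : ℝ)) ^ 2 * (K * C ^ 2) :=
        mul_le_mul_of_nonneg_left h2 (by positivity)
    _ = C ^ 2 / K := by field_simp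

/-- Orthogonality removes the cross term, and the factor θ² ≤ 1 is discarded. Hence second moments
of accumulated noise merely add up. -/
theorem integral_norm_sq_noise_step {θ c s M : ℝ} (hθ0 : 0 ≤ θ) (hθ1 : θ ≤ 1) {n ξ : Ω → E}
    (hn : BddMeas n) (hξ : BddMeas ξ) (hort : ∫ ω, inner ℝ (n ω) (ξ ω) ∂Pr = 0)
    (hs : ∫ ω, ‖ξ ω‖ ^ 2 ∂Pr ≤ s) (hM : ∫ ω, ‖n ω‖ ^ 2 ∂Pr ≤ M) :
    ∫ ω, ‖θ • n ω + c • ξ ω‖ ^ 2 ∂Pr ≤ M + c ^ 2 * s := by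
  have h1 : ∀ ω, ‖θ • n ω + c • ξ ω‖ ^ 2
      = θ ^ 2 * ‖n ω‖ ^ 2 + 2 * (θ * c) * inner ℝ (n ω) (ξ ω) + c ^ 2 * ‖ξ ω‖ ^ 2 := by
    intro ω
    rw [norm_add_sq_real, norm_smul, norm_smul, inner_smul_left, inner_smul_right, mul_pow,
      mul_pow, Real.norm_eq_abs, Real.norm_eq_abs, sq_abs, sq_abs]
    simp
    ring
  simp_rw [h1]
  have i1 := (hn.norm_sq.const_mul (θ ^ 2)).integrable (Pr := Pr)
  have i2 := ((hn.inner hξ).const_mul (2 * (θ * c))).integrable (Pr := Pr)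
  have i3 := (hξ.norm_sq.const_mul (c ^ 2)).integrable (Pr := Pr)
  have i12 : Integrable (fun ω => θ ^ 2 * ‖n ω‖ ^ 2 + 2 * (θ * c) * inner ℝ (n ω) (ξ ω)) Pr :=
    i1.add i2
  rw [integral_add i12 i3, integral_add i1 i2, integral_const_mul, integral_const_mul,
    integral_const_mul, hort, mul_zero, add_zero]
  have h2 : 0 ≤ ∫ ω, ‖n ω‖ ^ 2 ∂Pr := integral_nonneg fun ω => by positivity
  have h3 : θ ^ 2 ≤ 1 := pow_le_one₀ hθ0 hθ1
  exact add_le_add ((mul_le_of_le_one_left h2 h3).trans hM)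
    (mul_le_mul_of_nonneg_left hs (sq_nonneg _))

theorem integral_norm_sq_convex_le {θ M : ℝ} (hθ0 : 0 ≤ θ) (hθ1 : θ ≤ 1) {x y : Ω → E}
    (hx : BddMeas x) (hy : BddMeas y) (hxM : ∫ ω, ‖x ω‖ ^ 2 ∂Pr ≤ M)
    (hyM : ∫ ω, ‖y ω‖ ^ 2 ∂Pr ≤ M) :
    ∫ ω, ‖θ • x ω + (1 - θ) • y ω‖ ^ 2 ∂Pr ≤ M := by
  have i1 := (hx.norm_sq.const_mul θ).integrable (Pr := Pr)
  have i2 := (hy.norm_sq.const_mul (1 - θ)).integrable (Pr := Pr)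
  refine (integral_mono ((hx.const_smul θ).add (hy.const_smul (1 - θ))).norm_sq.integrable
    (i1.add i2) fun ω => norm_sq_convex_le hθ0 hθ1 _ _).trans ?_
  simp only [Pi.add_apply]
  rw [integral_add i1 i2, integral_const_mul, integral_const_mul]
  nlinarith

end orthogonal

/-! ### Deterministic bounds for DSG -/

/-- The set of all `v = (w, a, b)` with `a, b ∈ [0, 1]`, which contains all iterates. -/
def unitBox (d : ℕ) : Set (Primal d) :=
  {v | aPart v ∈ Set.Icc (0 : ℝ) 1 ∧ bPart v ∈ Set.Icc (0 : ℝ) 1}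

theorem unitBox_subset_box (d : ℕ) : unitBox d ⊆ box d := fun v hv =>
  ⟨abs_le.mpr ⟨by linarith [hv.1.1], hv.1.2⟩, abs_le.mpr ⟨by linarith [hv.2.1], hv.2.2⟩⟩

theorem average_mem_Icc {ι : Type*} {s : Finset ι} (hs : s.Nonempty) {f : ι → ℝ}
    (hf : ∀ i ∈ s, f i ∈ Set.Icc (0 : ℝ) 1) :
    (1 / (s.card : ℝ)) * ∑ i ∈ s, f i ∈ Set.Icc (0 : ℝ) 1 := by
  have hc : (0 : ℝ) < s.card := by exact_mod_cast hs.card_pos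
  refine ⟨mul_nonneg (by positivity) (Finset.sum_nonneg fun i hi => (hf i hi).1), ?_⟩
  rw [one_div, inv_mul_le_iff₀ hc, mul_one]
  refine (Finset.sum_le_sum fun i hi => (hf i hi).2).trans ?_
  simp

theorem average_mem_unitBox {d : ℕ} {ι : Type*} {s : Finset ι} (hs : s.Nonempty)
    {f : ι → Primal d} (hf : ∀ i ∈ s, f i ∈ unitBox d) :
    (1 / (s.card : ℝ)) • ∑ i ∈ s, f i ∈ unitBox d := by
  constructor
  · rw [aPart_smul, aPart_sum]
    exact average_mem_Icc hs fun i hi => (hf i hi).1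
  · rw [bPart_smul, bPart_sum]
    exact average_mem_Icc hs fun i hi => (hf i hi).2

section dsg

variable {d K : ℕ} {X : Type*}

/-- One local step of DSG. -/
def localStep (p : ℝ) (h : Weights d → X → ℝ) (γ η : ℝ) (v₀ : Primal d) (s : Primal d × ℝ)
    (z : X × Bool) : Primal d × ℝ :=
  (proxStep γ η v₀ s.1 (gradV p h s.1 s.2 z), s.2 + η * gradAlpha p h s.1 s.2 z)

/-- The average of the local variables. -/
def avgState (s : Fin K → Primal d × ℝ) : Primal d × ℝ :=
  ((1 / (K : ℝ)) • ∑ k, (s k).1, (1 / (K : ℝ)) * ∑ k, (s k).2)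

theorem dsgState_zero (p : ℝ) (h : Weights d → X → ℝ) (γ η : ℝ) (I : ℕ) (v₀ : Primal d) (α₀ : ℝ)
    (z : ℕ → Fin K → X × Bool) (k : Fin K) : dsgState p h γ η I v₀ α₀ z 0 k = (v₀, α₀) := rfl

theorem dsgState_succ (p : ℝ) (h : Weights d → X → ℝ) (γ η : ℝ) (I : ℕ) (v₀ : Primal d) (α₀ : ℝ)
    (z : ℕ → Fin K → X × Bool) (t : ℕ) :
    dsgState p h γ η I v₀ α₀ z (t + 1) =
      if (t + 1) % I = 0 then
        fun _ => avgState fun k => localStep p h γ η v₀ (dsgState p h γ η I v₀ α₀ z t k) (z t k)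
      else fun k => localStep p h γ η v₀ (dsgState p h γ η I v₀ α₀ z t k) (z t k) := rfl

theorem avgState_const (hK : 0 < K) (s : Primal d × ℝ) : avgState (fun _ : Fin K => s) = s :=
  Prod.ext (average_const hK s.1) (average_const hK s.2)

/-- Averaging is idempotent, so the mean state evolves by the same formula in communication rounds
and in local rounds. -/
theorem avgState_dsgState_succ (hK : 0 < K) (p : ℝ) (h : Weights d → X → ℝ) (γ η : ℝ) (I : ℕ)
    (v₀ : Primal d) (α₀ : ℝ) (z : ℕ → Fin K → X × Bool) (t : ℕ) :
    avgState (dsgState p h γ η I v₀ α₀ z (t + 1)) =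
      avgState fun k => localStep p h γ η v₀ (dsgState p h γ η I v₀ α₀ z t k) (z t k) := by
  rw [dsgState_succ]
  split_ifs
  · exact avgState_const hK _
  · rfl

theorem proxStep_sub_left {γ η : ℝ} (hγ : 0 < γ) (hη : 0 < η) (v₀ v g : Primal d) :
    proxStep γ η v₀ v g - v₀ = (γ / (η + γ)) • (v - v₀ - η • g) := by
  have hs : η + γ ≠ 0 := by positivity
  have h1 : η / (η + γ) = 1 - γ / (η + γ) := by field_simp; ring
  have h2 : η * γ / (η + γ) = γ / (η + γ) * η := by ring
  rw [proxStep, h1, h2]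
  module

theorem proxStep_sub_right {γ η : ℝ} (hγ : 0 < γ) (hη : 0 < η) (v₀ v g : Primal d) :
    proxStep γ η v₀ v g - v = (η / (η + γ)) • (v₀ - v - γ • g) := by
  have hs : η + γ ≠ 0 := by positivity
  have h1 : γ / (η + γ) = 1 - η / (η + γ) := by field_simp; ring
  have h2 : η * γ / (η + γ) = η / (η + γ) * γ := by ring
  rw [proxStep, h1, h2]
  module

/-- The region which the local variables do not leave. -/
structure InRegion (p Gh γ : ℝ) (v₀ : Primal d) (s : Primal d × ℝ) : Prop where
  mem : s.1 ∈ unitBox d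
  dual : |s.2| ≤ dualBound p
  near : ‖s.1 - v₀‖ ≤ γ * gradBound p Gh

theorem sub_average (hK : 0 < K) {E : Type*} [AddCommGroup E] [Module ℝ E] (x : E)
    (f : Fin K → E) : x - (1 / (K : ℝ)) • ∑ k, f k = (1 / (K : ℝ)) • ∑ k, (x - f k) := by
  rw [Finset.sum_sub_distrib, smul_sub, average_const hK]

theorem average_sub (hK : 0 < K) {E : Type*} [AddCommGroup E] [Module ℝ E] (x : E)
    (f : Fin K → E) : (1 / (K : ℝ)) • ∑ k, f k - x = (1 / (K : ℝ)) • ∑ k, (f k - x) := by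
  rw [Finset.sum_sub_distrib, smul_sub, average_const hK]

theorem InRegion.average {p Gh γ : ℝ} {v₀ : Primal d} (hp0 : 0 < p) (hp1 : p < 1)
    (hGh : 0 ≤ Gh) (hγ : 0 < γ) (hK : 0 < K) {s : Fin K → Primal d × ℝ}
    (hs : ∀ k, InRegion p Gh γ v₀ (s k)) : InRegion p Gh γ v₀ (avgState s) where
  mem := by
    have : Nonempty (Fin K) := ⟨⟨0, hK⟩⟩
    have := average_mem_unitBox (s := (Finset.univ : Finset (Fin K))) Finset.univ_nonempty
      fun k _ => (hs k).mem
    simpa [avgState] using this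
  dual := abs_average_le (zero_le_one.trans (one_le_dualBound hp0 hp1)) fun k => (hs k).dual
  near := by
    have h1 := gradBound_pos hp0 hp1 hGh
    simp only [avgState]
    rw [average_sub hK]
    exact norm_average_le (by positivity) fun k => (hs k).near

variable [MeasurableSpace X] {p Gh Lh L1 μ Δ₀ : ℝ} {h : Weights d → X → ℝ}
  {P : Fin K → Measure (X × Bool)}

/-- Each bound is invariant under the update. The components a and b become convex combinations of
old value, score and starting value; the decay of the dual step balances its input exactly at
1/(p(1-p)); the proximal pull balances a gradient of norm G exactly at distance γG. -/
theorem Assumptions.inRegion_localStep (hA : Assumptions p Gh Lh L1 μ Δ₀ h P) (hp0 : 0 < p)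
    (hp1 : p < 1) {γ η : ℝ} (hγ : 0 < γ) (hη : 0 < η) (hη1 : η ≤ 1 / 2)
    {v₀ : Primal d} (hv₀ : v₀ ∈ unitBox d) {s : Primal d × ℝ} (hs : InRegion p Gh γ v₀ s)
    (z : X × Bool) : InRegion p Gh γ v₀ (localStep p h γ η v₀ s z) := by
  have hsum : 0 < η + γ := by positivity
  have hθ0 : 0 < γ / (η + γ) := by positivity
  have hθ1 : γ / (η + γ) ≤ 1 := by rw [div_le_one hsum]; linarith
  obtain ⟨h0, h1⟩ := hA.score_mem (wPart s.1) z.1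
  have key : ∀ {a a₀ b i q : ℝ}, a ∈ Set.Icc (0 : ℝ) 1 → a₀ ∈ Set.Icc (0 : ℝ) 1 →
      b ∈ Set.Icc (0 : ℝ) 1 → (i = 0 ∨ i = 1) → 0 < q → q < 1 →
      γ / (η + γ) * a + η / (η + γ) * a₀ - η * γ / (η + γ) * (-(2 * q * (b - a) * i))
        ∈ Set.Icc (0 : ℝ) 1 := by
    intro a a₀ b i q ha ha₀ hb hi hq0 hq1
    -- Regrouped, the update is the θ-combination of the start a₀ with a convex combination of a and
    -- the score b; η ≤ 1/2 makes the inner weight 2qηi at most 1.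
    have e : γ / (η + γ) * a + η / (η + γ) * a₀ - η * γ / (η + γ) * (-(2 * q * (b - a) * i))
        = γ / (η + γ) * ((1 - 2 * q * η * i) * a + 2 * q * η * i * b)
          + (1 - γ / (η + γ)) * a₀ := by
      field_simp; ring
    have hc0 : 0 ≤ 2 * q * η * i := by rcases hi with rfl | rfl <;> simp; positivity
    have hc1 : 2 * q * η * i ≤ 1 := by rcases hi with rfl | rfl <;> simp; nlinarith
    rw [e]
    have hx := (convex_Icc (0 : ℝ) 1) ha hb (sub_nonneg.mpr hc1) hc0 (by ring)
    simp only [smul_eq_mul] at hx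
    have := (convex_Icc (0 : ℝ) 1) hx ha₀ hθ0.le (sub_nonneg.mpr hθ1) (by ring)
    simpa only [smul_eq_mul] using this
  refine ⟨⟨?_, ?_⟩, ?_, ?_⟩
  · simp only [localStep, proxStep, hA.gradV_eq, aPart_sub, aPart_add, aPart_smul, lossGrad,
      aPart_mkPrimal]
    exact key hs.mem.1 hv₀.1 ⟨h0, h1⟩ (posInd_mem z) (by linarith) (by linarith)
  · simp only [localStep, proxStep, hA.gradV_eq, bPart_sub, bPart_add, bPart_smul, lossGrad,
      bPart_mkPrimal]
    exact key hs.mem.2 hv₀.2 ⟨h0, h1⟩ (negInd_mem z) hp0 hp1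
  · simp only [localStep, gradAlpha_eq, lossGradDual]
    have hk : 0 < p * (1 - p) := mul_pos hp0 (by linarith)
    have e2 : |2 * (p * h (wPart s.1) z.1 * negInd z - (1 - p) * h (wPart s.1) z.1 * posInd z)|
        ≤ 2 := by
      rw [negInd_eq]
      rcases posInd_mem z with hz | hz <;> rw [hz, abs_le] <;> constructor <;> nlinarith
    set B := 2 * (p * h (wPart s.1) z.1 * negInd z - (1 - p) * h (wPart s.1) z.1 * posInd z)
    have e3 : s.2 + η * (B - 2 * (p * (1 - p)) * s.2)
        = (1 - 2 * (p * (1 - p)) * η) * s.2 + η * B := by ring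
    have e4 : 0 ≤ 1 - 2 * (p * (1 - p)) * η := by nlinarith
    rw [e3]
    refine (abs_add_le _ _).trans ?_
    rw [abs_mul, abs_mul, abs_of_nonneg e4, abs_of_pos hη]
    have e5 := mul_le_mul_of_nonneg_left hs.dual e4
    have e6 := mul_le_mul_of_nonneg_left e2 hη.le
    have e7 := dualBound_mul hp0 hp1
    nlinarith
  · simp only [localStep, hA.gradV_eq]
    rw [proxStep_sub_left hγ hη, norm_smul, Real.norm_of_nonneg hθ0.le]
    have e1 := hA.norm_lossGrad_le hp0 hp1 (unitBox_subset_box d hs.mem) hs.dual z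
    have e2 : ‖s.1 - v₀ - η • lossGrad p h s.1 s.2 z‖ ≤ (η + γ) * gradBound p Gh := by
      refine (norm_sub_le _ _).trans ?_
      rw [norm_smul, Real.norm_of_nonneg hη.le]
      nlinarith [hs.near]
    refine (mul_le_mul_of_nonneg_left e2 hθ0.le).trans_eq ?_
    field_simp

/-- A step consists of a gradient part of length at most ηG and a pull towards v₀; since v is within
γG of v₀, the pull is also at most ηG. -/
theorem Assumptions.norm_localStep_sub_le (hA : Assumptions p Gh Lh L1 μ Δ₀ h P) (hp0 : 0 < p)
    (hp1 : p < 1) {γ η : ℝ} (hγ : 0 < γ) (hη : 0 < η)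
    {v₀ : Primal d} {s : Primal d × ℝ} (hs : InRegion p Gh γ v₀ s)
    (z : X × Bool) :
    ‖(localStep p h γ η v₀ s z).1 - s.1‖ ≤ 2 * η * gradBound p Gh ∧
      |(localStep p h γ η v₀ s z).2 - s.2| ≤ 4 * η := by
  constructor
  · simp only [localStep, hA.gradV_eq]
    have e1 := hA.norm_lossGrad_le hp0 hp1 (unitBox_subset_box d hs.mem) hs.dual z
    have hG : 0 ≤ gradBound p Gh := (norm_nonneg _).trans e1
    rw [proxStep_sub_right hγ hη, norm_smul, Real.norm_of_nonneg (by positivity)]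
    have e2 : ‖v₀ - s.1 - γ • lossGrad p h s.1 s.2 z‖ ≤ γ * (2 * gradBound p Gh) := by
      refine (norm_sub_le _ _).trans ?_
      rw [norm_smul, Real.norm_of_nonneg hγ.le, norm_sub_rev]
      nlinarith [hs.near]
    have e3 : η / (η + γ) ≤ η / γ := div_le_div_of_nonneg_left hη.le hγ (by linarith)
    refine (mul_le_mul e3 e2 (norm_nonneg _) (by positivity)).trans_eq ?_
    field_simp
  · simp only [localStep, gradAlpha_eq, add_sub_cancel_left]
    rw [abs_mul, abs_of_pos hη]
    have := hA.abs_lossGradDual_le hp0 hp1 s.1 hs.dual z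
    nlinarith

theorem Assumptions.inRegion_dsgState (hA : Assumptions p Gh Lh L1 μ Δ₀ h P) (hK : 0 < K)
    (hp0 : 0 < p) (hp1 : p < 1) (hGh : 0 ≤ Gh) {γ η : ℝ} (hγ : 0 < γ) (hη : 0 < η)
    (hη1 : η ≤ 1 / 2) (I : ℕ) {v₀ : Primal d} (hv₀ : v₀ ∈ unitBox d) {α₀ : ℝ}
    (hα₀ : |α₀| ≤ dualBound p) (z : ℕ → Fin K → X × Bool) (t : ℕ) (k : Fin K) :
    InRegion p Gh γ v₀ (dsgState p h γ η I v₀ α₀ z t k) := by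
  induction t generalizing k with
  | zero =>
    refine ⟨hv₀, hα₀, ?_⟩
    have := gradBound_pos hp0 hp1 hGh
    simp only [dsgState_zero, sub_self, norm_zero]
    positivity
  | succ t ih =>
    rw [dsgState_succ]
    have h1 : ∀ k, InRegion p Gh γ v₀
        (localStep p h γ η v₀ (dsgState p h γ η I v₀ α₀ z t k) (z t k)) :=
      fun k => hA.inRegion_localStep hp0 hp1 hγ hη hη1 hv₀ (ih k) _
    split_ifs
    · exact InRegion.average hp0 hp1 hGh hγ hK h1
    · exact h1 k

theorem succ_mod_of_ne_zero {t I : ℕ} (ht : (t + 1) % I ≠ 0) : (t + 1) % I = t % I + 1 := by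
  rcases Nat.eq_zero_or_pos I with rfl | hI
  · simp
  have h2 : t % I < I := Nat.mod_lt _ hI
  have h1 : (t + 1) % I = (t % I + 1) % I := by simp
  rcases (Nat.succ_le_of_lt h2).eq_or_lt with h3 | h3
  · exact absurd (by rw [h1, show t % I + 1 = I from h3, Nat.mod_self]) ht
  · rw [h1, Nat.mod_eq_of_lt h3]

/-- The local variables of two machines do not drift apart between averaging steps. -/
theorem Assumptions.dsgState_drift (hA : Assumptions p Gh Lh L1 μ Δ₀ h P) (hK : 0 < K)
    (hp0 : 0 < p) (hp1 : p < 1) (hGh : 0 ≤ Gh) {γ η : ℝ} (hγ : 0 < γ) (hη : 0 < η)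
    (hη1 : η ≤ 1 / 2) (I : ℕ) {v₀ : Primal d} (hv₀ : v₀ ∈ unitBox d) {α₀ : ℝ}
    (hα₀ : |α₀| ≤ dualBound p) (z : ℕ → Fin K → X × Bool) (t : ℕ) (k l : Fin K) :
    ‖(dsgState p h γ η I v₀ α₀ z t k).1 - (dsgState p h γ η I v₀ α₀ z t l).1‖
        ≤ 4 * η * gradBound p Gh * (t % I : ℕ) ∧
      |(dsgState p h γ η I v₀ α₀ z t k).2 - (dsgState p h γ η I v₀ α₀ z t l).2|
        ≤ 8 * η * (t % I : ℕ) := by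
  induction t generalizing k l with
  | zero => simp [dsgState_zero]
  | succ t ih =>
    rw [dsgState_succ]
    split_ifs with ht
    · simp [ht]
    · rw [succ_mod_of_ne_zero ht]
      obtain ⟨i1, i2⟩ := ih k l
      have hreg := hA.inRegion_dsgState hK hp0 hp1 hGh hγ hη hη1 I hv₀ hα₀ z t
      obtain ⟨a1, a2⟩ := hA.norm_localStep_sub_le hp0 hp1 hγ hη (hreg k) (z t k)
      obtain ⟨b1, b2⟩ := hA.norm_localStep_sub_le hp0 hp1 hγ hη (hreg l) (z t l)
      have tri : ∀ {E : Type} [NormedAddCommGroup E] (x y x' y' : E),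
          ‖x' - y'‖ ≤ ‖x' - x‖ + ‖y' - y‖ + ‖x - y‖ := by
        intro E _ x y x' y'
        have : x' - y' = (x' - x) - (y' - y) + (x - y) := by abel
        rw [this]
        exact (norm_add_le _ _).trans (add_le_add_left (norm_sub_le _ _) _)
      push_cast
      constructor
      · refine (tri (dsgState p h γ η I v₀ α₀ z t k).1 (dsgState p h γ η I v₀ α₀ z t l).1
          _ _).trans ?_
        linarith
      · refine (tri (dsgState p h γ η I v₀ α₀ z t k).2 (dsgState p h γ η I v₀ α₀ z t l).2
          _ _).trans ?_
        simp only [Real.norm_eq_abs]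
        linarith

/-- The local variables stay close to their average. -/
theorem Assumptions.dsgState_sub_avgState (hA : Assumptions p Gh Lh L1 μ Δ₀ h P) (hK : 0 < K)
    (hp0 : 0 < p) (hp1 : p < 1) (hGh : 0 ≤ Gh) {γ η : ℝ} (hγ : 0 < γ) (hη : 0 < η)
    (hη1 : η ≤ 1 / 2) {I : ℕ} (hI : 1 ≤ I) {v₀ : Primal d} (hv₀ : v₀ ∈ unitBox d) {α₀ : ℝ}
    (hα₀ : |α₀| ≤ dualBound p) (z : ℕ → Fin K → X × Bool) (t : ℕ) (k : Fin K) :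
    ‖(dsgState p h γ η I v₀ α₀ z t k).1 - (avgState (dsgState p h γ η I v₀ α₀ z t)).1‖
        ≤ 4 * gradBound p Gh * (((I : ℝ) - 1) * η) ∧
      |(dsgState p h γ η I v₀ α₀ z t k).2 - (avgState (dsgState p h γ η I v₀ α₀ z t)).2|
        ≤ 8 * (((I : ℝ) - 1) * η) := by
  -- The bound I - 1 rather than I matters: it is 0 for I = 1, the case in which the outer `max`
  -- with 1 may push I above 1/√(Kη).
  have hmod : ((t % I : ℕ) : ℝ) ≤ (I : ℝ) - 1 := by
    have : t % I + 1 ≤ I := Nat.mod_lt _ hI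
    have : ((t % I : ℕ) : ℝ) + 1 ≤ I := by exact_mod_cast this
    linarith
  have hI' : (1 : ℝ) ≤ I := by exact_mod_cast hI
  have hG := gradBound_pos hp0 hp1 hGh
  have hd := hA.dsgState_drift hK hp0 hp1 hGh hγ hη hη1 I hv₀ hα₀ z t k
  have hnn : 0 ≤ (I : ℝ) - 1 := by linarith
  constructor
  · simp only [avgState]
    rw [sub_average hK]
    refine norm_average_le (by positivity) fun l => (hd l).1.trans ?_
    calc 4 * η * gradBound p Gh * ((t % I : ℕ) : ℝ)
        ≤ 4 * η * gradBound p Gh * ((I : ℝ) - 1) :=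
          mul_le_mul_of_nonneg_left hmod (by positivity)
      _ = _ := by ring
  · simp only [avgState]
    have := sub_average hK (dsgState p h γ η I v₀ α₀ z t k).2
      fun l => (dsgState p h γ η I v₀ α₀ z t l).2
    simp only [smul_eq_mul] at this
    rw [this]
    refine abs_average_le (by positivity) fun l => (hd l).2.trans ?_
    calc 8 * η * ((t % I : ℕ) : ℝ) ≤ 8 * η * ((I : ℝ) - 1) :=
          mul_le_mul_of_nonneg_left hmod (by positivity)
      _ = _ := by ring

omit [MeasurableSpace X] in
theorem dsgOutput_eq (p : ℝ) (h : Weights d → X → ℝ) (γ η : ℝ) (T I : ℕ) (v₀ : Primal d) (α₀ : ℝ)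
    (z : ℕ → Fin K → X × Bool) :
    dsgOutput p h γ η T I v₀ α₀ z =
      (1 / (T : ℝ)) • ∑ t ∈ Finset.Icc 1 T, (avgState (dsgState p h γ η I v₀ α₀ z t)).1 := by
  simp only [dsgOutput, avgState]
  rw [← Finset.smul_sum, ← Finset.smul_sum, smul_comm, Finset.sum_comm]

theorem Assumptions.dsgOutput_mem (hA : Assumptions p Gh Lh L1 μ Δ₀ h P) (hK : 0 < K)
    (hp0 : 0 < p) (hp1 : p < 1) (hGh : 0 ≤ Gh) {γ η : ℝ} (hγ : 0 < γ) (hη : 0 < η)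
    (hη1 : η ≤ 1 / 2) {T : ℕ} (hT : 1 ≤ T) (I : ℕ) {v₀ : Primal d} (hv₀ : v₀ ∈ unitBox d) {α₀ : ℝ}
    (hα₀ : |α₀| ≤ dualBound p) (z : ℕ → Fin K → X × Bool) :
    dsgOutput p h γ η T I v₀ α₀ z ∈ unitBox d := by
  rw [dsgOutput_eq]
  have := average_mem_unitBox (s := Finset.Icc 1 T) (Finset.nonempty_Icc.mpr hT)
    (f := fun t => (avgState (dsgState p h γ η I v₀ α₀ z t)).1) fun t _ =>
      (InRegion.average hp0 hp1 hGh hγ hK fun k =>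
        hA.inRegion_dsgState hK hp0 hp1 hGh hγ hη hη1 I hv₀ hα₀ z t k).mem
  simpa using this

theorem Assumptions.measurable_localStep (hA : Assumptions p Gh Lh L1 μ Δ₀ h P)
    {Ω : Type*} [MeasurableSpace Ω] (γ η : ℝ) {v₀ : Ω → Primal d} {s : Ω → Primal d × ℝ}
    {z : Ω → X × Bool} (hv₀ : Measurable v₀) (hs : Measurable s) (hz : Measurable z) :
    Measurable fun ω => localStep p h γ η (v₀ ω) (s ω) (z ω) := by
  have hs1 : Measurable fun ω => (s ω).1 := measurable_fst.comp hs
  have hs2 : Measurable fun ω => (s ω).2 := measurable_snd.comp hs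
  have h1 := hA.measurable_lossGrad hs1 hs2 hz
  have h2 := hA.measurable_lossGradDual hs1 hs2 hz
  simp only [localStep, proxStep, hA.gradV_eq, gradAlpha_eq]
  exact (((hs1.const_smul (γ / (η + γ))).add (hv₀.const_smul (η / (η + γ)))).sub
    (h1.const_smul (η * γ / (η + γ)))).prodMk (hs2.add (h2.const_mul η))

omit [MeasurableSpace X] in
theorem measurable_avgState {Ω : Type*} [MeasurableSpace Ω] {s : Ω → Fin K → Primal d × ℝ}
    (hs : ∀ k, Measurable fun ω => s ω k) : Measurable fun ω => avgState (s ω) := by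
  have h1 : Measurable fun ω => ∑ k, (s ω k).1 :=
    Finset.measurable_sum _ fun k _ => measurable_fst.comp (hs k)
  have h2 : Measurable fun ω => ∑ k, (s ω k).2 :=
    Finset.measurable_sum _ fun k _ => measurable_snd.comp (hs k)
  exact (h1.const_smul (1 / (K : ℝ))).prodMk (h2.const_mul (1 / (K : ℝ)))

/-- Only samples before time t enter. As the σ-algebra on Ω is arbitrary, this statement also
expresses predictability: it is applied to σ-algebras that omit a fresh sample. -/
theorem Assumptions.measurable_dsgState (hA : Assumptions p Gh Lh L1 μ Δ₀ h P)
    {Ω : Type*} {_ : MeasurableSpace Ω} (γ η : ℝ) (I : ℕ) {v₀ : Ω → Primal d} {α₀ : Ω → ℝ}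
    {z : ℕ → Fin K → Ω → X × Bool} (hv₀ : Measurable v₀) (hα₀ : Measurable α₀) (t : ℕ)
    (hz : ∀ t' < t, ∀ k, Measurable (z t' k)) (k : Fin K) :
    Measurable fun ω => dsgState p h γ η I (v₀ ω) (α₀ ω) (fun t k => z t k ω) t k := by
  induction t generalizing k with
  | zero => exact hv₀.prodMk hα₀
  | succ t ih =>
    have h1 : ∀ k, Measurable fun ω => localStep p h γ η (v₀ ω)
        (dsgState p h γ η I (v₀ ω) (α₀ ω) (fun t k => z t k ω) t k) (z t k ω) := fun k =>
      hA.measurable_localStep γ η hv₀ (ih (fun t' ht' => hz t' (by omega)) k)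
        (hz t (Nat.lt_succ_self t) k)
    simp only [dsgState_succ]
    split_ifs
    · exact measurable_avgState h1
    · exact h1 k

theorem Assumptions.measurable_dsgOutput (hA : Assumptions p Gh Lh L1 μ Δ₀ h P)
    {Ω : Type*} {_ : MeasurableSpace Ω} (γ η : ℝ) (T I : ℕ) {v₀ : Ω → Primal d} {α₀ : Ω → ℝ}
    {z : ℕ → Fin K → Ω → X × Bool} (hv₀ : Measurable v₀) (hα₀ : Measurable α₀)
    (hz : ∀ t k, Measurable (z t k)) :
    Measurable fun ω => dsgOutput p h γ η T I (v₀ ω) (α₀ ω) (fun t k => z t k ω) := by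
  simp only [dsgOutput_eq]
  have h1 : Measurable fun ω => ∑ t ∈ Finset.Icc 1 T,
      (avgState (dsgState p h γ η I (v₀ ω) (α₀ ω) (fun t k => z t k ω) t)).1 :=
    Finset.measurable_sum _ fun t _ => measurable_fst.comp (measurable_avgState fun k =>
      hA.measurable_dsgState γ η I hv₀ hα₀ t (fun t' _ k => hz t' k) k)
  exact h1.const_smul (1 / (T : ℝ))

end dsg

/-! ### A coupled linear recursion with noise -/

section recursion

/-- The accumulated noise `n_{t+1} = θ n_t + c ξ_t`, `n_0 = 0`. -/
def accNoise {E : Type*} [AddCommGroup E] [Module ℝ E] (θ c : ℝ) (ξ : ℕ → E) : ℕ → E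
  | 0 => 0
  | t + 1 => θ • accNoise θ c ξ t + c • ξ t

theorem norm_add_three_sq_le {E : Type*} [NormedAddCommGroup E] (x y z : E) :
    ‖x + y + z‖ ^ 2 ≤ 3 * ‖x‖ ^ 2 + 3 * ‖y‖ ^ 2 + 3 * ‖z‖ ^ 2 := by
  have h := pow_le_pow_left₀ (norm_nonneg _) (norm_add₃_le (a := x) (b := y) (c := z)) 2
  nlinarith [sq_nonneg (‖x‖ - ‖y‖), sq_nonneg (‖y‖ - ‖z‖), sq_nonneg (‖x‖ - ‖z‖)]

theorem norm_add_sq_le_two {E : Type*} [NormedAddCommGroup E] (x y : E) :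
    ‖x + y‖ ^ 2 ≤ 2 * ‖x‖ ^ 2 + 2 * ‖y‖ ^ 2 := by
  have h := pow_le_pow_left₀ (norm_nonneg _) (norm_add_le x y) 2
  nlinarith [sq_nonneg (‖x‖ - ‖y‖)]

variable {Ω : Type*} [MeasurableSpace Ω] {Pr : Measure Ω} [IsProbabilityMeasure Pr]
  {E : Type*} [NormedAddCommGroup E] [InnerProductSpace ℝ E]
  [MeasurableSpace E] [BorelSpace E] [SecondCountableTopology E]

theorem bddMeas_accNoise {θ c : ℝ} {ξ : ℕ → Ω → E} (hξ : ∀ t, BddMeas (ξ t)) (t : ℕ) :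
    BddMeas fun ω => accNoise θ c (fun t => ξ t ω) t := by
  induction t with
  | zero => exact BddMeas.const 0
  | succ t ih => exact (ih.const_smul θ).add ((hξ t).const_smul c)

/-- Martingale-type bound: contraction and orthogonality make the second moment grow at most
linearly in t. -/
theorem integral_norm_sq_accNoise_le {θ c s : ℝ} (hθ0 : 0 ≤ θ) (hθ1 : θ ≤ 1) {ξ : ℕ → Ω → E}
    (hξ : ∀ t, BddMeas (ξ t))
    (hort : ∀ t, ∫ ω, inner ℝ (accNoise θ c (fun t => ξ t ω) t) (ξ t ω) ∂Pr = 0)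
    (hs : ∀ t, ∫ ω, ‖ξ t ω‖ ^ 2 ∂Pr ≤ s) (t : ℕ) :
    ∫ ω, ‖accNoise θ c (fun t => ξ t ω) t‖ ^ 2 ∂Pr ≤ t * (c ^ 2 * s) := by
  induction t with
  | zero => simp [accNoise]
  | succ t ih =>
    have := integral_norm_sq_noise_step (c := c) hθ0 hθ1 (bddMeas_accNoise (θ := θ) (c := c) hξ t)
      (hξ t) (hort t) (hs t) ih
    push_cast
    rw [add_mul, one_mul]
    exact this

/-- The noise is linear in the recursion and is subtracted first. What remains, measured from the
noiseless path -γ(1-θ^t)g, is a convex combination of previous biases, so it never exceeds the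
largest bias. The bias bound in turn depends on x and β, hence an induction over t with levels `Mx`,
`Mβ`, `Mδ`, `Mb` chosen in advance; the hypotheses on these levels say that the bootstrap reproduces
them. -/
theorem coupled_recursion_bound {γ η lam a a' c N₁ N₂ Mx Mβ Mb Mδ : ℝ} (hγ : 0 < γ) (hη : 0 < η)
    (hl0 : 0 ≤ lam) (hl1 : lam ≤ 1) (ha : 0 ≤ a) (ha' : 0 ≤ a') {T : ℕ}
    {x b ξ : ℕ → Ω → E} {g : Ω → E} {β δ ζ : ℕ → Ω → ℝ}
    (hx : ∀ t, BddMeas (x t)) (hb : ∀ t, BddMeas (b t)) (hξ : ∀ t, BddMeas (ξ t))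
    (hg : BddMeas g) (hβ : ∀ t, BddMeas (β t)) (hδ : ∀ t, BddMeas (δ t))
    (hζ : ∀ t, BddMeas (ζ t))
    (hx0 : ∀ ω, x 0 ω = 0)
    (hxs : ∀ t ω, x (t + 1) ω = (γ / (η + γ)) • (x t ω - η • (g ω + b t ω + ξ t ω)))
    (hβs : ∀ t ω, β (t + 1) ω = (1 - lam) * β t ω + lam * δ t ω + η * ζ t ω)
    (hbb : ∀ t ω, ‖b t ω‖ ^ 2 ≤ a * (c + ‖x t ω‖ ^ 2 + β t ω ^ 2))
    (hδb : ∀ t ω, δ t ω ^ 2 ≤ a' * (c + ‖x t ω‖ ^ 2))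
    (hn : ∀ t ≤ T, ∫ ω, ‖accNoise (γ / (η + γ)) (-(γ / (η + γ) * η)) (fun t => ξ t ω) t‖ ^ 2 ∂Pr
      ≤ N₁)
    (hm : ∀ t ≤ T, ∫ ω, accNoise (1 - lam) η (fun t => ζ t ω) t ^ 2 ∂Pr ≤ N₂)
    (hMδ : a' * (c + Mx) ≤ Mδ) (hMδ0 : 0 ≤ Mδ) (hMb0 : 0 ≤ Mb)
    (hMβ : 3 * ∫ ω, β 0 ω ^ 2 ∂Pr + 3 * Mδ + 3 * N₂ ≤ Mβ)
    (hMb : a * (c + Mx + Mβ) ≤ Mb)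
    (hMx : 3 * γ ^ 2 * ∫ ω, ‖g ω‖ ^ 2 ∂Pr + 3 * (γ ^ 2 * Mb) + 3 * N₁ ≤ Mx)
    (t : ℕ) (ht : t ≤ T) :
    ∫ ω, ‖x t ω + (γ * (1 - (γ / (η + γ)) ^ t)) • g ω‖ ^ 2 ∂Pr ≤ 2 * (γ ^ 2 * Mb) + 2 * N₁ := by
  have hsum : 0 < η + γ := by positivity
  set θ := γ / (η + γ) with hθ
  have hθ0 : 0 ≤ θ := by positivity
  have hθ1 : θ ≤ 1 := by rw [hθ, div_le_one hsum]; linarith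
  -- This identity makes -γg the fixed point of the noiseless recursion and turns the bias into the
  -- term of weight 1 - θ.
  have hθη : θ * η = (1 - θ) * γ := by rw [hθ]; field_simp; ring
  set n : ℕ → Ω → E := fun t ω => accNoise θ (-(θ * η)) (fun t => ξ t ω) t with hnd
  set m : ℕ → Ω → ℝ := fun t ω => accNoise (1 - lam) η (fun t => ζ t ω) t with hmd
  -- Remainder after removing noiseless path and accumulated noise; it satisfies r' = θr +
  -- (1-θ)(-γb).
  set r : ℕ → Ω → E := fun t ω => x t ω + (γ * (1 - θ ^ t)) • g ω - n t ω with hrd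
  -- The same for the dual error, where the noiseless path is the decay of the initial error.
  set q : ℕ → Ω → ℝ := fun t ω => β t ω - (1 - lam) ^ t * β 0 ω - m t ω with hqd
  have hnB : ∀ t, BddMeas (n t) := fun t => bddMeas_accNoise hξ t
  have hmB : ∀ t, BddMeas (m t) := fun t => bddMeas_accNoise hζ t
  have hrB : ∀ t, BddMeas (r t) := fun t => ((hx t).add (hg.const_smul _)).sub (hnB t)
  have hqB : ∀ t, BddMeas (q t) := fun t => ((hβ t).sub ((hβ 0).const_mul _)).sub (hmB t)
  have hrs : ∀ t ω, r (t + 1) ω = θ • r t ω + (1 - θ) • (-γ) • b t ω := by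
    intro t ω
    have e1 : n (t + 1) ω = θ • n t ω + (-(θ * η)) • ξ t ω := rfl
    have e2 : γ * (1 - θ ^ (t + 1)) = θ * (γ * (1 - θ ^ t)) + θ * η := by
      rw [hθη, pow_succ]; ring
    have e3 : (1 - θ) • (-γ) • b t ω = (-(θ * η)) • b t ω := by
      rw [smul_smul, hθη]; congr 1; ring
    simp only [hrd]
    rw [e1, e2, e3, hxs]
    module
  have hqs : ∀ t ω, q (t + 1) ω = (1 - lam) • q t ω + (1 - (1 - lam)) • δ t ω := by
    intro t ω
    have e1 : m (t + 1) ω = (1 - lam) • m t ω + η • ζ t ω := rfl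
    simp only [hqd]
    rw [e1, hβs, pow_succ]
    simp only [smul_eq_mul]
    ring
  have hg0 : 0 ≤ ∫ ω, ‖g ω‖ ^ 2 ∂Pr := integral_nonneg fun ω => by positivity
  have hβ0 : 0 ≤ ∫ ω, β 0 ω ^ 2 ∂Pr := integral_nonneg fun ω => by positivity
  have key : ∀ t ≤ T, ∫ ω, ‖r t ω‖ ^ 2 ∂Pr ≤ γ ^ 2 * Mb ∧ ∫ ω, ‖q t ω‖ ^ 2 ∂Pr ≤ Mδ := by
    intro t
    induction t with
    | zero =>
      intro _
      have e1 : ∀ ω, r 0 ω = 0 := by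
        intro ω
        have e2 : n 0 ω = 0 := rfl
        simp only [hrd]
        rw [hx0, e2]
        simp
      have e3 : ∀ ω, q 0 ω = 0 := by
        intro ω
        have e2 : m 0 ω = 0 := rfl
        simp only [hqd]
        rw [e2]
        simp
      simp only [e1, e3, norm_zero]
      simp only [ne_eq, OfNat.ofNat_ne_zero, not_false_eq_true, zero_pow, integral_zero]
      exact ⟨by positivity, hMδ0⟩
    | succ t ih =>
      intro ht
      obtain ⟨hr, hq⟩ := ih (by omega)
      have htT : t ≤ T := by omega
      have hw0 : 0 ≤ θ ^ t := by positivity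
      have hw1 : θ ^ t ≤ 1 := pow_le_one₀ hθ0 hθ1
      -- Reassemble x from path, remainder and noise; the induction hypothesis on r supplies the
      -- middle term.
      have hxM : ∫ ω, ‖x t ω‖ ^ 2 ∂Pr ≤ Mx := by
        have hpt : ∀ ω, ‖x t ω‖ ^ 2
            ≤ 3 * γ ^ 2 * ‖g ω‖ ^ 2 + (3 * ‖r t ω‖ ^ 2 + 3 * ‖n t ω‖ ^ 2) := by
          intro ω
          have e1 : x t ω = (-(γ * (1 - θ ^ t))) • g ω + r t ω + n t ω := by
            simp only [hrd]; module
          have e2 := norm_add_three_sq_le ((-(γ * (1 - θ ^ t))) • g ω) (r t ω) (n t ω)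
          rw [← e1, norm_smul, mul_pow, norm_neg, Real.norm_of_nonneg
            (mul_nonneg hγ.le (by linarith)), mul_pow] at e2
          have e3 : (1 - θ ^ t) ^ 2 ≤ 1 := pow_le_one₀ (by linarith) (by linarith)
          have e4 : γ ^ 2 * (1 - θ ^ t) ^ 2 * ‖g ω‖ ^ 2 ≤ γ ^ 2 * ‖g ω‖ ^ 2 :=
            mul_le_mul_of_nonneg_right (mul_le_of_le_one_right (by positivity) e3)
              (by positivity)
          linarith
        have i1 := (hg.norm_sq.const_mul (3 * γ ^ 2)).integrable (Pr := Pr)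
        have i2 := ((hrB t).norm_sq.const_mul 3).integrable (Pr := Pr)
        have i3 := ((hnB t).norm_sq.const_mul 3).integrable (Pr := Pr)
        have i23 : Integrable (fun ω => 3 * ‖r t ω‖ ^ 2 + 3 * ‖n t ω‖ ^ 2) Pr := i2.add i3
        have e := integral_mono (hx t).norm_sq.integrable (i1.add i23) hpt
        simp only [Pi.add_apply] at e
        rw [integral_add i1 i23, integral_add i2 i3, integral_const_mul, integral_const_mul,
          integral_const_mul] at e
        have := hn t htT
        linarith
      have hβM : ∫ ω, β t ω ^ 2 ∂Pr ≤ Mβ := by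
        have hpt : ∀ ω, β t ω ^ 2 ≤ 3 * β 0 ω ^ 2 + (3 * ‖q t ω‖ ^ 2 + 3 * m t ω ^ 2) := by
          intro ω
          have e1 : β t ω = (1 - lam) ^ t * β 0 ω + q t ω + m t ω := by
            simp only [hqd]; ring
          have e2 := norm_add_three_sq_le ((1 - lam) ^ t * β 0 ω) (q t ω) (m t ω)
          rw [← e1] at e2
          simp only [Real.norm_eq_abs, sq_abs] at e2 ⊢
          have e3 : ((1 - lam) ^ t) ^ 2 ≤ 1 :=
            pow_le_one₀ (pow_nonneg (by linarith) _) (pow_le_one₀ (by linarith) (by linarith))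
          have e4 : ((1 - lam) ^ t * β 0 ω) ^ 2 ≤ β 0 ω ^ 2 := by
            rw [mul_pow]; exact mul_le_of_le_one_left (sq_nonneg _) e3
          linarith
        have i1 := ((hβ 0).sq.const_mul 3).integrable (Pr := Pr)
        have i2 := ((hqB t).norm_sq.const_mul 3).integrable (Pr := Pr)
        have i3 := ((hmB t).sq.const_mul 3).integrable (Pr := Pr)
        have i23 : Integrable (fun ω => 3 * ‖q t ω‖ ^ 2 + 3 * m t ω ^ 2) Pr := i2.add i3
        have e := integral_mono (hβ t).sq.integrable (i1.add i23) hpt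
        simp only [Pi.add_apply] at e
        rw [integral_add i1 i23, integral_add i2 i3, integral_const_mul, integral_const_mul,
          integral_const_mul] at e
        have := hm t htT
        linarith
      have i0 : Integrable (fun _ : Ω => c) Pr := integrable_const c
      have ix := (hx t).norm_sq.integrable (Pr := Pr)
      have iβ := (hβ t).sq.integrable (Pr := Pr)
      have i0x : Integrable (fun ω => c + ‖x t ω‖ ^ 2) Pr := i0.add ix
      have hbM : ∫ ω, ‖b t ω‖ ^ 2 ∂Pr ≤ Mb := by
        have e := integral_mono (hb t).norm_sq.integrable ((i0x.add iβ).const_mul a) (hbb t)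
        simp only [Pi.add_apply] at e
        rw [integral_const_mul, integral_add i0x iβ, integral_add i0 ix] at e
        simp only [integral_const, probReal_univ, one_smul] at e
        exact e.trans ((mul_le_mul_of_nonneg_left (by linarith) ha).trans hMb)
      have hδM : ∫ ω, ‖δ t ω‖ ^ 2 ∂Pr ≤ Mδ := by
        simp only [Real.norm_eq_abs, sq_abs]
        have e := integral_mono (hδ t).sq.integrable (i0x.const_mul a') (hδb t)
        rw [integral_const_mul, integral_add i0 ix] at e
        simp only [integral_const, probReal_univ, one_smul] at e
        exact e.trans ((mul_le_mul_of_nonneg_left (by linarith) ha').trans hMδ)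
      constructor
      · simp_rw [hrs]
        refine integral_norm_sq_convex_le hθ0 hθ1 (hrB t) ((hb t).const_smul _) hr ?_
        simp_rw [norm_smul, mul_pow]
        rw [integral_const_mul, norm_neg, Real.norm_of_nonneg hγ.le]
        exact mul_le_mul_of_nonneg_left hbM (by positivity)
      · simp_rw [hqs]
        exact integral_norm_sq_convex_le (by linarith) (by linarith) (hqB t) (hδ t) hq hδM
  have hpt : ∀ ω, ‖x t ω + (γ * (1 - θ ^ t)) • g ω‖ ^ 2 ≤ 2 * ‖r t ω‖ ^ 2 + 2 * ‖n t ω‖ ^ 2 := by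
    intro ω
    have e1 : x t ω + (γ * (1 - θ ^ t)) • g ω = r t ω + n t ω := by simp only [hrd]; module
    rw [e1]
    exact norm_add_sq_le_two _ _
  have i2 := ((hrB t).norm_sq.const_mul 2).integrable (Pr := Pr)
  have i3 := ((hnB t).norm_sq.const_mul 2).integrable (Pr := Pr)
  have e := integral_mono ((hx t).add (hg.const_smul _)).norm_sq.integrable (i2.add i3) hpt
  simp only [Pi.add_apply] at e
  rw [integral_add i2 i3, integral_const_mul, integral_const_mul] at e
  have := hn t ht
  have := (key t ht).1
  linarith

end recursion

/-! ### Fresh samples in a stage of CoDA -/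

section fresh

variable {d K : ℕ} {X : Type*} [MeasurableSpace X] {Ω : Type*}

/-- `Y` is determined by `v₀`, `α₀` and the samples other than `z t k`. -/
def DeterminedWithout (v₀ : Ω → Primal d) (α₀ : Ω → ℝ) (z : ℕ → Fin K → Ω → X × Bool) (t : ℕ)
    (k : Fin K) {E : Type*} [MeasurableSpace E] (Y : Ω → E) : Prop :=
  ∀ m : MeasurableSpace Ω, Measurable[m] v₀ → Measurable[m] α₀ →
    (∀ t' k', (t', k') ≠ (t, k) → Measurable[m] (z t' k')) → Measurable[m] Y

/-- The samples `z t k` of a stage are independent of each other and of the starting point. -/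
structure FreshSamples {mΩ : MeasurableSpace Ω} (Pr : Measure Ω) (P : Fin K → Measure (X × Bool))
    (v₀ : Ω → Primal d) (α₀ : Ω → ℝ) (z : ℕ → Fin K → Ω → X × Bool) : Prop where
  measurable_primal : Measurable v₀
  measurable_dual : Measurable α₀
  measurable_sample : ∀ t k, Measurable (z t k)
  law : ∀ t k, Pr.map (z t k) = P k
  fresh : ∀ t k, ∃ m : MeasurableSpace Ω, m ≤ mΩ ∧ Measurable[m] v₀ ∧ Measurable[m] α₀ ∧
    (∀ t' k', (t', k') ≠ (t, k) → Measurable[m] (z t' k')) ∧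
    Indep m (MeasurableSpace.comap (z t k) inferInstance) Pr

/-- The local variables in a stage, as functions on the sample space. -/
def stageState (p : ℝ) (h : Weights d → X → ℝ) (γ η : ℝ) (I : ℕ) (v₀ : Ω → Primal d) (α₀ : Ω → ℝ)
    (z : ℕ → Fin K → Ω → X × Bool) (t : ℕ) (ω : Ω) : Fin K → Primal d × ℝ :=
  dsgState p h γ η I (v₀ ω) (α₀ ω) (fun t k => z t k ω) t

variable {p Gh Lh L1 μ Δ₀ : ℝ} {h : Weights d → X → ℝ} {P : Fin K → Measure (X × Bool)}
  {v₀ : Ω → Primal d} {α₀ : Ω → ℝ} {z : ℕ → Fin K → Ω → X × Bool}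

theorem Assumptions.determinedWithout_stageState (hA : Assumptions p Gh Lh L1 μ Δ₀ h P)
    (γ η : ℝ) (I : ℕ) {t t' : ℕ} (htt : t' ≤ t) (k k' : Fin K) :
    DeterminedWithout v₀ α₀ z t k fun ω => stageState p h γ η I v₀ α₀ z t' ω k' :=
  fun _ hv hα hz => hA.measurable_dsgState γ η I hv hα t'
    (fun s hs l => hz s l fun he => by
      have := congrArg Prod.fst he
      simp only at this
      omega) k'

variable {mΩ : MeasurableSpace Ω} {Pr : Measure Ω} [IsProbabilityMeasure Pr]

section noise

variable {E : Type*} [NormedAddCommGroup E] [InnerProductSpace ℝ E] [CompleteSpace E]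
  [MeasurableSpace E] [BorelSpace E] [SecondCountableTopology E]
  {Φ : Fin K → (Primal d × ℝ) × (X × Bool) → E}

theorem FreshSamples.integral_inner_eq_zero (hS : FreshSamples Pr P v₀ α₀ z)
    (hΦ : ∀ k, Measurable (Φ k)) (hΦi : ∀ k a, Integrable (fun y => Φ k (a, y)) (P k))
    (hΦ0 : ∀ k a, ∫ y, Φ k (a, y) ∂(P k) = 0) {t : ℕ} {k : Fin K} {s : Ω → Primal d × ℝ}
    {Y : Ω → E} (hs : DeterminedWithout v₀ α₀ z t k s) (hY : DeterminedWithout v₀ α₀ z t k Y)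
    (hYb : ∃ C : ℝ, ∀ ω, ‖Y ω‖ ≤ C) (hΦb : ∃ C : ℝ, ∀ ω, ‖Φ k (s ω, z t k ω)‖ ≤ C) :
    ∫ ω, inner ℝ (Y ω) (Φ k (s ω, z t k ω)) ∂Pr = 0 := by
  obtain ⟨m, hm, hv, hα, hz, hind⟩ := hS.fresh t k
  refine integral_inner_fresh_eq_zero hm (hY m hv hα hz) (hs m hv hα hz)
    (hS.measurable_sample t k) hind (hΦ k) ?_ ?_ hYb hΦb
  · intro a; rw [hS.law]; exact hΦi k a
  · intro a; rw [hS.law]; exact hΦ0 k a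

/-- The average over the machines of the noise `Φ`. -/
def avgNoise (Φ : Fin K → (Primal d × ℝ) × (X × Bool) → E) (s : ℕ → Ω → Fin K → Primal d × ℝ)
    (z : ℕ → Fin K → Ω → X × Bool) (t : ℕ) (ω : Ω) : E :=
  (1 / (K : ℝ)) • ∑ k, Φ k (s t ω k, z t k ω)

variable {γ η : ℝ} {I : ℕ}

theorem Assumptions.bddMeas_sampleNoise (hA : Assumptions p Gh Lh L1 μ Δ₀ h P) (hK : 0 < K)
    (hp0 : 0 < p) (hp1 : p < 1) (hGh : 0 ≤ Gh) (hγ : 0 < γ) (hη : 0 < η) (hη1 : η ≤ 1 / 2)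
    (hv₀ : ∀ ω, v₀ ω ∈ unitBox d) (hα₀ : ∀ ω, |α₀ ω| ≤ dualBound p)
    (hS : FreshSamples Pr P v₀ α₀ z) (hΦ : ∀ k, Measurable (Φ k)) {C : ℝ}
    (hΦb : ∀ k v s y, InRegion p Gh γ v s → ‖Φ k (s, y)‖ ≤ C) (t : ℕ) (k : Fin K) :
    BddMeas fun ω => Φ k (stageState p h γ η I v₀ α₀ z t ω k, z t k ω) := by
  refine ⟨(hΦ k).comp (Measurable.prodMk ?_ (hS.measurable_sample t k)), C, fun ω =>
    hΦb k (v₀ ω) _ _ (hA.inRegion_dsgState hK hp0 hp1 hGh hγ hη hη1 I (hv₀ ω) (hα₀ ω) _ t k)⟩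
  exact hA.measurable_dsgState γ η I hS.measurable_primal hS.measurable_dual t
    (fun t' _ k => hS.measurable_sample t' k) k

theorem Assumptions.bddMeas_avgNoise (hA : Assumptions p Gh Lh L1 μ Δ₀ h P) (hK : 0 < K)
    (hp0 : 0 < p) (hp1 : p < 1) (hGh : 0 ≤ Gh) (hγ : 0 < γ) (hη : 0 < η) (hη1 : η ≤ 1 / 2)
    (hv₀ : ∀ ω, v₀ ω ∈ unitBox d) (hα₀ : ∀ ω, |α₀ ω| ≤ dualBound p)
    (hS : FreshSamples Pr P v₀ α₀ z) (hΦ : ∀ k, Measurable (Φ k)) {C : ℝ}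
    (hΦb : ∀ k v s y, InRegion p Gh γ v s → ‖Φ k (s, y)‖ ≤ C) (t : ℕ) :
    BddMeas (avgNoise Φ (stageState p h γ η I v₀ α₀ z) z t) :=
  (BddMeas.sum fun k _ =>
    hA.bddMeas_sampleNoise hK hp0 hp1 hGh hγ hη hη1 hv₀ hα₀ hS hΦ hΦb t k).const_smul _

/-- Source of the speedup by K: the sample of machine l at time t is fresh even given the noise of
another machine k at the same time, so the K noises are pairwise orthogonal. -/
theorem Assumptions.integral_norm_sq_avgNoise_le (hA : Assumptions p Gh Lh L1 μ Δ₀ h P)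
    (hK : 0 < K) (hp0 : 0 < p) (hp1 : p < 1) (hGh : 0 ≤ Gh) (hγ : 0 < γ) (hη : 0 < η)
    (hη1 : η ≤ 1 / 2) (hv₀ : ∀ ω, v₀ ω ∈ unitBox d) (hα₀ : ∀ ω, |α₀ ω| ≤ dualBound p)
    (hS : FreshSamples Pr P v₀ α₀ z) (hΦ : ∀ k, Measurable (Φ k))
    (hΦi : ∀ k a, Integrable (fun y => Φ k (a, y)) (P k))
    (hΦ0 : ∀ k a, ∫ y, Φ k (a, y) ∂(P k) = 0) {C : ℝ}
    (hΦb : ∀ k v s y, InRegion p Gh γ v s → ‖Φ k (s, y)‖ ≤ C) (t : ℕ) :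
    ∫ ω, ‖avgNoise Φ (stageState p h γ η I v₀ α₀ z) z t ω‖ ^ 2 ∂Pr ≤ C ^ 2 / K := by
  have hB := hA.bddMeas_sampleNoise (I := I) hK hp0 hp1 hGh hγ hη hη1 hv₀ hα₀ hS hΦ hΦb t
  refine integral_norm_sq_average_le hK hB (fun k ω => hΦb k (v₀ ω) _ _
    (hA.inRegion_dsgState hK hp0 hp1 hGh hγ hη hη1 I (hv₀ ω) (hα₀ ω) _ t k)) fun k l hkl => ?_
  refine hS.integral_inner_eq_zero hΦ hΦi hΦ0
    (hA.determinedWithout_stageState γ η I le_rfl l l) ?_ (hB k).bounded (hB l).bounded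
  intro m hv hα hz
  exact (hΦ k).comp ((hA.determinedWithout_stageState γ η I le_rfl l k m hv hα hz).prodMk
    (hz t k fun he => hkl (congrArg Prod.snd he)))

/-- The noise accumulated before time t is a function of earlier samples, and each term of the new
average is centred given those. -/
theorem Assumptions.integral_inner_accNoise_eq_zero (hA : Assumptions p Gh Lh L1 μ Δ₀ h P)
    (hK : 0 < K) (hp0 : 0 < p) (hp1 : p < 1) (hGh : 0 ≤ Gh) (hγ : 0 < γ) (hη : 0 < η)
    (hη1 : η ≤ 1 / 2) (hv₀ : ∀ ω, v₀ ω ∈ unitBox d) (hα₀ : ∀ ω, |α₀ ω| ≤ dualBound p)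
    (hS : FreshSamples Pr P v₀ α₀ z) (hΦ : ∀ k, Measurable (Φ k))
    (hΦi : ∀ k a, Integrable (fun y => Φ k (a, y)) (P k))
    (hΦ0 : ∀ k a, ∫ y, Φ k (a, y) ∂(P k) = 0) {C : ℝ}
    (hΦb : ∀ k v s y, InRegion p Gh γ v s → ‖Φ k (s, y)‖ ≤ C) (θ c : ℝ) (t : ℕ) :
    ∫ ω, inner ℝ
      (accNoise θ c (fun t => avgNoise Φ (stageState p h γ η I v₀ α₀ z) z t ω) t)
      (avgNoise Φ (stageState p h γ η I v₀ α₀ z) z t ω) ∂Pr = 0 := by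
  have hB := hA.bddMeas_sampleNoise (I := I) hK hp0 hp1 hGh hγ hη hη1 hv₀ hα₀ hS hΦ hΦb
  have hBn : BddMeas fun ω =>
      accNoise θ c (fun t => avgNoise Φ (stageState p h γ η I v₀ α₀ z) z t ω) t :=
    bddMeas_accNoise (fun t => hA.bddMeas_avgNoise hK hp0 hp1 hGh hγ hη hη1 hv₀ hα₀ hS hΦ hΦb t) t
  have hdet : ∀ k, ∀ t' ≤ t, DeterminedWithout v₀ α₀ z t k fun ω =>
      accNoise θ c (fun t => avgNoise Φ (stageState p h γ η I v₀ α₀ z) z t ω) t' := by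
    intro k t' ht' m hv hα hz
    induction t' with
    | zero => exact measurable_const
    | succ t' ih =>
      have h1 : Measurable[m] fun ω => avgNoise Φ (stageState p h γ η I v₀ α₀ z) z t' ω := by
        have h2 : Measurable[m] fun ω =>
            ∑ k, Φ k (stageState p h γ η I v₀ α₀ z t' ω k, z t' k ω) :=
          Finset.measurable_sum _ fun l _ => (hΦ l).comp
            ((hA.determinedWithout_stageState γ η I (by omega) k l m hv hα hz).prodMk
              (hz t' l fun he => by
                have := congrArg Prod.fst he
                simp only at this
                omega))
        exact h2.const_smul (1 / (K : ℝ))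
      exact ((ih (by omega)).const_smul θ).add (h1.const_smul c)
  have hpt : ∀ ω, inner ℝ
      (accNoise θ c (fun t => avgNoise Φ (stageState p h γ η I v₀ α₀ z) z t ω) t)
      (avgNoise Φ (stageState p h γ η I v₀ α₀ z) z t ω) = 1 / (K : ℝ) * ∑ k, inner ℝ
      (accNoise θ c (fun t => avgNoise Φ (stageState p h γ η I v₀ α₀ z) z t ω) t)
      (Φ k (stageState p h γ η I v₀ α₀ z t ω k, z t k ω)) := by
    intro ω
    have : avgNoise Φ (stageState p h γ η I v₀ α₀ z) z t ω =
      (1 / (K : ℝ)) • ∑ k, Φ k (stageState p h γ η I v₀ α₀ z t ω k, z t k ω) := rfl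
    rw [this, inner_smul_right, inner_sum]
  simp_rw [hpt]
  rw [integral_const_mul, integral_finsetSum _ fun k _ => (hBn.inner (hB t k)).integrable]
  rw [Finset.sum_eq_zero fun k _ => ?_, mul_zero]
  exact hS.integral_inner_eq_zero hΦ hΦi hΦ0
    (hA.determinedWithout_stageState γ η I le_rfl k k) (hdet k t le_rfl) hBn.bounded
    (hB t k).bounded

end noise

/-! ### Noise of the stochastic gradients -/

/-- The noise of the stochastic primal gradient. -/
def primalNoise (p : ℝ) (h : Weights d → X → ℝ) (P : Fin K → Measure (X × Bool)) (k : Fin K)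
    (q : (Primal d × ℝ) × (X × Bool)) : Primal d :=
  lossGrad p h q.1.1 q.1.2 q.2 - meanGrad p h (P k) q.1.1 q.1.2

/-- The noise of the stochastic dual gradient. -/
def dualNoise (p : ℝ) (h : Weights d → X → ℝ) (P : Fin K → Measure (X × Bool)) (k : Fin K)
    (q : (Primal d × ℝ) × (X × Bool)) : ℝ :=
  lossGradDual p h q.1.1 q.1.2 q.2
    - 2 * (p * (1 - p)) * (classGap p h (P k) (wPart q.1.1) - q.1.2)

variable [∀ k, IsProbabilityMeasure (P k)]

theorem Assumptions.measurable_primalNoise (hA : Assumptions p Gh Lh L1 μ Δ₀ h P) (k : Fin K) :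
    Measurable (primalNoise p h P k) := by
  have h1 : Measurable fun q : (Primal d × ℝ) × (X × Bool) => q.1.1 :=
    measurable_fst.comp measurable_fst
  have h2 : Measurable fun q : (Primal d × ℝ) × (X × Bool) => q.1.2 :=
    measurable_snd.comp measurable_fst
  exact (hA.measurable_lossGrad h1 h2 measurable_snd).sub (hA.measurable_meanGrad k h1 h2)

theorem Assumptions.integrable_primalNoise (hA : Assumptions p Gh Lh L1 μ Δ₀ h P) (hp0 : 0 < p)
    (hp1 : p < 1) (k : Fin K) (a : Primal d × ℝ) :
    Integrable (fun y => primalNoise p h P k (a, y)) (P k) :=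
  (hA.integrable_lossGrad hp0 hp1 k a.1 a.2).sub (integrable_const (meanGrad p h (P k) a.1 a.2))

theorem Assumptions.integral_primalNoise (hA : Assumptions p Gh Lh L1 μ Δ₀ h P) (hp0 : 0 < p)
    (hp1 : p < 1) (k : Fin K) (a : Primal d × ℝ) :
    ∫ y, primalNoise p h P k (a, y) ∂(P k) = 0 := by
  simp only [primalNoise]
  rw [integral_sub (hA.integrable_lossGrad hp0 hp1 k a.1 a.2) (integrable_const _)]
  simp [meanGrad]

theorem Assumptions.norm_primalNoise_le (hA : Assumptions p Gh Lh L1 μ Δ₀ h P) (hp0 : 0 < p)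
    (hp1 : p < 1) {γ : ℝ} (k : Fin K) (v : Primal d) (s : Primal d × ℝ) (y : X × Bool)
    (hs : InRegion p Gh γ v s) : ‖primalNoise p h P k (s, y)‖ ≤ 2 * gradBound p Gh := by
  have h1 := hA.norm_lossGrad_le hp0 hp1 (unitBox_subset_box d hs.mem) hs.dual y
  have h2 := hA.norm_meanGrad_le hp0 hp1 k (unitBox_subset_box d hs.mem) hs.dual
  exact (norm_sub_le _ _).trans (by simp only; linarith)

theorem Assumptions.measurable_dualNoise (hA : Assumptions p Gh Lh L1 μ Δ₀ h P) (k : Fin K) :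
    Measurable (dualNoise p h P k) := by
  have h1 : Measurable fun q : (Primal d × ℝ) × (X × Bool) => q.1.1 :=
    measurable_fst.comp measurable_fst
  have h2 : Measurable fun q : (Primal d × ℝ) × (X × Bool) => q.1.2 :=
    measurable_snd.comp measurable_fst
  exact (hA.measurable_lossGradDual h1 h2 measurable_snd).sub
    ((((hA.measurable_classGap k).comp (measurable_wPart.comp h1)).sub h2).const_mul _)

theorem Assumptions.integrable_lossGradDual (hA : Assumptions p Gh Lh L1 μ Δ₀ h P) (hp0 : 0 < p)
    (hp1 : p < 1) (k : Fin K) (v : Primal d) (α : ℝ) :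
    Integrable (fun y => lossGradDual p h v α y) (P k) := by
  have h0 : Integrable (fun y => lossGradDual p h v 0 y) (P k) := by
    refine Integrable.of_bound (hA.measurable_lossGradDual measurable_const measurable_const
      measurable_id).aestronglyMeasurable 4 (Filter.Eventually.of_forall fun y => ?_)
    refine hA.abs_lossGradDual_le hp0 hp1 v ?_ y
    have := one_le_dualBound hp0 hp1
    rw [abs_zero]; linarith
  refine (h0.sub (integrable_const (2 * (p * (1 - p)) * α))).congr
    (Filter.Eventually.of_forall fun y => ?_)
  simp only [Pi.sub_apply, lossGradDual]
  ring

theorem Assumptions.integrable_dualNoise (hA : Assumptions p Gh Lh L1 μ Δ₀ h P) (hp0 : 0 < p)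
    (hp1 : p < 1) (k : Fin K) (a : Primal d × ℝ) :
    Integrable (fun y => dualNoise p h P k (a, y)) (P k) :=
  (hA.integrable_lossGradDual hp0 hp1 k a.1 a.2).sub
    (integrable_const (2 * (p * (1 - p)) * (classGap p h (P k) (wPart a.1) - a.2)))

theorem Assumptions.integral_dualNoise (hA : Assumptions p Gh Lh L1 μ Δ₀ h P) (hp0 : 0 < p)
    (hp1 : p < 1) (k : Fin K) (a : Primal d × ℝ) :
    ∫ y, dualNoise p h P k (a, y) ∂(P k) = 0 := by
  simp only [dualNoise]
  rw [integral_sub (hA.integrable_lossGradDual hp0 hp1 k a.1 a.2) (integrable_const _),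
    hA.integral_lossGradDual hp0 hp1]
  simp

theorem Assumptions.norm_dualNoise_le (hA : Assumptions p Gh Lh L1 μ Δ₀ h P) (hp0 : 0 < p)
    (hp1 : p < 1) {γ : ℝ} (k : Fin K) (v : Primal d) (s : Primal d × ℝ) (y : X × Bool)
    (hs : InRegion p Gh γ v s) : ‖dualNoise p h P k (s, y)‖ ≤ 8 := by
  have h1 := hA.abs_lossGradDual_le hp0 hp1 s.1 hs.dual y
  have h2 := norm_integral_le_of_norm_le_const (μ := P k) (Filter.Eventually.of_forall fun y =>
    (Real.norm_eq_abs _).trans_le (hA.abs_lossGradDual_le hp0 hp1 s.1 hs.dual y))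
  rw [hA.integral_lossGradDual hp0 hp1] at h2
  simp only [probReal_univ, mul_one] at h2
  exact (norm_sub_le _ _).trans (by simp only [Real.norm_eq_abs] at h2 ⊢; linarith)

end fresh

/-! ### One stage of CoDA as a perturbed gradient step -/

section stage

variable {d K : ℕ} {X : Type*} [MeasurableSpace X]
  {p Gh Lh L1 μ Δ₀ : ℝ} {h : Weights d → X → ℝ} {P : Fin K → Measure (X × Bool)}

/-- The deviation of the averaged expected gradients from `∇φ(v₀)`. -/
def gradBias (p : ℝ) (h : Weights d → X → ℝ) (P : Fin K → Measure (X × Bool)) (v₀ : Primal d)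
    (s : Fin K → Primal d × ℝ) : Primal d :=
  (1 / (K : ℝ)) • ∑ k, meanGrad p h (P k) (s k).1 (s k).2 - phiGrad p h P v₀

/-- The deviation of the averaged dual targets from the one at `v₀`. -/
def gapBias (p : ℝ) (h : Weights d → X → ℝ) (P : Fin K → Measure (X × Bool)) (v₀ : Primal d)
    (s : Fin K → Primal d × ℝ) : ℝ :=
  (1 / (K : ℝ)) * ∑ k, classGap p h (P k) (wPart (s k).1) - dualOpt p h P (wPart v₀)

/-- Stochastic gradient = ∇φ(v₀) + bias + noise, after averaging; the proximal step is affine in its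
arguments, so it commutes with the average. -/
theorem Assumptions.avgState_primal_succ (hA : Assumptions p Gh Lh L1 μ Δ₀ h P) (hK : 0 < K)
    {γ η : ℝ} (hγ : 0 < γ) (hη : 0 < η) (I : ℕ) (v₀ : Primal d) (α₀ : ℝ)
    (z : ℕ → Fin K → X × Bool) (t : ℕ) :
    (avgState (dsgState p h γ η I v₀ α₀ z (t + 1))).1 - v₀ =
      (γ / (η + γ)) • ((avgState (dsgState p h γ η I v₀ α₀ z t)).1 - v₀ - η • (phiGrad p h P v₀
        + gradBias p h P v₀ (dsgState p h γ η I v₀ α₀ z t)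
        + (1 / (K : ℝ)) • ∑ k, primalNoise p h P k (dsgState p h γ η I v₀ α₀ z t k, z t k))) := by
  rw [avgState_dsgState_succ hK]
  set s := dsgState p h γ η I v₀ α₀ z t
  have e1 : ∀ k, (localStep p h γ η v₀ (s k) (z t k)).1 - v₀ = (γ / (η + γ)) • ((s k).1 - v₀
      - η • (meanGrad p h (P k) (s k).1 (s k).2 + primalNoise p h P k (s k, z t k))) := by
    intro k
    simp only [localStep, primalNoise, hA.gradV_eq]
    rw [proxStep_sub_left hγ hη, add_sub_cancel]
  simp only [avgState, gradBias]
  rw [average_sub hK, average_sub hK, Finset.sum_congr rfl fun k _ => e1 k, ← Finset.smul_sum,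
    Finset.sum_sub_distrib (fun k => (s k).1 - v₀), ← Finset.smul_sum, Finset.sum_add_distrib]
  module

theorem Assumptions.avgState_dual_succ (hK : 0 < K)
    {γ η : ℝ} (I : ℕ) (v₀ : Primal d) (α₀ : ℝ) (z : ℕ → Fin K → X × Bool) (t : ℕ) :
    (avgState (dsgState p h γ η I v₀ α₀ z (t + 1))).2 - dualOpt p h P (wPart v₀) =
      (1 - 2 * (p * (1 - p)) * η) * ((avgState (dsgState p h γ η I v₀ α₀ z t)).2
          - dualOpt p h P (wPart v₀))
        + 2 * (p * (1 - p)) * η * gapBias p h P v₀ (dsgState p h γ η I v₀ α₀ z t)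
        + η * ((1 / (K : ℝ)) • ∑ k, dualNoise p h P k (dsgState p h γ η I v₀ α₀ z t k, z t k)) := by
  rw [avgState_dsgState_succ hK]
  set s := dsgState p h γ η I v₀ α₀ z t
  have e1 : ∀ k, (localStep p h γ η v₀ (s k) (z t k)).2 = (1 - 2 * (p * (1 - p)) * η) * (s k).2
      + 2 * (p * (1 - p)) * η * classGap p h (P k) (wPart (s k).1)
      + η * dualNoise p h P k (s k, z t k) := by
    intro k
    simp only [localStep, dualNoise, gradAlpha_eq]
    ring
  simp only [avgState, gapBias, smul_eq_mul]
  rw [Finset.sum_congr rfl fun k _ => e1 k, Finset.sum_add_distrib, Finset.sum_add_distrib,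
    ← Finset.mul_sum, ← Finset.mul_sum, ← Finset.mul_sum]
  ring

variable [∀ k, IsProbabilityMeasure (P k)]

/-- The expected gradient is Lipschitz, and ∇φ(v₀) is its average at (v₀, D). The distance to that
point splits into four terms: primal and dual drift from the machine mean (4GJ and 8J, whence 16G² +
64), and primal and dual displacement of the mean. -/
theorem Assumptions.norm_gradBias_sq_le (hA : Assumptions p Gh Lh L1 μ Δ₀ h P) (hK : 0 < K)
    (hp0 : 0 < p) (hp1 : p < 1) (hGh : 0 ≤ Gh) (hLh : 0 ≤ Lh) {γ η : ℝ} (hγ : 0 < γ) (hη : 0 < η)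
    (hη1 : η ≤ 1 / 2) {I : ℕ} (hI : 1 ≤ I) {e : ℝ} (hIe : (((I : ℝ) - 1) * η) ^ 2 ≤ e)
    {v₀ : Primal d} (hv₀ : v₀ ∈ unitBox d) {α₀ : ℝ}
    (hα₀ : |α₀| ≤ dualBound p) (z : ℕ → Fin K → X × Bool) (t : ℕ) :
    ‖gradBias p h P v₀ (dsgState p h γ η I v₀ α₀ z t)‖ ^ 2 ≤
      4 * gradLip p Gh Lh ^ 2 * ((16 * gradBound p Gh ^ 2 + 64) * e
        + ‖(avgState (dsgState p h γ η I v₀ α₀ z t)).1 - v₀‖ ^ 2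
        + ((avgState (dsgState p h γ η I v₀ α₀ z t)).2 - dualOpt p h P (wPart v₀)) ^ 2) := by
  have hd := hA.dsgState_sub_avgState hK hp0 hp1 hGh hγ hη hη1 hI hv₀ hα₀ z t
  have hL := gradLip_pos hp0 hp1 hGh hLh
  have hG := gradBound_pos hp0 hp1 hGh
  set s := dsgState p h γ η I v₀ α₀ z t
  set D := dualOpt p h P (wPart v₀) with hD
  set J := ((I : ℝ) - 1) * η
  have hJ : 0 ≤ J := mul_nonneg (sub_nonneg.mpr (by exact_mod_cast hI)) hη.le
  have hDb : |D| ≤ dualBound p := (hA.abs_dualOpt_le hp0 hp1 _).trans (one_le_dualBound hp0 hp1)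
  set a := ‖(avgState s).1 - v₀‖ with ha
  set b := |(avgState s).2 - D| with hb
  have ha0 : 0 ≤ a := norm_nonneg _
  have hb0 : 0 ≤ b := abs_nonneg _
  have h1 : gradBias p h P v₀ s = (1 / (K : ℝ)) •
      ∑ k, (meanGrad p h (P k) (s k).1 (s k).2 - meanGrad p h (P k) v₀ D) := by
    rw [gradBias, phiGrad, Finset.sum_sub_distrib, smul_sub]
  have h2 : ‖gradBias p h P v₀ s‖
      ≤ gradLip p Gh Lh * ((4 * gradBound p Gh * J + a) + (8 * J + b)) := by
    rw [h1]
    refine norm_average_le (by positivity) fun k => ?_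
    refine (hA.meanGrad_lipschitz hp0 hp1 hGh hLh k (unitBox_subset_box d hv₀) hDb).trans
      (mul_le_mul_of_nonneg_left ?_ hL.le)
    have e1 := norm_sub_le_norm_sub_add_norm_sub (s k).1 (avgState s).1 v₀
    have e2 := abs_sub_le (s k).2 (avgState s).2 D
    linarith [(hd k).1, (hd k).2]
  have h3 := pow_le_pow_left₀ (norm_nonneg _) h2 2
  rw [mul_pow] at h3
  have h4 : ((4 * gradBound p Gh * J + a) + (8 * J + b)) ^ 2
      ≤ 4 * ((16 * gradBound p Gh ^ 2 + 64) * e + a ^ 2 + b ^ 2) := by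
    have e1 : (16 * gradBound p Gh ^ 2 + 64) * J ^ 2 ≤ (16 * gradBound p Gh ^ 2 + 64) * e :=
      mul_le_mul_of_nonneg_left hIe (by positivity)
    have e2 : ∀ x y u v : ℝ, ((x + y) + (u + v)) ^ 2 ≤ 4 * (x ^ 2 + y ^ 2 + u ^ 2 + v ^ 2) := by
      intro x y u v
      nlinarith [sq_nonneg (x - y), sq_nonneg (x - u), sq_nonneg (x - v), sq_nonneg (y - u),
        sq_nonneg (y - v), sq_nonneg (u - v)]
    have e3 := e2 (4 * gradBound p Gh * J) a (8 * J) b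
    nlinarith
  rw [hb, sq_abs] at h4
  have h5 := mul_le_mul_of_nonneg_left h4 (sq_nonneg (gradLip p Gh Lh))
  refine (h3.trans h5).trans_eq ?_
  ring

theorem Assumptions.gapBias_sq_le (hA : Assumptions p Gh Lh L1 μ Δ₀ h P) (hK : 0 < K)
    (hp0 : 0 < p) (hp1 : p < 1) (hGh : 0 ≤ Gh) {γ η : ℝ} (hγ : 0 < γ) (hη : 0 < η)
    (hη1 : η ≤ 1 / 2) {I : ℕ} (hI : 1 ≤ I) {e : ℝ} (hIe : (((I : ℝ) - 1) * η) ^ 2 ≤ e)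
    {v₀ : Primal d} (hv₀ : v₀ ∈ unitBox d) {α₀ : ℝ}
    (hα₀ : |α₀| ≤ dualBound p) (z : ℕ → Fin K → X × Bool) (t : ℕ) :
    gapBias p h P v₀ (dsgState p h γ η I v₀ α₀ z t) ^ 2 ≤
      8 * Gh ^ 2 * ((16 * gradBound p Gh ^ 2 + 64) * e
        + ‖(avgState (dsgState p h γ η I v₀ α₀ z t)).1 - v₀‖ ^ 2) := by
  have hd := hA.dsgState_sub_avgState hK hp0 hp1 hGh hγ hη hη1 hI hv₀ hα₀ z t
  have hG := gradBound_pos hp0 hp1 hGh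
  set s := dsgState p h γ η I v₀ α₀ z t
  set J := ((I : ℝ) - 1) * η
  have hJ : 0 ≤ J := mul_nonneg (sub_nonneg.mpr (by exact_mod_cast hI)) hη.le
  set a := ‖(avgState s).1 - v₀‖ with ha
  have ha0 : 0 ≤ a := norm_nonneg _
  have h1 : gapBias p h P v₀ s = (1 / (K : ℝ)) *
      ∑ k, (classGap p h (P k) (wPart (s k).1) - classGap p h (P k) (wPart v₀)) := by
    rw [gapBias, dualOpt, Finset.sum_sub_distrib, mul_sub]
  have h2 : |gapBias p h P v₀ s| ≤ 2 * Gh * (4 * gradBound p Gh * J + a) := by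
    rw [h1]
    refine abs_average_le (by positivity) fun k => ?_
    refine (hA.classGap_lipschitz hp0 hp1 k _ _).trans
      (mul_le_mul_of_nonneg_left ?_ (by positivity))
    have e1 := norm_sub_le_norm_sub_add_norm_sub (s k).1 (avgState s).1 v₀
    have e2 := norm_wPart_le ((s k).1 - v₀)
    rw [wPart_sub] at e2
    linarith [(hd k).1]
  have h3 := pow_le_pow_left₀ (abs_nonneg _) h2 2
  rw [sq_abs, mul_pow] at h3
  have h4 : (4 * gradBound p Gh * J + a) ^ 2
      ≤ 2 * ((16 * gradBound p Gh ^ 2 + 64) * e + a ^ 2) := by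
    have e1 : (16 * gradBound p Gh ^ 2 + 64) * J ^ 2 ≤ (16 * gradBound p Gh ^ 2 + 64) * e :=
      mul_le_mul_of_nonneg_left hIe (by positivity)
    nlinarith [sq_nonneg (4 * gradBound p Gh * J - a), sq_nonneg J]
  have h5 := mul_le_mul_of_nonneg_left h4 (sq_nonneg (2 * Gh))
  refine (h3.trans h5).trans_eq ?_
  ring

/-! ### Time averaging and the bookkeeping of constants within a stage. -/

theorem sum_pow_prox {γ η : ℝ} (hγ : 0 < γ) (hη : 0 < η) (T : ℕ) :
    η * ∑ t ∈ Finset.Icc 1 T, (γ / (η + γ)) ^ t + γ * (γ / (η + γ)) ^ T = γ := by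
  induction T with
  | zero => simp
  | succ T ih =>
    rw [Finset.sum_Icc_succ_top (by omega)]
    have h1 : (η + γ) * (γ / (η + γ)) ^ (T + 1) = γ * (γ / (η + γ)) ^ T := by
      rw [pow_succ]; field_simp
    nlinarith

/-- The coefficient of `‖x_t‖²` in the recursion for the gradient bias. -/
def biasCoef (p Gh Lh : ℝ) : ℝ := 4 * gradLip p Gh Lh ^ 2 * (1 + 24 * Gh ^ 2)

/-- The coefficient of the initial dual error in the recursion for the gradient bias. -/
def dualCoef (p Gh Lh : ℝ) : ℝ := 12 * gradLip p Gh Lh ^ 2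

/-- The coefficient of the noise level in the recursion for the gradient bias. -/
def driftCoef (p Gh Lh : ℝ) : ℝ :=
  4 * gradLip p Gh Lh ^ 2 * ((16 * gradBound p Gh ^ 2 + 64) * (1 + 24 * Gh ^ 2) + 192)

/-- The noise level of one stage. -/
def stageNoise (p Gh Lh γ : ℝ) : ℝ :=
  10 * γ * (2 * driftCoef p Gh Lh + 24 * biasCoef p Gh Lh * gradBound p Gh ^ 2)
    + 40 * gradBound p Gh ^ 2 / γ

/-- The step -Wg contributes -15γ/16, Young's inequality for the cross term +γ/16 and the smoothness
term +γ/16, which leaves -13γ/16. For r the costs are 4/γ from Young and 1/γ from smoothness. -/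
theorem descent_pointwise {E : Type*} [NormedAddCommGroup E] [InnerProductSpace ℝ E]
    {γ W L : ℝ} (hγ : 0 < γ) (hL : 0 ≤ L) (hγL : 32 * L * γ ≤ 1) (hW1 : W ≤ γ)
    (hW2 : 15 / 16 * γ ≤ W) (g r : E) :
    inner ℝ g (r - W • g) + L * ‖r - W • g‖ ^ 2
      ≤ -(13 / 16 * γ) * ‖g‖ ^ 2 + 5 / γ * ‖r‖ ^ 2 := by
  have e2 : inner ℝ g (r - W • g) = inner ℝ g r - W * ‖g‖ ^ 2 := by
    rw [inner_sub_right, inner_smul_right, real_inner_self_eq_norm_sq]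
  have e3 : inner ℝ g r ≤ γ / 16 * ‖g‖ ^ 2 + 4 / γ * ‖r‖ ^ 2 := by
    refine (real_inner_le_norm _ _).trans ?_
    have : γ / 16 * ‖g‖ ^ 2 + 4 / γ * ‖r‖ ^ 2 - ‖g‖ * ‖r‖
        = 1 / (16 * γ) * (γ * ‖g‖ - 8 * ‖r‖) ^ 2 := by field_simp; ring
    have : 0 ≤ 1 / (16 * γ) * (γ * ‖g‖ - 8 * ‖r‖) ^ 2 := by positivity
    linarith
  have hW0 : 0 ≤ W := le_trans (by positivity) hW2
  have e4 : ‖r - W • g‖ ^ 2 ≤ 2 * ‖r‖ ^ 2 + 2 * (γ ^ 2 * ‖g‖ ^ 2) := by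
    have h1 := norm_add_sq_le_two r (-(W • g))
    rw [← sub_eq_add_neg, norm_neg, norm_smul, mul_pow, Real.norm_of_nonneg hW0] at h1
    have h2 := mul_le_mul_of_nonneg_right (pow_le_pow_left₀ hW0 hW1 2) (sq_nonneg ‖g‖)
    linarith
  have e5 := mul_le_mul_of_nonneg_left e4 hL
  have e6 : L * (2 * (γ ^ 2 * ‖g‖ ^ 2)) ≤ γ / 16 * ‖g‖ ^ 2 := by
    have : L * (2 * (γ ^ 2 * ‖g‖ ^ 2)) = (32 * L * γ) * (γ / 16 * ‖g‖ ^ 2) := by ring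
    rw [this]
    exact mul_le_of_le_one_left (by positivity) hγL
  have e7 : (L * 2) * ‖r‖ ^ 2 ≤ 1 / γ * ‖r‖ ^ 2 := by
    refine mul_le_mul_of_nonneg_right ?_ (sq_nonneg _)
    rw [le_div_iff₀ hγ]
    linarith [mul_nonneg hL hγ.le]
  have e8 : 15 / 16 * γ * ‖g‖ ^ 2 ≤ W * ‖g‖ ^ 2 := mul_le_mul_of_nonneg_right hW2 (sq_nonneg _)
  have e9 : 5 / γ * ‖r‖ ^ 2 = 4 / γ * ‖r‖ ^ 2 + 1 / γ * ‖r‖ ^ 2 := by ring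
  rw [e9]
  linarith

/-- The geometric weights sum to at most γ/η, so the time average of θ^t is at most γ/(ηT) ≤ 1/16: a
stage is long enough for x_t to spend most of its time near -γg. -/
theorem average_prox_weight {γ η : ℝ} (hγ : 0 < γ) (hη : 0 < η) {T : ℕ} (hT : 16 * γ ≤ η * T) :
    1 / (T : ℝ) * ∑ t ∈ Finset.Icc 1 T, γ * (1 - (γ / (η + γ)) ^ t) ≤ γ ∧
      15 / 16 * γ ≤ 1 / (T : ℝ) * ∑ t ∈ Finset.Icc 1 T, γ * (1 - (γ / (η + γ)) ^ t) := by
  have hTpos : (0 : ℝ) < T := by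
    by_contra hneg
    have : (T : ℝ) = 0 := le_antisymm (not_lt.mp hneg) (Nat.cast_nonneg T)
    rw [this] at hT
    linarith
  have hθ0 : 0 ≤ γ / (η + γ) := by positivity
  have hsp := sum_pow_prox hγ hη T
  generalize γ / (η + γ) = θ at *
  have hWeq : 1 / (T : ℝ) * ∑ t ∈ Finset.Icc 1 T, γ * (1 - θ ^ t)
      = γ - γ * (1 / (T : ℝ) * ∑ t ∈ Finset.Icc 1 T, θ ^ t) := by
    rw [← Finset.mul_sum, Finset.sum_sub_distrib, Finset.sum_const, Nat.card_Icc,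
      add_tsub_cancel_right, nsmul_eq_mul]
    field_simp
  have hs0 : 0 ≤ 1 / (T : ℝ) * ∑ t ∈ Finset.Icc 1 T, θ ^ t :=
    mul_nonneg (by positivity) (Finset.sum_nonneg fun t _ => by positivity)
  have hs1 : 1 / (T : ℝ) * ∑ t ∈ Finset.Icc 1 T, θ ^ t ≤ 1 / 16 := by
    rw [one_div, inv_mul_le_iff₀ hTpos]
    have e1 : 0 ≤ γ * θ ^ T := by positivity
    have e2 : η * ∑ t ∈ Finset.Icc 1 T, θ ^ t ≤ η * (T * (1 / 16)) := by linarith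
    exact le_of_mul_le_mul_left e2 hη
  rw [hWeq]
  constructor <;> nlinarith

/-- Jensen's inequality for the average of `T` random vectors. -/
theorem integral_norm_sq_time_average_le {Ω : Type*} {mΩ : MeasurableSpace Ω} {Pr : Measure Ω}
    [IsProbabilityMeasure Pr] {ρ : ℕ → Ω → Primal d} {T : ℕ} (hT : 1 ≤ T)
    (hρB : ∀ t, BddMeas (ρ t)) {M : ℝ} (hρ : ∀ t ≤ T, ∫ ω, ‖ρ t ω‖ ^ 2 ∂Pr ≤ M) :
    ∫ ω, ‖(1 / (T : ℝ)) • ∑ t ∈ Finset.Icc 1 T, ρ t ω‖ ^ 2 ∂Pr ≤ M := by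
  have hTpos : (0 : ℝ) < T := by exact_mod_cast hT
  have hpt : ∀ ω, ‖(1 / (T : ℝ)) • ∑ t ∈ Finset.Icc 1 T, ρ t ω‖ ^ 2
      ≤ 1 / (T : ℝ) * ∑ t ∈ Finset.Icc 1 T, ‖ρ t ω‖ ^ 2 := by
    intro ω
    have e1 : ‖∑ t ∈ Finset.Icc 1 T, ρ t ω‖ ^ 2 ≤ (∑ t ∈ Finset.Icc 1 T, ‖ρ t ω‖) ^ 2 :=
      pow_le_pow_left₀ (norm_nonneg _) (norm_sum_le _ _) 2
    have e2 := sq_sum_le_card_mul_sum_sq (s := Finset.Icc 1 T) (f := fun t => ‖ρ t ω‖)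
    rw [Nat.card_Icc, add_tsub_cancel_right] at e2
    rw [norm_smul, mul_pow, Real.norm_of_nonneg (by positivity)]
    refine (mul_le_mul_of_nonneg_left (e1.trans e2) (by positivity)).trans_eq ?_
    field_simp
  have hRB : BddMeas fun ω => (1 / (T : ℝ)) • ∑ t ∈ Finset.Icc 1 T, ρ t ω :=
    (BddMeas.sum fun t _ => hρB t).const_smul _
  have hB1 : BddMeas fun ω => ∑ t ∈ Finset.Icc 1 T, ‖ρ t ω‖ ^ 2 :=
    BddMeas.sum fun t _ => (hρB t).norm_sq
  refine (integral_mono hRB.norm_sq.integrable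
    (hB1.integrable.const_mul (1 / (T : ℝ))) hpt).trans ?_
  rw [integral_const_mul, integral_finsetSum _ fun t _ => (hρB t).norm_sq.integrable]
  rw [one_div, inv_mul_le_iff₀ hTpos]
  refine (Finset.sum_le_sum fun t ht => hρ t (Finset.mem_Icc.mp ht).2).trans_eq ?_
  rw [Finset.sum_const, Nat.card_Icc, add_tsub_cancel_right, nsmul_eq_mul]

/-- The condition on b₁ reads 6γ²b₁ ≤ 1/160, so the feedback of ‖g‖² through x costs only γ²/80, a
small fraction of the progress of the stage. -/
theorem bias_level_le {γ G b₁ b₂ b₃ e G₀ B₀ : ℝ} (hγ : 0 < γ) (hγb : 960 * γ ^ 2 * b₁ ≤ 1)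
    (hb₂ : 0 ≤ b₂) (hb₃ : 0 ≤ b₃) (he : 0 ≤ e) (hG₀ : 0 ≤ G₀) (hB₀ : 0 ≤ B₀) :
    2 * (γ ^ 2 * (b₁ * (6 * γ ^ 2 * G₀ + 6 * γ ^ 2 * (b₂ * B₀ + b₃ * e) + 24 * G ^ 2 * e)
        + b₂ * B₀ + b₃ * e)) + 2 * ((2 * G) ^ 2 * e)
      ≤ γ ^ 2 / 80 * G₀ + 4 * b₂ * γ ^ 2 * B₀
        + γ / 5 * (10 * γ * (2 * b₃ + 24 * b₁ * G ^ 2) + 40 * G ^ 2 / γ) * e := by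
  have hb : 0 ≤ b₂ * B₀ + b₃ * e := by positivity
  have f2 : (960 * γ ^ 2 * b₁) * (1 / 160 * G₀) ≤ 1 / 160 * G₀ :=
    mul_le_of_le_one_left (by positivity) hγb
  have f3 : (960 * γ ^ 2 * b₁) * (1 / 160 * (b₂ * B₀ + b₃ * e))
      ≤ 1 / 160 * (b₂ * B₀ + b₃ * e) := mul_le_of_le_one_left (by positivity) hγb
  have e1 : b₁ * (6 * γ ^ 2 * G₀ + 6 * γ ^ 2 * (b₂ * B₀ + b₃ * e) + 24 * G ^ 2 * e)
      ≤ 1 / 160 * G₀ + (b₂ * B₀ + b₃ * e) + 24 * b₁ * G ^ 2 * e := by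
    linarith
  have e2 := mul_le_mul_of_nonneg_left e1 (by positivity : 0 ≤ 2 * γ ^ 2)
  have e3 : γ / 5 * (10 * γ * (2 * b₃ + 24 * b₁ * G ^ 2) + 40 * G ^ 2 / γ) * e
      = 2 * γ ^ 2 * (2 * b₃ + 24 * b₁ * G ^ 2) * e + 8 * G ^ 2 * e := by field_simp; ring
  rw [e3]
  linarith

/-- The bootstrap closes: feedback through b₁ uses at most half of `Mx`, and the other half is by
definition the sum of the external terms. -/
theorem bias_level_closed {γ G b₁ b₂ b₃ e G₀ B₀ : ℝ} (hγb : 960 * γ ^ 2 * b₁ ≤ 1)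
    (hb₂ : 0 ≤ b₂) (hb₃ : 0 ≤ b₃) (he : 0 ≤ e) (hG₀ : 0 ≤ G₀) (hB₀ : 0 ≤ B₀) {Mx : ℝ}
    (hMx : Mx = 6 * γ ^ 2 * G₀ + 6 * γ ^ 2 * (b₂ * B₀ + b₃ * e) + 24 * G ^ 2 * e) :
    3 * γ ^ 2 * (b₁ * Mx + b₂ * B₀ + b₃ * e) + 3 * (γ ^ 2 * G₀) + 3 * ((2 * G) ^ 2 * e) ≤ Mx := by
  have h0 : 0 ≤ Mx := by rw [hMx]; positivity
  have h1 := mul_le_of_le_one_left (by positivity : 0 ≤ Mx / 320) hγb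
  have h2 : 0 ≤ b₂ * B₀ + b₃ * e := by positivity
  have e1 : 3 * γ ^ 2 * (b₁ * Mx) ≤ Mx / 2 := by
    have : 3 * γ ^ 2 * (b₁ * Mx) = 960 * γ ^ 2 * b₁ * (Mx / 320) := by ring
    linarith
  have : 3 * γ ^ 2 * (b₁ * Mx + b₂ * B₀ + b₃ * e) + 3 * (γ ^ 2 * G₀) + 3 * ((2 * G) ^ 2 * e)
    = 3 * γ ^ 2 * (b₁ * Mx)
      + (6 * γ ^ 2 * G₀ + 6 * γ ^ 2 * (b₂ * B₀ + b₃ * e) + 24 * G ^ 2 * e) / 2 := by ring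
  rw [this, ← hMx]
  linarith

theorem biasCoef_nonneg : 0 ≤ biasCoef p Gh Lh := by rw [biasCoef]; positivity

theorem dualCoef_nonneg : 0 ≤ dualCoef p Gh Lh := by rw [dualCoef]; positivity

theorem driftCoef_nonneg : 0 ≤ driftCoef p Gh Lh := by rw [driftCoef]; positivity

/-- Inserting the dual levels into the primal bias bound and collecting terms; the three
coefficients are defined as the result. -/
theorem bias_coef_eq {B₀ e Mx : ℝ} :
    4 * gradLip p Gh Lh ^ 2 * ((16 * gradBound p Gh ^ 2 + 64) * e + Mx + (3 * B₀
        + 3 * (8 * Gh ^ 2 * ((16 * gradBound p Gh ^ 2 + 64) * e + Mx)) + 3 * (64 * e)))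
      = biasCoef p Gh Lh * Mx + dualCoef p Gh Lh * B₀ + driftCoef p Gh Lh * e := by
  rw [biasCoef, dualCoef, driftCoef]
  ring

/-- The deviation of the averaged iterates from a gradient flow with the gradient at `v₀`. -/
theorem Assumptions.integral_perturbation_le (hA : Assumptions p Gh Lh L1 μ Δ₀ h P) (hK : 0 < K)
    (hp0 : 0 < p) (hp1 : p < 1) (hGh : 0 ≤ Gh) (hLh : 0 ≤ Lh)
    {Ω : Type*} {mΩ : MeasurableSpace Ω} {Pr : Measure Ω} [IsProbabilityMeasure Pr]
    {v₀ : Ω → Primal d} {α₀ : Ω → ℝ} {z : ℕ → Fin K → Ω → X × Bool}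
    {γ η : ℝ} (hγ : 0 < γ) (hη : 0 < η)
    (hη1 : η ≤ 1 / 2) {I T : ℕ} (hI : 1 ≤ I) (hIe : (((I : ℝ) - 1) * η) ^ 2 ≤ η / K)
    (hT1 : η * T ≤ 1) (hγb : 960 * γ ^ 2 * biasCoef p Gh Lh ≤ 1)
    (hv₀ : ∀ ω, v₀ ω ∈ unitBox d) (hα₀ : ∀ ω, |α₀ ω| ≤ dualBound p)
    (hS : FreshSamples Pr P v₀ α₀ z) :
    (∀ t, BddMeas fun ω => (avgState (stageState p h γ η I v₀ α₀ z t ω)).1 - v₀ ω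
      + (γ * (1 - (γ / (η + γ)) ^ t)) • phiGrad p h P (v₀ ω)) ∧
    ∀ t ≤ T, ∫ ω, ‖(avgState (stageState p h γ η I v₀ α₀ z t ω)).1 - v₀ ω
      + (γ * (1 - (γ / (η + γ)) ^ t)) • phiGrad p h P (v₀ ω)‖ ^ 2 ∂Pr
      ≤ γ ^ 2 / 80 * ∫ ω, ‖phiGrad p h P (v₀ ω)‖ ^ 2 ∂Pr
        + 4 * dualCoef p Gh Lh * γ ^ 2
            * ∫ ω, (α₀ ω - dualOpt p h P (wPart (v₀ ω))) ^ 2 ∂Pr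
        + γ / 5 * stageNoise p Gh Lh γ * (η / K) := by
  have hG := gradBound_pos hp0 hp1 hGh
  have hLp := gradLip_pos hp0 hp1 hGh hLh
  have hK' : (0 : ℝ) < K := by exact_mod_cast hK
  have hk0 : 0 < p * (1 - p) := mul_pos hp0 (by linarith)
  have hk1 : p * (1 - p) ≤ 1 := by nlinarith
  -- The common noise level η/K of gradient noise, dual noise and drift.
  obtain ⟨e, he⟩ : ∃ e, e = η / (K : ℝ) := ⟨_, rfl⟩
  rw [← he] at hIe ⊢
  have he0 : 0 ≤ e := by rw [he]; positivity
  set st := stageState p h γ η I v₀ α₀ z with hst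
  have hvm := hS.measurable_primal
  have hαm := hS.measurable_dual
  have hreg : ∀ t ω k, InRegion p Gh γ (v₀ ω) (st t ω k) := fun t ω k =>
    hA.inRegion_dsgState hK hp0 hp1 hGh hγ hη hη1 I (hv₀ ω) (hα₀ ω) _ t k
  have hregA : ∀ t ω, InRegion p Gh γ (v₀ ω) (avgState (st t ω)) := fun t ω =>
    InRegion.average hp0 hp1 hGh hγ hK (hreg t ω)
  have hstm : ∀ t k, Measurable fun ω => st t ω k := fun t k =>
    hA.measurable_dsgState γ η I hvm hαm t (fun t' _ k => hS.measurable_sample t' k) k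
  have hDm : Measurable fun ω => dualOpt p h P (wPart (v₀ ω)) :=
    hA.measurable_dualOpt.comp (measurable_wPart.comp hvm)
  have hDb : ∀ ω, |dualOpt p h P (wPart (v₀ ω))| ≤ 1 := fun ω => hA.abs_dualOpt_le hp0 hp1 _
  have hgB : BddMeas fun ω => phiGrad p h P (v₀ ω) := ⟨hA.measurable_phiGrad.comp hvm, _,
    fun ω => hA.norm_phiGrad_le hp0 hp1 hGh (unitBox_subset_box d (hv₀ ω))⟩
  have hxB : ∀ t, BddMeas fun ω => (avgState (st t ω)).1 - v₀ ω := fun t =>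
    ⟨(measurable_fst.comp (measurable_avgState (hstm t))).sub hvm, _, fun ω => (hregA t ω).near⟩
  have hβB : ∀ t, BddMeas fun ω => (avgState (st t ω)).2 - dualOpt p h P (wPart (v₀ ω)) :=
    fun t => ⟨(measurable_snd.comp (measurable_avgState (hstm t))).sub hDm, dualBound p + 1,
      fun ω => (norm_sub_le _ _).trans (add_le_add (hregA t ω).dual (hDb ω))⟩
  have hbB : ∀ t, BddMeas fun ω => gradBias p h P (v₀ ω) (st t ω) := fun t =>
    ((BddMeas.sum fun k _ => ⟨hA.measurable_meanGrad k (measurable_fst.comp (hstm t k))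
      (measurable_snd.comp (hstm t k)), _, fun ω => hA.norm_meanGrad_le hp0 hp1 k
        (unitBox_subset_box d (hreg t ω k).mem) (hreg t ω k).dual⟩).const_smul _).sub hgB
  have hδB : ∀ t, BddMeas fun ω => gapBias p h P (v₀ ω) (st t ω) := fun t =>
    ((BddMeas.sum fun k _ => ⟨(hA.measurable_classGap k).comp (measurable_wPart.comp
      (measurable_fst.comp (hstm t k))), _, fun ω => hA.abs_classGap_le hp0 hp1 k _⟩).const_mul
        (1 / (K : ℝ))).sub ⟨hDm, _, hDb⟩
  have hξB := hA.bddMeas_avgNoise (I := I) hK hp0 hp1 hGh hγ hη hη1 hv₀ hα₀ hS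
    (Φ := primalNoise p h P) hA.measurable_primalNoise (hA.norm_primalNoise_le hp0 hp1)
  have hζB := hA.bddMeas_avgNoise (I := I) hK hp0 hp1 hGh hγ hη hη1 hv₀ hα₀ hS
    (Φ := dualNoise p h P) hA.measurable_dualNoise (hA.norm_dualNoise_le hp0 hp1)
  have hsum : 0 < η + γ := by positivity
  have hθ0 : 0 ≤ γ / (η + γ) := by positivity
  have hθ1 : γ / (η + γ) ≤ 1 := by rw [div_le_one hsum]; linarith
  have hl0 : 0 ≤ 2 * (p * (1 - p)) * η := by positivity
  have hl1 : 2 * (p * (1 - p)) * η ≤ 1 := by nlinarith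
  -- At most T increments of variance η²C/K amount to (ηT)·Cη/K, and ηT ≤ 1.
  have hnoise : ∀ t ≤ T, ∀ c C : ℝ, c ^ 2 ≤ η ^ 2 → 0 ≤ C →
      (t : ℝ) * (c ^ 2 * (C / K)) ≤ C * e := by
    intro t ht c C hc hC
    have ht' : (t : ℝ) ≤ T := by exact_mod_cast ht
    calc (t : ℝ) * (c ^ 2 * (C / K)) ≤ T * (η ^ 2 * (C / K)) :=
          mul_le_mul ht' (mul_le_mul_of_nonneg_right hc (by positivity)) (by positivity)
            (by positivity)
      _ = (η * T) * (C * e) := by rw [he]; ring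
      _ ≤ C * e := mul_le_of_le_one_left (by positivity) hT1
  have hn : ∀ t ≤ T, ∫ ω, ‖accNoise (γ / (η + γ)) (-(γ / (η + γ) * η))
      (fun t => avgNoise (primalNoise p h P) st z t ω) t‖ ^ 2 ∂Pr
      ≤ (2 * gradBound p Gh) ^ 2 * e := fun t ht =>
    (integral_norm_sq_accNoise_le hθ0 hθ1 hξB
      (hA.integral_inner_accNoise_eq_zero hK hp0 hp1 hGh hγ hη hη1 hv₀ hα₀ hS
        hA.measurable_primalNoise (hA.integrable_primalNoise hp0 hp1)
        (hA.integral_primalNoise hp0 hp1) (hA.norm_primalNoise_le hp0 hp1) _ _)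
      (hA.integral_norm_sq_avgNoise_le hK hp0 hp1 hGh hγ hη hη1 hv₀ hα₀ hS
        hA.measurable_primalNoise (hA.integrable_primalNoise hp0 hp1)
        (hA.integral_primalNoise hp0 hp1) (hA.norm_primalNoise_le hp0 hp1)) t).trans
      (hnoise t ht _ _ (by
        rw [neg_sq, mul_pow]
        exact mul_le_of_le_one_left (sq_nonneg _) (pow_le_one₀ hθ0 hθ1)) (by positivity))
  have hm : ∀ t ≤ T, ∫ ω, accNoise (1 - 2 * (p * (1 - p)) * η) η
      (fun t => avgNoise (dualNoise p h P) st z t ω) t ^ 2 ∂Pr ≤ 64 * e := by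
    intro t ht
    have := (integral_norm_sq_accNoise_le (sub_nonneg.mpr hl1) (sub_le_self 1 hl0) hζB
      (hA.integral_inner_accNoise_eq_zero hK hp0 hp1 hGh hγ hη hη1 hv₀ hα₀ hS
        hA.measurable_dualNoise (hA.integrable_dualNoise hp0 hp1)
        (hA.integral_dualNoise hp0 hp1) (hA.norm_dualNoise_le hp0 hp1) _ η)
      (hA.integral_norm_sq_avgNoise_le hK hp0 hp1 hGh hγ hη hη1 hv₀ hα₀ hS
        hA.measurable_dualNoise (hA.integrable_dualNoise hp0 hp1)
        (hA.integral_dualNoise hp0 hp1) (hA.norm_dualNoise_le hp0 hp1)) t).trans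
      (hnoise t ht _ _ le_rfl (by positivity))
    simp only [Real.norm_eq_abs, sq_abs] at this
    refine this.trans_eq ?_
    norm_num
  have hβ0 : ∫ ω, ((avgState (st 0 ω)).2 - dualOpt p h P (wPart (v₀ ω))) ^ 2 ∂Pr
      = ∫ ω, (α₀ ω - dualOpt p h P (wPart (v₀ ω))) ^ 2 ∂Pr := by
    have : ∀ ω, avgState (st 0 ω) = (v₀ ω, α₀ ω) := fun ω => avgState_const hK _
    simp only [this]
  obtain ⟨G₀, hG₀⟩ : ∃ G₀, G₀ = ∫ ω, ‖phiGrad p h P (v₀ ω)‖ ^ 2 ∂Pr := ⟨_, rfl⟩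
  obtain ⟨B₀, hB₀⟩ : ∃ B₀, B₀ = ∫ ω, (α₀ ω - dualOpt p h P (wPart (v₀ ω))) ^ 2 ∂Pr := ⟨_, rfl⟩
  have hG₀0 : 0 ≤ G₀ := hG₀ ▸ integral_nonneg fun ω => by positivity
  have hB₀0 : 0 ≤ B₀ := hB₀ ▸ integral_nonneg fun ω => by positivity
  have hb₁0 : 0 ≤ biasCoef p Gh Lh := biasCoef_nonneg
  have hb₂0 : 0 ≤ dualCoef p Gh Lh := dualCoef_nonneg
  have hb₃0 : 0 ≤ driftCoef p Gh Lh := driftCoef_nonneg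
  -- Twice the external contributions to E‖x_t‖², so that the feedback fits into the other half.
  obtain ⟨Mx, hMx⟩ : ∃ Mx, Mx = 6 * γ ^ 2 * G₀ + 6 * γ ^ 2 * (dualCoef p Gh Lh * B₀
    + driftCoef p Gh Lh * e) + 24 * gradBound p Gh ^ 2 * e := ⟨_, rfl⟩
  have hMx0 : 0 ≤ Mx := by rw [hMx]; positivity
  have hfin := bias_level_le (G := gradBound p Gh) hγ hγb hb₂0 hb₃0 he0 hG₀0 hB₀0
  have hcl := bias_level_closed (G := gradBound p Gh) hγb hb₂0 hb₃0 he0 hG₀0 hB₀0 hMx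
  rw [← hMx] at hfin
  rw [← hG₀, ← hB₀, stageNoise]
  refine ⟨fun t => (hxB t).add (hgB.const_smul _), fun t ht => le_trans ?_ hfin⟩
  exact coupled_recursion_bound (Pr := Pr) (T := T) (a := 4 * gradLip p Gh Lh ^ 2)
    (a' := 8 * Gh ^ 2) (c := (16 * gradBound p Gh ^ 2 + 64) * e)
    (N₁ := (2 * gradBound p Gh) ^ 2 * e) (N₂ := 64 * e) (Mx := Mx)
    (Mβ := 3 * B₀ + 3 * (8 * Gh ^ 2 * ((16 * gradBound p Gh ^ 2 + 64) * e + Mx)) + 3 * (64 * e))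
    (Mδ := 8 * Gh ^ 2 * ((16 * gradBound p Gh ^ 2 + 64) * e + Mx))
    (Mb := biasCoef p Gh Lh * Mx + dualCoef p Gh Lh * B₀ + driftCoef p Gh Lh * e)
    (x := fun t ω => (avgState (st t ω)).1 - v₀ ω) (b := fun t ω => gradBias p h P (v₀ ω) (st t ω))
    (ξ := avgNoise (primalNoise p h P) st z) (g := fun ω => phiGrad p h P (v₀ ω))
    (β := fun t ω => (avgState (st t ω)).2 - dualOpt p h P (wPart (v₀ ω)))
    (δ := fun t ω => gapBias p h P (v₀ ω) (st t ω)) (ζ := avgNoise (dualNoise p h P) st z)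
    hγ hη hl0 hl1 (by positivity) (by positivity) hxB hbB hξB hgB hβB hδB hζB
    (fun ω => by
      have : avgState (st 0 ω) = (v₀ ω, α₀ ω) := avgState_const hK _
      simp [this])
    (fun t ω => hA.avgState_primal_succ hK hγ hη I (v₀ ω) (α₀ ω) (fun t k => z t k ω) t)
    (fun t ω => avgState_dual_succ hK I (v₀ ω) (α₀ ω) (fun t k => z t k ω) t)
    (fun t ω => hA.norm_gradBias_sq_le hK hp0 hp1 hGh hLh hγ hη hη1 hI hIe (hv₀ ω) (hα₀ ω) _ t)
    (fun t ω => hA.gapBias_sq_le hK hp0 hp1 hGh hγ hη hη1 hI hIe (hv₀ ω) (hα₀ ω) _ t)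
    hn hm le_rfl (by positivity) (by positivity) (by rw [hβ0, hB₀]) bias_coef_eq.le
    (by rw [← hG₀]; linarith) t ht

/-- One stage decreases `φ` like a gradient step, up to the initial dual error and the noise. -/
theorem Assumptions.stage_bound (hA : Assumptions p Gh Lh L1 μ Δ₀ h P) (hK : 0 < K)
    (hp0 : 0 < p) (hp1 : p < 1) (hGh : 0 ≤ Gh) (hLh : 0 ≤ Lh) (hL1 : 0 ≤ L1)
    {Ω : Type*} {mΩ : MeasurableSpace Ω} {Pr : Measure Ω} [IsProbabilityMeasure Pr]
    {v₀ : Ω → Primal d} {α₀ : Ω → ℝ} {z : ℕ → Fin K → Ω → X × Bool}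
    {γ η : ℝ} (hγ : 0 < γ) (hη : 0 < η)
    (hη1 : η ≤ 1 / 2) {I T : ℕ} (hI : 1 ≤ I) (hIe : (((I : ℝ) - 1) * η) ^ 2 ≤ η / K)
    (hT : 16 * γ ≤ η * T) (hT1 : η * T ≤ 1) (hγb : 960 * γ ^ 2 * biasCoef p Gh Lh ≤ 1)
    (hγL : 32 * L1 * γ ≤ 1)
    (hv₀ : ∀ ω, v₀ ω ∈ unitBox d) (hα₀ : ∀ ω, |α₀ ω| ≤ dualBound p)
    (hS : FreshSamples Pr P v₀ α₀ z) :
    ∫ ω, phi p h P (dsgOutput p h γ η T I (v₀ ω) (α₀ ω) (fun t k => z t k ω)) ∂Pr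
      ≤ ∫ ω, phi p h P (v₀ ω) ∂Pr - 3 / 4 * γ * ∫ ω, ‖phiGrad p h P (v₀ ω)‖ ^ 2 ∂Pr
        + 20 * dualCoef p Gh Lh * γ * ∫ ω, (α₀ ω - dualOpt p h P (wPart (v₀ ω))) ^ 2 ∂Pr
        + stageNoise p Gh Lh γ * (η / K) := by
  obtain ⟨hρB, hρ⟩ := hA.integral_perturbation_le hK hp0 hp1 hGh hLh hγ hη hη1 hI hIe hT1 hγb
    hv₀ hα₀ hS
  obtain ⟨hW1, hW2⟩ := average_prox_weight hγ hη hT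
  have hTpos : (0 : ℝ) < T := by
    by_contra hneg
    have : (T : ℝ) = 0 := le_antisymm (not_lt.mp hneg) (Nat.cast_nonneg T)
    rw [this] at hT; linarith
  have hTnat : 1 ≤ T := by exact_mod_cast hTpos
  have hvm := hS.measurable_primal
  have hαm := hS.measurable_dual
  have hgB : BddMeas fun ω => phiGrad p h P (v₀ ω) := ⟨hA.measurable_phiGrad.comp hvm, _,
    fun ω => hA.norm_phiGrad_le hp0 hp1 hGh (unitBox_subset_box d (hv₀ ω))⟩
  have hR2 := integral_norm_sq_time_average_le hTnat hρB hρ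
  have hRB : BddMeas fun ω => (1 / (T : ℝ)) • ∑ t ∈ Finset.Icc 1 T,
      ((avgState (stageState p h γ η I v₀ α₀ z t ω)).1 - v₀ ω
        + (γ * (1 - (γ / (η + γ)) ^ t)) • phiGrad p h P (v₀ ω)) :=
    (BddMeas.sum fun t _ => hρB t).const_smul _
  -- The stage output is v₀ - Wg + R, with W the averaged weight of the noiseless path and R the
  -- averaged perturbation.
  have hout : ∀ ω, dsgOutput p h γ η T I (v₀ ω) (α₀ ω) (fun t k => z t k ω) - v₀ ω
      = (1 / (T : ℝ)) • ∑ t ∈ Finset.Icc 1 T,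
          ((avgState (stageState p h γ η I v₀ α₀ z t ω)).1 - v₀ ω
            + (γ * (1 - (γ / (η + γ)) ^ t)) • phiGrad p h P (v₀ ω))
        - (1 / (T : ℝ) * ∑ t ∈ Finset.Icc 1 T, γ * (1 - (γ / (η + γ)) ^ t))
            • phiGrad p h P (v₀ ω) := by
    intro ω
    have e1 : (1 / (T : ℝ)) • ∑ _t ∈ Finset.Icc 1 T, v₀ ω = v₀ ω := by
      rw [Finset.sum_const, Nat.card_Icc, add_tsub_cancel_right, ← Nat.cast_smul_eq_nsmul ℝ,
        smul_smul, one_div_mul_cancel hTpos.ne', one_smul]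
    rw [dsgOutput_eq, Finset.sum_add_distrib, Finset.sum_sub_distrib, ← Finset.sum_smul, smul_add,
      smul_sub, e1, smul_smul, add_sub_cancel_right]
    rfl
  have hWm : ∀ ω, dsgOutput p h γ η T I (v₀ ω) (α₀ ω) (fun t k => z t k ω) ∈ unitBox d := fun ω =>
    hA.dsgOutput_mem hK hp0 hp1 hGh hγ hη hη1 hTnat I (hv₀ ω) (hα₀ ω) _
  generalize 1 / (T : ℝ) * ∑ t ∈ Finset.Icc 1 T, γ * (1 - (γ / (η + γ)) ^ t) = W at hW1 hW2 hout
  generalize hR : (fun ω => (1 / (T : ℝ)) • ∑ t ∈ Finset.Icc 1 T,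
      ((avgState (stageState p h γ η I v₀ α₀ z t ω)).1 - v₀ ω
        + (γ * (1 - (γ / (η + γ)) ^ t)) • phiGrad p h P (v₀ ω))) = R at hRB
  have hR' : ∀ ω, (1 / (T : ℝ)) • ∑ t ∈ Finset.Icc 1 T,
      ((avgState (stageState p h γ η I v₀ α₀ z t ω)).1 - v₀ ω
        + (γ * (1 - (γ / (η + γ)) ^ t)) • phiGrad p h P (v₀ ω)) = R ω := fun ω => congrFun hR ω
  simp only [hR'] at hR2 hout
  have hpt : ∀ ω, phi p h P (dsgOutput p h γ η T I (v₀ ω) (α₀ ω) (fun t k => z t k ω))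
      ≤ phi p h P (v₀ ω) + (-(13 / 16 * γ) * ‖phiGrad p h P (v₀ ω)‖ ^ 2
        + 5 / γ * ‖R ω‖ ^ 2) := by
    intro ω
    have e1 := hA.phi_descent hK hp0 hp1 hL1 (unitBox_subset_box d (hWm ω))
      (unitBox_subset_box d (hv₀ ω))
    rw [hout ω] at e1
    linarith [descent_pointwise hγ hL1 hγL hW1 hW2 (phiGrad p h P (v₀ ω)) (R ω)]
  have hφB : ∀ u : Ω → Primal d, Measurable u → (∀ ω, u ω ∈ unitBox d) →
      BddMeas fun ω => phi p h P (u ω) := fun u hu hub =>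
    ⟨(hA.measurable_phi hK hp0 hp1).comp hu, 9, fun ω =>
      hA.abs_phi_le hK hp0 hp1 (unitBox_subset_box d (hub ω))⟩
  have i0 := (hφB _ (hA.measurable_dsgOutput γ η T I hvm hαm hS.measurable_sample)
    hWm).integrable (Pr := Pr)
  have i1 := (hφB _ hvm hv₀).integrable (Pr := Pr)
  have i2 := (hgB.norm_sq.const_mul (-(13 / 16 * γ))).integrable (Pr := Pr)
  have i3 := (hRB.norm_sq.const_mul (5 / γ)).integrable (Pr := Pr)
  have i23 : Integrable (fun ω => -(13 / 16 * γ) * ‖phiGrad p h P (v₀ ω)‖ ^ 2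
        + 5 / γ * ‖R ω‖ ^ 2) Pr := i2.add i3
  have hfin := integral_mono i0 (i1.add i23) hpt
  simp only [Pi.add_apply] at hfin
  rw [integral_add i1 i23, integral_add i2 i3, integral_const_mul, integral_const_mul] at hfin
  have h1 := mul_le_mul_of_nonneg_left hR2 (by positivity : 0 ≤ 5 / γ)
  generalize ∫ ω, ‖phiGrad p h P (v₀ ω)‖ ^ 2 ∂Pr = G₀ at *
  generalize ∫ ω, (α₀ ω - dualOpt p h P (wPart (v₀ ω))) ^ 2 ∂Pr = B₀ at *
  -- The perturbation returns γ/16 of the gradient term, so -13γ/16 becomes -3γ/4.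
  have h2 : 5 / γ * (γ ^ 2 / 80 * G₀ + 4 * dualCoef p Gh Lh * γ ^ 2 * B₀
      + γ / 5 * stageNoise p Gh Lh γ * (η / K))
      = γ / 16 * G₀ + 20 * dualCoef p Gh Lh * γ * B₀ + stageNoise p Gh Lh γ * (η / K) := by
    field_simp
    ring
  linarith

end stage

/-! ### Sample means over a random class -/

section ratio

variable {Ω E : Type*} {mΩ : MeasurableSpace Ω} [MeasurableSpace E] {Pr : Measure Ω}
  [IsProbabilityMeasure Pr] {Q : Measure E} {ι : Type*} [DecidableEq ι] {s : Finset ι}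
  {Z : ι → Ω → E} {G J : E → ℝ} {a q : ℝ}

theorem sum_indicator_nonneg (hJ : ∀ z, J z = 0 ∨ J z = 1) (s : Finset ι) (x : ι → E) :
    0 ≤ ∑ i ∈ s, J (x i) :=
  Finset.sum_nonneg fun i _ => by rcases hJ (x i) with h | h <;> simp [h]

theorem classRatio_mem (hG : ∀ z, G z ∈ Set.Icc (0 : ℝ) 1) (hJ : ∀ z, J z = 0 ∨ J z = 1)
    (x : ι → E) :
    (∑ i ∈ s, G (x i) * J (x i)) / (∑ i ∈ s, J (x i)) ∈ Set.Icc (0 : ℝ) 1 := by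
  have hJ0 : ∀ z, 0 ≤ J z := fun z => by rcases hJ z with h | h <;> simp [h]
  refine ⟨div_nonneg (Finset.sum_nonneg fun i _ => mul_nonneg (hG _).1 (hJ0 _))
    (sum_indicator_nonneg hJ s x), div_le_one_of_le₀ (Finset.sum_le_sum fun i _ =>
      mul_le_of_le_one_left (hJ0 _) (hG _).2) (sum_indicator_nonneg hJ s x)⟩

/-- If sample i is in the class, the class size is one plus the count among the other samples, so
the weight of sample i does not involve it. The product is the indicator of an empty class, where
0/0 = 0 makes the error -a. Thus independence kills every summand in the mean and only the empty
event biases the estimator. -/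
theorem classRatio_sub_eq (hJ : ∀ z, J z = 0 ∨ J z = 1) (x : ι → E) :
    (∑ i ∈ s, G (x i) * J (x i)) / (∑ i ∈ s, J (x i)) - a
      = ∑ i ∈ s, (G (x i) - a) * J (x i) * (1 / (1 + ∑ j ∈ s.erase i, J (x j)))
        - a * ∏ i ∈ s, (1 - J (x i)) := by
  by_cases h0 : ∀ i ∈ s, J (x i) = 0
  · rw [Finset.sum_eq_zero (f := fun i => (J (x i))) h0,
      Finset.sum_eq_zero (f := fun i => (G (x i) - a) * J (x i) * _)
        (fun i hi => by rw [h0 i hi]; ring),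
      Finset.prod_eq_one (fun i hi => by rw [h0 i hi]; ring)]
    simp
  · push Not at h0
    obtain ⟨i₀, hi₀, h1⟩ := h0
    have h1 : J (x i₀) = 1 := (hJ _).resolve_left h1
    rw [Finset.prod_eq_zero hi₀ (by rw [h1]; ring)]
    have hpos : 0 < ∑ i ∈ s, J (x i) := by
      rw [← Finset.add_sum_erase s _ hi₀, h1]
      linarith [sum_indicator_nonneg hJ (s.erase i₀) x]
    have h2 : ∀ i ∈ s, (G (x i) - a) * J (x i) * (1 / (1 + ∑ j ∈ s.erase i, J (x j)))
        = (G (x i) * J (x i) - a * J (x i)) * (1 / ∑ j ∈ s, J (x j)) := by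
      intro i hi
      rcases hJ (x i) with h | h
      · rw [h]; ring
      · rw [← Finset.add_sum_erase s _ hi, h]; ring
    rw [Finset.sum_congr rfl h2, ← Finset.sum_mul, Finset.sum_sub_distrib, ← Finset.mul_sum]
    field_simp
    ring

/-- The structure of an i.i.d. sample from `Q`, with scores `G` and a class indicator `J`. -/
structure ClassSample (Pr : Measure Ω) (Q : Measure E) (Z : ι → Ω → E) (G J : E → ℝ) (a q : ℝ) :
    Prop where
  measurable_sample : ∀ i, Measurable (Z i)
  law : ∀ i, Pr.map (Z i) = Q
  indep : iIndepFun Z Pr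
  measurable_score : Measurable G
  measurable_ind : Measurable J
  score_mem : ∀ z, G z ∈ Set.Icc (0 : ℝ) 1
  ind_mem : ∀ z, J z = 0 ∨ J z = 1
  mean_mem : a ∈ Set.Icc (0 : ℝ) 1
  mean_eq : ∫ z, (G z - a) * J z ∂Q = 0
  prob_eq : ∫ z, J z ∂Q = q

namespace ClassSample

variable (hC : ClassSample Pr Q Z G J a q)
include hC

theorem bddMeas_ind (i : ι) : BddMeas fun ω => J (Z i ω) :=
  ⟨hC.measurable_ind.comp (hC.measurable_sample i), 1, fun ω => by
    rcases hC.ind_mem (Z i ω) with h | h <;> simp [h]⟩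

theorem abs_dev_le (z : E) : |(G z - a) * J z| ≤ 1 := by
  obtain ⟨h0, h1⟩ := hC.score_mem z
  obtain ⟨a0, a1⟩ := hC.mean_mem
  rcases hC.ind_mem z with h | h
  · simp [h]
  · rw [h, mul_one, abs_le]; constructor <;> linarith

theorem bddMeas_dev (i : ι) : BddMeas fun ω => (G (Z i ω) - a) * J (Z i ω) :=
  ⟨((hC.measurable_score.sub_const a).mul hC.measurable_ind).comp (hC.measurable_sample i), 1,
    fun _ => hC.abs_dev_le _⟩

theorem integral_ind (i : ι) : ∫ ω, J (Z i ω) ∂Pr = q := by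
  rw [← hC.prob_eq, ← hC.law i, integral_map (hC.measurable_sample i).aemeasurable
    hC.measurable_ind.aestronglyMeasurable]

theorem integral_dev (i : ι) : ∫ ω, (G (Z i ω) - a) * J (Z i ω) ∂Pr = 0 := by
  have hf : Measurable fun z => (G z - a) * J z :=
    (hC.measurable_score.sub_const a).mul hC.measurable_ind
  rw [← hC.mean_eq, ← hC.law i, integral_map (hC.measurable_sample i).aemeasurable
    hf.aestronglyMeasurable]

theorem bddMeas_ratio (s : Finset ι) : BddMeas fun ω =>
    (∑ i ∈ s, G (Z i ω) * J (Z i ω)) / (∑ i ∈ s, J (Z i ω)) := by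
  refine ⟨?_, 1, fun ω => ?_⟩
  · refine Measurable.div ?_ ?_
    · exact Finset.measurable_sum _ fun i _ =>
        (hC.measurable_score.mul hC.measurable_ind).comp (hC.measurable_sample i)
    · exact Finset.measurable_sum _ fun i _ => hC.measurable_ind.comp (hC.measurable_sample i)
  · obtain ⟨h0, h1⟩ := classRatio_mem (s := s) hC.score_mem hC.ind_mem fun i => Z i ω
    rw [Real.norm_eq_abs, abs_of_nonneg h0]
    exact h1

/-- The bias of the sample mean of a class is at most the probability that the class is empty. -/
theorem abs_integral_ratio_sub_le (s : Finset ι) :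
    |∫ ω, ((∑ i ∈ s, G (Z i ω) * J (Z i ω)) / (∑ i ∈ s, J (Z i ω)) - a) ∂Pr|
      ≤ |1 - q| ^ s.card := by
  have hw : ∀ i, BddMeas fun ω => 1 / (1 + ∑ j ∈ s.erase i, J (Z j ω)) := fun i => by
    refine ⟨measurable_const.div (measurable_const.add
      (Finset.measurable_sum _ fun j _ => (hC.bddMeas_ind j).measurable)), 1, fun ω => ?_⟩
    have := sum_indicator_nonneg hC.ind_mem (s.erase i) fun j => Z j ω
    rw [Real.norm_of_nonneg (by positivity)]
    exact div_le_one_of_le₀ (by linarith) (by linarith)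
  -- The deviation of sample i is centred and independent of its weight, which is a function of the
  -- other samples only.
  have hterm : ∀ i ∈ s, ∫ ω, (G (Z i ω) - a) * J (Z i ω)
      * (1 / (1 + ∑ j ∈ s.erase i, J (Z j ω))) ∂Pr = 0 := by
    intro i hi
    have hind := hC.indep.indepFun_finset {i} (s.erase i) (by simp) hC.measurable_sample
    have h2 := hind.comp
      (φ := fun x : (({i} : Finset ι) → E) => (G (x ⟨i, by simp⟩) - a) * J (x ⟨i, by simp⟩))
      (ψ := fun x : (↥(s.erase i) → E) => 1 / (1 + ∑ j, J (x j)))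
      (((hC.measurable_score.sub_const a).mul hC.measurable_ind).comp (measurable_pi_apply _))
      (measurable_const.div (measurable_const.add
        (Finset.measurable_sum _ fun j _ => hC.measurable_ind.comp (measurable_pi_apply _))))
    have h3 : ((fun x : (↥(s.erase i) → E) => 1 / (1 + ∑ j, J (x j))) ∘
        fun (ω : Ω) (j : ↥(s.erase i)) => Z j ω)
        = fun ω => 1 / (1 + ∑ j ∈ s.erase i, J (Z j ω)) := by
      funext ω
      simp only [Function.comp]
      rw [← Finset.sum_coe_sort (s.erase i) fun j => J (Z j ω)]
    rw [h3] at h2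
    have h4 := h2.integral_fun_mul_eq_mul_integral
      (hC.bddMeas_dev i).measurable.aestronglyMeasurable (hw i).measurable.aestronglyMeasurable
    simp only [Function.comp] at h4
    rw [h4, hC.integral_dev i, zero_mul]
  have hprod : ∫ ω, ∏ i ∈ s, (1 - J (Z i ω)) ∂Pr = (1 - q) ^ s.card := by
    have h1 := (hC.indep.precomp (g := fun i : s => (i : ι)) Subtype.val_injective).comp
      (fun _ z => 1 - J z) (fun _ => measurable_const.sub hC.measurable_ind)
    have h2 := h1.integral_fun_prod_eq_prod_integral fun i =>
      ((measurable_const.sub hC.measurable_ind).comp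
        (hC.measurable_sample i)).aestronglyMeasurable
    simp only [Function.comp] at h2
    have h3 : ∀ i : ι, ∫ ω, (1 - J (Z i ω)) ∂Pr = 1 - q := fun i => by
      rw [integral_sub (integrable_const _) (hC.bddMeas_ind i).integrable, hC.integral_ind]
      simp
    simp only [h3, Finset.prod_const, Finset.card_univ, Fintype.card_coe] at h2
    rw [← h2]
    refine integral_congr_ae (Filter.Eventually.of_forall fun ω => ?_)
    exact (Finset.prod_coe_sort s fun i => 1 - J (Z i ω)).symm
  have hPB : BddMeas fun ω => ∏ i ∈ s, (1 - J (Z i ω)) := by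
    refine ⟨Finset.measurable_prod _ fun i _ => measurable_const.sub (hC.bddMeas_ind i).measurable,
      1, fun ω => ?_⟩
    rw [Real.norm_eq_abs, Finset.abs_prod]
    refine Finset.prod_le_one (fun _ _ => abs_nonneg _) fun i _ => ?_
    rcases hC.ind_mem (Z i ω) with h | h <;> simp [h]
  have hsB : ∀ i, BddMeas fun ω => (G (Z i ω) - a) * J (Z i ω)
      * (1 / (1 + ∑ j ∈ s.erase i, J (Z j ω))) := fun i => (hC.bddMeas_dev i).mul (hw i)
  have hSB : BddMeas fun ω => ∑ i ∈ s, (G (Z i ω) - a) * J (Z i ω)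
      * (1 / (1 + ∑ j ∈ s.erase i, J (Z j ω))) := BddMeas.sum fun i _ => hsB i
  have e : ∀ ω, (∑ i ∈ s, G (Z i ω) * J (Z i ω)) / (∑ i ∈ s, J (Z i ω)) - a
      = ∑ i ∈ s, (G (Z i ω) - a) * J (Z i ω) * (1 / (1 + ∑ j ∈ s.erase i, J (Z j ω)))
        - a * ∏ i ∈ s, (1 - J (Z i ω)) := fun ω => classRatio_sub_eq hC.ind_mem fun i => Z i ω
  rw [integral_congr_ae (Filter.Eventually.of_forall e),
    integral_sub hSB.integrable (hPB.const_mul a).integrable,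
    integral_finsetSum _ fun i _ => (hsB i).integrable, Finset.sum_eq_zero hterm,
    integral_const_mul, hprod, zero_sub, abs_neg, abs_mul, abs_pow]
  exact mul_le_of_le_one_left (by positivity) (by
    rw [abs_of_nonneg hC.mean_mem.1]; exact hC.mean_mem.2)

omit hC in
theorem memLp_of_bddMeas {f : Ω → ℝ} (hf : BddMeas f) : MemLp f 2 Pr := by
  obtain ⟨hm, C, hb⟩ := hf
  exact MemLp.of_bound hm.aestronglyMeasurable C (Filter.Eventually.of_forall hb)

/-- The variance of a sum of independent bounded functions of the samples. -/
theorem integral_sq_sum_sub_le (s : Finset ι) {f : E → ℝ} (hf : Measurable f)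
    (hf1 : ∀ z, |f z| ≤ 1) {c : ℝ} (hc : ∀ i, ∫ ω, f (Z i ω) ∂Pr = c) :
    ∫ ω, (∑ i ∈ s, f (Z i ω) - s.card * c) ^ 2 ∂Pr ≤ s.card := by
  have hB : ∀ i, BddMeas fun ω => f (Z i ω) := fun i =>
    ⟨hf.comp (hC.measurable_sample i), 1, fun ω => hf1 _⟩
  have hSB : BddMeas fun ω => ∑ i ∈ s, f (Z i ω) := BddMeas.sum fun i _ => hB i
  have h1 := IndepFun.variance_sum (μ := Pr) (X := fun i ω => f (Z i ω)) (s := s)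
    (fun i _ => memLp_of_bddMeas (hB i))
    (fun i _ j _ hij => (hC.indep.indepFun hij).comp hf hf)
  have h2 : ∫ ω, ∑ i ∈ s, f (Z i ω) ∂Pr = s.card * c := by
    rw [integral_finsetSum _ fun i _ => (hB i).integrable, Finset.sum_congr rfl fun i _ => hc i,
      Finset.sum_const, nsmul_eq_mul]
  have h3 : variance (∑ i ∈ s, fun ω => f (Z i ω)) Pr
      = ∫ ω, (∑ i ∈ s, f (Z i ω) - s.card * c) ^ 2 ∂Pr := by
    have e : (∑ i ∈ s, fun ω => f (Z i ω)) = fun ω => ∑ i ∈ s, f (Z i ω) := by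
      funext ω; simp
    rw [e, variance_eq_integral hSB.measurable.aemeasurable, h2]
  rw [← h3, h1]
  refine (Finset.sum_le_sum fun i _ => (variance_le_expectation_sq
    (hB i).measurable.aestronglyMeasurable).trans (?_ : _ ≤ (1 : ℝ))).trans (by simp)
  refine (integral_mono (μ := Pr) (hB i).sq.integrable (integrable_const (1 : ℝ))
    fun ω => ?_).trans (by simp)
  exact (sq_le_one_iff_abs_le_one _).mpr (hf1 _)

/-- Let r = |s|q be the mean class size and n the actual one. For n ≥ r/2 the error is the centred
sum divided by n ≥ r/2; for n < r/2 the error is at most 1 while |n - r| > r/2. Both cases cost 4/r²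
times a second moment of size at most |s|. -/
theorem integral_ratio_sub_sq_le (hq : 0 < q) {s : Finset ι} (hs : 0 < s.card) :
    ∫ ω, ((∑ i ∈ s, G (Z i ω) * J (Z i ω)) / (∑ i ∈ s, J (Z i ω)) - a) ^ 2 ∂Pr
      ≤ 8 / (s.card * q ^ 2) := by
  have hm : (0 : ℝ) < s.card := by exact_mod_cast hs
  have hUB : BddMeas fun ω => ∑ i ∈ s, (G (Z i ω) - a) * J (Z i ω) :=
    BddMeas.sum fun i _ => hC.bddMeas_dev i
  have hNB : BddMeas fun ω => ∑ i ∈ s, J (Z i ω) - s.card * q :=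
    (BddMeas.sum fun i _ => hC.bddMeas_ind i).sub (BddMeas.const _)
  have hU : ∫ ω, (∑ i ∈ s, (G (Z i ω) - a) * J (Z i ω)) ^ 2 ∂Pr ≤ s.card := by
    simpa using hC.integral_sq_sum_sub_le s (f := fun z => (G z - a) * J z)
      ((hC.measurable_score.sub_const a).mul hC.measurable_ind) hC.abs_dev_le hC.integral_dev
  have hN : ∫ ω, (∑ i ∈ s, J (Z i ω) - s.card * q) ^ 2 ∂Pr ≤ s.card :=
    hC.integral_sq_sum_sub_le s hC.measurable_ind
      (fun z => by rcases hC.ind_mem z with h | h <;> simp [h]) hC.integral_ind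
  have hpt : ∀ ω, ((∑ i ∈ s, G (Z i ω) * J (Z i ω)) / (∑ i ∈ s, J (Z i ω)) - a) ^ 2
      ≤ 4 / (s.card * q) ^ 2 * ((∑ i ∈ s, (G (Z i ω) - a) * J (Z i ω)) ^ 2
        + (∑ i ∈ s, J (Z i ω) - s.card * q) ^ 2) := by
    intro ω
    have hR := classRatio_mem (s := s) hC.score_mem hC.ind_mem fun i => Z i ω
    have hU' : ∑ i ∈ s, (G (Z i ω) - a) * J (Z i ω)
        = ∑ i ∈ s, G (Z i ω) * J (Z i ω) - a * ∑ i ∈ s, J (Z i ω) := by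
      rw [Finset.mul_sum, ← Finset.sum_sub_distrib]
      exact Finset.sum_congr rfl fun i _ => by ring
    obtain ⟨a0, a1⟩ := hC.mean_mem
    rw [hU']
    generalize ∑ i ∈ s, G (Z i ω) * J (Z i ω) = u at *
    generalize ∑ i ∈ s, J (Z i ω) = n at *
    have hmq : 0 < s.card * q := by positivity
    generalize (s.card : ℝ) * q = r at *
    rw [div_mul_eq_mul_div, le_div_iff₀ (by positivity)]
    by_cases hn : n < r / 2
    · have h1 : (u / n - a) ^ 2 ≤ 1 := by
        rw [sq_le_one_iff_abs_le_one, abs_le]; constructor <;> linarith [hR.1, hR.2]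
      have h2 : r ^ 2 ≤ 4 * (n - r) ^ 2 := by nlinarith
      nlinarith [sq_nonneg (u - a * n), sq_nonneg r]
    · have hn0 : 0 < n := by linarith
      have h1 : (u / n - a) * n = u - a * n := by field_simp
      have h2 : (u / n - a) ^ 2 * r ^ 2 ≤ (u / n - a) ^ 2 * (4 * n ^ 2) :=
        mul_le_mul_of_nonneg_left (by nlinarith) (sq_nonneg _)
      have h3 : (u / n - a) ^ 2 * (4 * n ^ 2) = 4 * (u - a * n) ^ 2 := by rw [← h1]; ring
      nlinarith [sq_nonneg (n - r)]
  have i1 : Integrable (fun ω => (∑ i ∈ s, (G (Z i ω) - a) * J (Z i ω)) ^ 2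
        + (∑ i ∈ s, J (Z i ω) - s.card * q) ^ 2) Pr := (hUB.sq.add hNB.sq).integrable
  refine (integral_mono ((hC.bddMeas_ratio s).sub (BddMeas.const a)).sq.integrable
    (i1.const_mul (4 / (s.card * q) ^ 2)) hpt).trans ?_
  rw [integral_const_mul, integral_add hUB.sq.integrable hNB.sq.integrable]
  refine (mul_le_mul_of_nonneg_left (add_le_add hU hN) (by positivity)).trans_eq ?_
  field_simp
  norm_num

end ClassSample

end ratio

/-! ### The dual estimate -/

section dualEstimate

variable {d K : ℕ} {X : Type*} [MeasurableSpace X]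
  {p Gh Lh L1 μ Δ₀ : ℝ} {h : Weights d → X → ℝ} {P : Fin K → Measure (X × Bool)}

/-- The difference of the sample means of the two classes on one machine. -/
def classRatioGap (h : Weights d → X → ℝ) (m : ℕ) (w : Weights d) (x : ℕ → X × Bool) : ℝ :=
  (∑ i ∈ Finset.Icc 1 m, h w (x i).1 * negInd (x i)) / (∑ i ∈ Finset.Icc 1 m, negInd (x i))
    - (∑ i ∈ Finset.Icc 1 m, h w (x i).1 * posInd (x i)) / (∑ i ∈ Finset.Icc 1 m, posInd (x i))

theorem dualEstimate_eq (m : ℕ) (v : Primal d) (z : ℕ → Fin K → X × Bool) :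
    dualEstimate h m v z = (1 / (K : ℝ)) * ∑ k, classRatioGap h m (wPart v) fun i => z i k := rfl

theorem Assumptions.abs_classRatioGap_le (hA : Assumptions p Gh Lh L1 μ Δ₀ h P) (m : ℕ)
    (w : Weights d) (x : ℕ → X × Bool) : |classRatioGap h m w x| ≤ 1 := by
  obtain ⟨a0, a1⟩ := classRatio_mem (s := Finset.Icc 1 m) (G := fun z : X × Bool => h w z.1)
    (J := negInd) (fun z => hA.score_mem w z.1) negInd_mem x
  obtain ⟨b0, b1⟩ := classRatio_mem (s := Finset.Icc 1 m) (G := fun z : X × Bool => h w z.1)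
    (J := posInd) (fun z => hA.score_mem w z.1) posInd_mem x
  rw [classRatioGap, abs_le]
  constructor <;> linarith

theorem Assumptions.abs_dualEstimate_le (hA : Assumptions p Gh Lh L1 μ Δ₀ h P) (m : ℕ)
    (v : Primal d) (z : ℕ → Fin K → X × Bool) : |dualEstimate h m v z| ≤ 1 :=
  abs_average_le zero_le_one fun _ => hA.abs_classRatioGap_le m _ _

theorem Assumptions.measurable_classRatioGap (hA : Assumptions p Gh Lh L1 μ Δ₀ h P) (m : ℕ)
    {Ω : Type*} {_ : MeasurableSpace Ω} {w : Ω → Weights d} (hw : Measurable w)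
    {x : ℕ → Ω → X × Bool} (hx : ∀ i, Measurable (x i)) :
    Measurable fun ω => classRatioGap h m (w ω) fun i => x i ω := by
  have hs : ∀ i, Measurable fun ω => h (w ω) (x i ω).1 := fun i =>
    hA.measurable_score_uncurry.comp (hw.prodMk (measurable_fst.comp (hx i)))
  have key : ∀ J : X × Bool → ℝ, Measurable J → Measurable fun ω =>
      (∑ i ∈ Finset.Icc 1 m, h (w ω) (x i ω).1 * J (x i ω))
        / (∑ i ∈ Finset.Icc 1 m, J (x i ω)) := fun J hJ =>
    (Finset.measurable_sum _ fun i _ => (hs i).mul (hJ.comp (hx i))).div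
      (Finset.measurable_sum _ fun i _ => hJ.comp (hx i))
  exact (key _ measurable_negInd).sub (key _ measurable_posInd)

theorem Assumptions.measurable_dualEstimate (hA : Assumptions p Gh Lh L1 μ Δ₀ h P) (m : ℕ)
    {Ω : Type*} {_ : MeasurableSpace Ω} {v : Ω → Primal d} (hv : Measurable v)
    {z : ℕ → Fin K → Ω → X × Bool} (hz : ∀ i k, Measurable (z i k)) :
    Measurable fun ω => dualEstimate h m (v ω) fun i k => z i k ω := by
  simp only [dualEstimate_eq]
  exact (Finset.measurable_sum _ fun k _ => hA.measurable_classRatioGap m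
    (measurable_wPart.comp hv) fun i => hz i k).const_mul (1 / (K : ℝ))

variable [∀ k, IsProbabilityMeasure (P k)]
  {Ω : Type*} {mΩ : MeasurableSpace Ω} {Pr : Measure Ω} [IsProbabilityMeasure Pr]
  {z : ℕ → Fin K → Ω → X × Bool}

theorem Assumptions.classSample_neg (hA : Assumptions p Gh Lh L1 μ Δ₀ h P)
    (hp1 : p < 1) (hz : ∀ i k, Measurable (z i k))
    (hlaw : ∀ i k, Pr.map (z i k) = P k)
    (hind : iIndepFun (fun j : ℕ × Fin K => z j.1 j.2) Pr) (w : Weights d) (k : Fin K) :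
    ClassSample Pr (P k) (fun i => z i k) (fun y => h w y.1) negInd (negMean p h (P k) w)
      (1 - p) where
  measurable_sample i := hz i k
  law i := hlaw i k
  indep := hind.precomp (g := fun i => (i, k)) fun i j hij => congrArg Prod.fst hij
  measurable_score := (hA.measurable_score w).comp measurable_fst
  measurable_ind := measurable_negInd
  score_mem y := hA.score_mem w y.1
  ind_mem := negInd_mem
  mean_mem := hA.negMean_mem hp1 k w
  mean_eq := by
    simp only [sub_mul]
    rw [integral_sub (hA.integrable_score_negInd k w) ((integrable_negInd k).const_mul _),
      integral_const_mul, hA.integral_negInd, integral_score_negInd hp1]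
    ring
  prob_eq := hA.integral_negInd k

theorem Assumptions.classSample_pos (hA : Assumptions p Gh Lh L1 μ Δ₀ h P)
    (hp0 : 0 < p) (hz : ∀ i k, Measurable (z i k))
    (hlaw : ∀ i k, Pr.map (z i k) = P k)
    (hind : iIndepFun (fun j : ℕ × Fin K => z j.1 j.2) Pr) (w : Weights d) (k : Fin K) :
    ClassSample Pr (P k) (fun i => z i k) (fun y => h w y.1) posInd (posMean p h (P k) w)
      p where
  measurable_sample i := hz i k
  law i := hlaw i k
  indep := hind.precomp (g := fun i => (i, k)) fun i j hij => congrArg Prod.fst hij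
  measurable_score := (hA.measurable_score w).comp measurable_fst
  measurable_ind := measurable_posInd
  score_mem y := hA.score_mem w y.1
  ind_mem := posInd_mem
  mean_mem := hA.posMean_mem hp0 k w
  mean_eq := by
    simp only [sub_mul]
    rw [integral_sub (hA.integrable_score_posInd k w) ((integrable_posInd k).const_mul _),
      integral_const_mul, hA.integral_posInd, integral_score_posInd hp0]
    ring
  prob_eq := hA.integral_posInd k

/-- Mean and second moment of the error of the class gap on one machine. -/
theorem Assumptions.integral_classRatioGap_sub (hA : Assumptions p Gh Lh L1 μ Δ₀ h P)
    (hp0 : 0 < p) (hp1 : p < 1) (hz : ∀ i k, Measurable (z i k))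
    (hlaw : ∀ i k, Pr.map (z i k) = P k)
    (hind : iIndepFun (fun j : ℕ × Fin K => z j.1 j.2) Pr) (w : Weights d) (k : Fin K)
    {m : ℕ} (hm : 1 ≤ m) :
    |∫ ω, (classRatioGap h m w (fun i => z i k ω) - classGap p h (P k) w) ∂Pr|
        ≤ 2 * max p (1 - p) ^ m ∧
      ∫ ω, (classRatioGap h m w (fun i => z i k ω) - classGap p h (P k) w) ^ 2 ∂Pr
        ≤ 32 / (m * (p * (1 - p)) ^ 2) := by
  have hN := hA.classSample_neg hp1 hz hlaw hind w k
  have hP := hA.classSample_pos hp0 hz hlaw hind w k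
  have hNB := (hN.bddMeas_ratio (Finset.Icc 1 m)).sub (BddMeas.const (negMean p h (P k) w))
  have hPB := (hP.bddMeas_ratio (Finset.Icc 1 m)).sub (BddMeas.const (posMean p h (P k) w))
  have n1 := hN.abs_integral_ratio_sub_le (Finset.Icc 1 m)
  have p1 := hP.abs_integral_ratio_sub_le (Finset.Icc 1 m)
  have hcard : 0 < (Finset.Icc 1 m).card := by simp; omega
  have n2 := hN.integral_ratio_sub_sq_le (by linarith) hcard
  have p2 := hP.integral_ratio_sub_sq_le hp0 hcard
  rw [Nat.card_Icc, add_tsub_cancel_right] at n1 p1 n2 p2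
  have e : ∀ ω, classRatioGap h m w (fun i => z i k ω) - classGap p h (P k) w
      = ((∑ i ∈ Finset.Icc 1 m, h w (z i k ω).1 * negInd (z i k ω))
          / (∑ i ∈ Finset.Icc 1 m, negInd (z i k ω)) - negMean p h (P k) w)
        - ((∑ i ∈ Finset.Icc 1 m, h w (z i k ω).1 * posInd (z i k ω))
          / (∑ i ∈ Finset.Icc 1 m, posInd (z i k ω)) - posMean p h (P k) w) := fun ω => by
    rw [classRatioGap, classGap]; ring
  simp only [e]
  have hm0 : (0 : ℝ) < m := by exact_mod_cast hm
  have hq : 0 < 1 - p := by linarith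
  constructor
  · rw [integral_sub hNB.integrable hPB.integrable]
    refine (abs_sub _ _).trans ?_
    rw [sub_sub_cancel, abs_of_pos hp0] at n1
    rw [abs_of_pos hq] at p1
    have h1 := pow_le_pow_left₀ hp0.le (le_max_left p (1 - p)) m
    have h2 := pow_le_pow_left₀ hq.le (le_max_right p (1 - p)) m
    linarith
  · have i1 := (hNB.sq.const_mul 2).integrable (Pr := Pr)
    have i2 := (hPB.sq.const_mul 2).integrable (Pr := Pr)
    refine (integral_mono (hNB.sub hPB).sq.integrable (i1.add i2) fun ω => ?_).trans ?_
    · have : ∀ x y : ℝ, (x - y) ^ 2 ≤ 2 * x ^ 2 + 2 * y ^ 2 := fun x y => by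
        nlinarith [sq_nonneg (x + y)]
      exact this _ _
    · simp only [Pi.add_apply]
      rw [integral_add i1 i2, integral_const_mul, integral_const_mul]
      have f1 : 8 / (m * (1 - p) ^ 2) ≤ 8 / (m * (p * (1 - p)) ^ 2) := by
        refine div_le_div_of_nonneg_left (by norm_num) (by positivity) ?_
        refine mul_le_mul_of_nonneg_left ?_ hm0.le
        exact pow_le_pow_left₀ (by positivity) (mul_le_of_le_one_left hq.le hp1.le) 2
      have f2 : 8 / (m * p ^ 2) ≤ 8 / (m * (p * (1 - p)) ^ 2) := by
        refine div_le_div_of_nonneg_left (by norm_num) (by positivity) ?_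
        refine mul_le_mul_of_nonneg_left ?_ hm0.le
        exact pow_le_pow_left₀ (by positivity) (mul_le_of_le_one_right hp0.le (by linarith)) 2
      have f3 : 32 / (m * (p * (1 - p)) ^ 2) = 4 * (8 / (m * (p * (1 - p)) ^ 2)) := by ring
      linarith

/-- The error of the dual estimate at a deterministic point. -/
theorem Assumptions.integral_dualEstimate_sub_sq_le (hA : Assumptions p Gh Lh L1 μ Δ₀ h P)
    (hK : 0 < K) (hp0 : 0 < p) (hp1 : p < 1) (hz : ∀ i k, Measurable (z i k))
    (hlaw : ∀ i k, Pr.map (z i k) = P k)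
    (hind : iIndepFun (fun j : ℕ × Fin K => z j.1 j.2) Pr) (v : Primal d)
    {m : ℕ} (hm : 1 ≤ m) :
    ∫ ω, (dualEstimate h m v (fun i k => z i k ω) - dualOpt p h P (wPart v)) ^ 2 ∂Pr
      ≤ 32 / (K * (m * (p * (1 - p)) ^ 2)) + 4 * (max p (1 - p) ^ m) ^ 2 := by
  have hK' : (0 : ℝ) < K := by exact_mod_cast hK
  have hY := hA.integral_classRatioGap_sub hp0 hp1 hz hlaw hind (wPart v) (m := m)
  have hYB : ∀ k, BddMeas fun ω => classRatioGap h m (wPart v) (fun i => z i k ω)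
      - classGap p h (P k) (wPart v) := fun k => BddMeas.sub
    ⟨hA.measurable_classRatioGap m measurable_const fun i => hz i k, 1,
      fun ω => hA.abs_classRatioGap_le m _ _⟩ (BddMeas.const _)
  have e : ∀ ω, dualEstimate h m v (fun i k => z i k ω) - dualOpt p h P (wPart v)
      = 1 / (K : ℝ) * ∑ k, (classRatioGap h m (wPart v) (fun i => z i k ω)
        - classGap p h (P k) (wPart v)) := fun ω => by
    rw [dualEstimate_eq, dualOpt, Finset.sum_sub_distrib, mul_sub]
  simp only [e]
  have hindep : ∀ k l : Fin K, k ≠ l → IndepFun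
      (fun ω => classRatioGap h m (wPart v) (fun i => z i k ω) - classGap p h (P k) (wPart v))
      (fun ω => classRatioGap h m (wPart v) (fun i => z i l ω) - classGap p h (P l) (wPart v))
      Pr := by
    intro k l hkl
    -- Group the samples by machine: disjoint index sets generate independent σ-algebras.
    have h1 := indep_iSup_of_disjoint (m := fun j : ℕ × Fin K =>
      MeasurableSpace.comap (z j.1 j.2) inferInstance) (fun j => (hz j.1 j.2).comap_le)
      hind.iIndep (S := {j | j.2 = k}) (T := {j | j.2 = l})
      (Set.disjoint_left.mpr fun j hj hj' => hkl (hj.symm.trans hj'))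
    have h2 : ∀ k : Fin K, Measurable[⨆ j ∈ {j : ℕ × Fin K | j.2 = k},
        MeasurableSpace.comap (z j.1 j.2) inferInstance]
        (fun ω => classRatioGap h m (wPart v) (fun i => z i k ω)
          - classGap p h (P k) (wPart v)) := fun k =>
      (hA.measurable_classRatioGap m measurable_const fun i =>
        (comap_measurable (z i k)).mono
          (le_iSup₂_of_le (i, k) rfl le_rfl) le_rfl).sub measurable_const
    rw [IndepFun_iff_Indep]
    exact indep_of_indep_of_le_right (indep_of_indep_of_le_left h1 (h2 k).comap_le) (h2 l).comap_le
  generalize hYd : (fun k ω => classRatioGap h m (wPart v) (fun i => z i k ω)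
        - classGap p h (P k) (wPart v)) = Y at *
  have hYd' : ∀ k ω, classRatioGap h m (wPart v) (fun i => z i k ω)
        - classGap p h (P k) (wPart v) = Y k ω := fun k ω => congrFun (congrFun hYd k) ω
  simp only [hYd'] at *
  have hSB : BddMeas fun ω => ∑ k, Y k ω := BddMeas.sum fun k _ => hYB k
  -- Variance and mean are treated separately: averaging over K machines divides the variance by K
  -- but leaves the bias, which must be small by itself.
  have hvar : variance (fun ω => ∑ k, Y k ω) Pr ≤ K * (32 / (m * (p * (1 - p)) ^ 2)) := by
    have h1 := IndepFun.variance_sum (μ := Pr) (X := Y) (s := Finset.univ)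
      (fun k _ => ClassSample.memLp_of_bddMeas (hYB k)) (fun k _ l _ hkl => hindep k l hkl)
    have e2 : (∑ k, Y k) = fun ω => ∑ k, Y k ω := by funext ω; simp
    rw [e2] at h1
    rw [h1]
    refine (Finset.sum_le_sum fun k _ => (variance_le_expectation_sq
      (hYB k).measurable.aestronglyMeasurable).trans (hY k hm).2).trans_eq (by simp)
  have hmean : |∫ ω, ∑ k, Y k ω ∂Pr| ≤ K * (2 * max p (1 - p) ^ m) := by
    rw [integral_finsetSum _ fun k _ => (hYB k).integrable]
    refine (Finset.abs_sum_le_sum_abs _ _).trans ?_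
    refine (Finset.sum_le_sum fun k _ => (hY k hm).1).trans_eq (by simp)
  have hsq : ∫ ω, (∑ k, Y k ω) ^ 2 ∂Pr
      ≤ K * (32 / (m * (p * (1 - p)) ^ 2)) + (K * (2 * max p (1 - p) ^ m)) ^ 2 := by
    have h1 := variance_eq_sub (ClassSample.memLp_of_bddMeas (Pr := Pr) hSB)
    have h2 := sq_le_sq' (by linarith [neg_abs_le (∫ ω, ∑ k, Y k ω ∂Pr)])
      ((le_abs_self _).trans hmean)
    simp only [Pi.pow_apply] at h1
    linarith
  have e3 : ∀ ω, (1 / (K : ℝ) * ∑ k, Y k ω) ^ 2 = (1 / (K : ℝ)) ^ 2 * (∑ k, Y k ω) ^ 2 :=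
    fun ω => mul_pow _ _ _
  simp only [e3]
  rw [integral_const_mul]
  refine (mul_le_mul_of_nonneg_left hsq (by positivity)).trans_eq ?_
  have hm0 : (0 : ℝ) < m := by exact_mod_cast hm
  field_simp
  ring

/-- A bound uniform over deterministic points transfers to an independent random point. -/
theorem integral_indepFun_le {U V : Type*} [MeasurableSpace U] [MeasurableSpace V]
    {u : Ω → U} {y : Ω → V} (hu : Measurable u) (hy : Measurable y)
    (huy : IndepFun u y Pr) {Φ : U × V → ℝ} (hΦ : Measurable Φ) {B : ℝ} (hB : ∀ q, ‖Φ q‖ ≤ B)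
    {C : ℝ} (hC : 0 ≤ C) (hΦC : ∀ x, ∫ ω, Φ (x, y ω) ∂Pr ≤ C) :
    ∫ ω, Φ (u ω, y ω) ∂Pr ≤ C := by
  have hi : BddMeas fun ω => Φ (u ω, y ω) := ⟨hΦ.comp (hu.prodMk hy), B, fun ω => hB _⟩
  rw [integral_indepFun hu hy huy hΦ hi.integrable]
  have h2 : ∀ x, ∫ b, Φ (x, b) ∂(Pr.map y) ≤ C := fun x => by
    have hx : Measurable fun b => Φ (x, b) := hΦ.comp measurable_prodMk_left
    rw [integral_map hy.aemeasurable hx.aestronglyMeasurable]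
    exact hΦC x
  -- Integrability of the inner integral need not be proved: otherwise its Bochner integral is 0 by
  -- convention, and 0 ≤ C.
  by_cases hI : Integrable (fun ω => ∫ b, Φ (u ω, b) ∂(Pr.map y)) Pr
  · exact (integral_mono hI (integrable_const C) fun ω => h2 (u ω)).trans (by simp)
  · rw [integral_undef hI]
    exact hC

/-- The error of the dual estimate at a random point that is independent of the minibatches. -/
theorem Assumptions.integral_dualEstimate_indep_le (hA : Assumptions p Gh Lh L1 μ Δ₀ h P)
    (hK : 0 < K) (hp0 : 0 < p) (hp1 : p < 1) (hz : ∀ i k, Measurable (z i k))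
    (hlaw : ∀ i k, Pr.map (z i k) = P k)
    (hind : iIndepFun (fun j : ℕ × Fin K => z j.1 j.2) Pr) {v : Ω → Primal d} (hv : Measurable v)
    (hvz : IndepFun v (fun ω i k => z i k ω) Pr)
    {m : ℕ} (hm : 1 ≤ m) :
    ∫ ω, (dualEstimate h m (v ω) (fun i k => z i k ω) - dualOpt p h P (wPart (v ω))) ^ 2 ∂Pr
      ≤ 32 / (K * (m * (p * (1 - p)) ^ 2)) + 4 * (max p (1 - p) ^ m) ^ 2 := by
  have hzm : Measurable fun ω i k => z i k ω :=
    measurable_pi_lambda _ fun i => measurable_pi_lambda _ fun k => hz i k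
  have hΦ : Measurable fun q : Primal d × (ℕ → Fin K → X × Bool) =>
      (dualEstimate h m q.1 q.2 - dualOpt p h P (wPart q.1)) ^ 2 :=
    ((hA.measurable_dualEstimate m measurable_fst
      (z := fun i k (q : Primal d × (ℕ → Fin K → X × Bool)) => q.2 i k) fun i k =>
      (measurable_pi_apply k).comp ((measurable_pi_apply i).comp measurable_snd)).sub
      (hA.measurable_dualOpt.comp (measurable_wPart.comp measurable_fst))).pow_const 2
  have hb : ∀ (v : Primal d) (z : ℕ → Fin K → X × Bool),
      ‖(dualEstimate h m v z - dualOpt p h P (wPart v)) ^ 2‖ ≤ 2 ^ 2 := fun v z => by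
    rw [norm_pow, Real.norm_eq_abs]
    refine pow_le_pow_left₀ (abs_nonneg _) ((abs_sub _ _).trans ?_) 2
    linarith [hA.abs_dualEstimate_le m v z, hA.abs_dualOpt_le hp0 hp1 (wPart v)]
  exact integral_indepFun_le hv hzm hvz (Φ := fun q : Primal d × (ℕ → Fin K → X × Bool) =>
    (dualEstimate h m q.1 q.2 - dualOpt p h P (wPart q.1)) ^ 2) hΦ (fun q => hb q.1 q.2)
    (by positivity) fun v => hA.integral_dualEstimate_sub_sq_le hK hp0 hp1 hz hlaw hind v hm

end dualEstimate

/-! ### The stages of CoDA -/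

section outer

variable {d K : ℕ} {X : Type*} [MeasurableSpace X]
  {p Gh Lh L1 μ Δ₀ : ℝ} {h : Weights d → X → ℝ} {P : Fin K → Measure (X × Bool)}

theorem zero_mem_unitBox : (0 : Primal d) ∈ unitBox d := by
  simp [unitBox, aPart, bPart]

theorem Assumptions.coda_mem (hA : Assumptions p Gh Lh L1 μ Δ₀ h P) (hK : 0 < K)
    (hp0 : 0 < p) (hp1 : p < 1) (hGh : 0 ≤ Gh) {γ : ℝ} (hγ : 0 < γ) {η : ℕ → ℝ} {T I m : ℕ → ℕ}
    (hη : ∀ s, 1 ≤ s → 0 < η s) (hη1 : ∀ s, 1 ≤ s → η s ≤ 1 / 2) (hT : ∀ s, 1 ≤ s → 1 ≤ T s)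
    (train mini : ℕ → ℕ → Fin K → X × Bool) (s : ℕ) :
    (coda p h γ η T I m train mini s).1 ∈ unitBox d ∧
      |(coda p h γ η T I m train mini s).2| ≤ dualBound p := by
  have hd := one_le_dualBound hp0 hp1
  induction s with
  | zero =>
    refine ⟨zero_mem_unitBox, ?_⟩
    simp only [coda, abs_zero]
    linarith
  | succ s ih =>
    exact ⟨hA.dsgOutput_mem hK hp0 hp1 hGh hγ (hη _ (by omega)) (hη1 _ (by omega))
      (hT _ (by omega)) _ ih.1 ih.2 _, (hA.abs_dualEstimate_le _ _ _).trans hd⟩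

theorem Assumptions.measurable_coda (hA : Assumptions p Gh Lh L1 μ Δ₀ h P)
    {Ω : Type*} {mΩ : MeasurableSpace Ω} (γ : ℝ) (η : ℕ → ℝ) (T I m : ℕ → ℕ)
    {train mini : ℕ → ℕ → Fin K → Ω → X × Bool} (s : ℕ)
    (ht : ∀ r ≤ s, ∀ t k, Measurable (train r t k))
    (hm : ∀ r ≤ s, ∀ i k, Measurable (mini r i k)) :
    (Measurable fun ω => (coda p h γ η T I m (fun s t k => train s t k ω)
      (fun s i k => mini s i k ω) s).1) ∧
    Measurable fun ω => (coda p h γ η T I m (fun s t k => train s t k ω)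
      (fun s i k => mini s i k ω) s).2 := by
  induction s with
  | zero => exact ⟨measurable_const, measurable_const⟩
  | succ s ih =>
    obtain ⟨h1, h2⟩ := ih (fun r hr => ht r (by omega)) (fun r hr => hm r (by omega))
    have h3 := hA.measurable_dsgOutput γ (η (s + 1)) (T (s + 1)) (I (s + 1)) h1 h2
      (z := train (s + 1)) (ht (s + 1) le_rfl)
    exact ⟨h3, hA.measurable_dualEstimate (m (s + 1)) h3 (hm (s + 1) le_rfl)⟩

/-- The primal output of stage s+1 is formed before the minibatch of that stage is drawn; hence
minibatches only up to s are required. -/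
theorem Assumptions.measurable_coda_succ (hA : Assumptions p Gh Lh L1 μ Δ₀ h P)
    {Ω : Type*} {mΩ : MeasurableSpace Ω} (γ : ℝ) (η : ℕ → ℝ) (T I m : ℕ → ℕ)
    {train mini : ℕ → ℕ → Fin K → Ω → X × Bool} (s : ℕ)
    (ht : ∀ r ≤ s + 1, ∀ t k, Measurable (train r t k))
    (hm : ∀ r ≤ s, ∀ i k, Measurable (mini r i k)) :
    Measurable fun ω => (coda p h γ η T I m (fun s t k => train s t k ω)
      (fun s i k => mini s i k ω) (s + 1)).1 := by
  obtain ⟨h1, h2⟩ := hA.measurable_coda γ η T I m s (fun r hr => ht r (by omega)) hm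
  exact hA.measurable_dsgOutput γ (η (s + 1)) (T (s + 1)) (I (s + 1)) h1 h2
    (z := train (s + 1)) (ht (s + 1) le_rfl)

theorem measurable_tuple {Ω : Type*} {mΩ : MeasurableSpace Ω} {z : ℕ → Fin K → Ω → X × Bool}
    (hz : ∀ i k, Measurable (z i k)) : Measurable fun ω i k => z i k ω :=
  measurable_pi_lambda _ fun i => measurable_pi_lambda _ fun k => hz i k

section sampling

variable {Ω : Type*} {mΩ : MeasurableSpace Ω} {Pr : Measure Ω}
  {train mini : ℕ → ℕ → Fin K → Ω → X × Bool}

/-- All samples, indexed by one type. -/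
def allSamples (train mini : ℕ → ℕ → Fin K → Ω → X × Bool) :
    (ℕ × ℕ × Fin K) ⊕ (ℕ × ℕ × Fin K) → Ω → X × Bool :=
  Sum.elim (fun j => train j.1 j.2.1 j.2.2) (fun j => mini j.1 j.2.1 j.2.2)

/-- The σ-algebra generated by the samples with indices in `S`. -/
abbrev sampleAlgebra (train mini : ℕ → ℕ → Fin K → Ω → X × Bool)
    (S : Set ((ℕ × ℕ × Fin K) ⊕ (ℕ × ℕ × Fin K))) : MeasurableSpace Ω :=
  ⨆ j ∈ S, MeasurableSpace.comap (allSamples train mini j) inferInstance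

theorem measurable_sampleAlgebra {S : Set ((ℕ × ℕ × Fin K) ⊕ (ℕ × ℕ × Fin K))} {j} (hj : j ∈ S) :
    Measurable[sampleAlgebra train mini S] (allSamples train mini j) :=
  (comap_measurable _).mono
    (le_iSup₂_of_le (f := fun j (_ : j ∈ S) =>
      MeasurableSpace.comap (allSamples train mini j) inferInstance) j hj le_rfl) le_rfl

theorem IsSampling.measurable_allSamples (hs : IsSampling Pr P train mini) (j) :
    Measurable (allSamples train mini j) := by
  rcases j with j | j
  · exact hs.measurable_train _ _ _
  · exact hs.measurable_mini _ _ _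

theorem IsSampling.sampleAlgebra_le (hs : IsSampling Pr P train mini) (S) :
    sampleAlgebra train mini S ≤ mΩ :=
  iSup₂_le fun j _ => (hs.measurable_allSamples j).comap_le

theorem IsSampling.indep_sampleAlgebra (hs : IsSampling Pr P train mini) {S T}
    (hST : Disjoint S T) :
    Indep (sampleAlgebra train mini S) (sampleAlgebra train mini T) Pr :=
  indep_iSup_of_disjoint (fun j => (hs.measurable_allSamples j).comap_le) hs.indep.iIndep hST

/-- The witnessing σ-algebra is generated by all samples except one, future ones included; mutual
independence makes a filtration unnecessary. -/
theorem IsSampling.freshSamples (hs : IsSampling Pr P train mini)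
    (hA : Assumptions p Gh Lh L1 μ Δ₀ h P) (γ : ℝ) (η : ℕ → ℝ) (T I m : ℕ → ℕ) (s : ℕ) :
    FreshSamples Pr P
      (fun ω => (coda p h γ η T I m (fun s t k => train s t k ω) (fun s i k => mini s i k ω) s).1)
      (fun ω => (coda p h γ η T I m (fun s t k => train s t k ω) (fun s i k => mini s i k ω) s).2)
      (train (s + 1)) where
  measurable_primal := (hA.measurable_coda γ η T I m s (fun r _ => hs.measurable_train r)
    fun r _ => hs.measurable_mini r).1
  measurable_dual := (hA.measurable_coda γ η T I m s (fun r _ => hs.measurable_train r)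
    fun r _ => hs.measurable_mini r).2
  measurable_sample := hs.measurable_train _
  law := hs.law_train _
  fresh t k := by
    have ht : ∀ r t' k', (r, t', k') ≠ (s + 1, t, k) →
        Measurable[sampleAlgebra train mini {Sum.inl (s + 1, t, k)}ᶜ] (train r t' k') :=
      fun r t' k' hne => measurable_sampleAlgebra (j := Sum.inl (r, t', k'))
        fun hm => hne (Sum.inl_injective hm)
    have hm : ∀ r i k', Measurable[sampleAlgebra train mini {Sum.inl (s + 1, t, k)}ᶜ]
        (mini r i k') := fun r i k' => measurable_sampleAlgebra (j := Sum.inr (r, i, k')) (by simp)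
    have hc := hA.measurable_coda (mΩ := sampleAlgebra train mini {Sum.inl (s + 1, t, k)}ᶜ)
      γ η T I m s (train := train) (mini := mini)
      (fun r hr t' k' => ht r t' k' fun he => by
        have := congrArg Prod.fst he
        simp only at this
        omega) fun r _ => hm r
    refine ⟨_, hs.sampleAlgebra_le _, hc.1, hc.2,
      fun t' k' hne => ht _ t' k' fun he => hne (congrArg Prod.snd he), ?_⟩
    refine indep_of_indep_of_le_right (hs.indep_sampleAlgebra (disjoint_compl_left
      (a := {Sum.inl (s + 1, t, k)}))) ?_
    exact (measurable_sampleAlgebra (train := train) (mini := mini)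
      (Set.mem_singleton (Sum.inl (s + 1, t, k)))).comap_le

theorem IsSampling.indepFun_mini (hs : IsSampling Pr P train mini)
    (hA : Assumptions p Gh Lh L1 μ Δ₀ h P) (γ : ℝ) (η : ℕ → ℝ) (T I m : ℕ → ℕ) (s : ℕ) :
    IndepFun (fun ω => (coda p h γ η T I m (fun s t k => train s t k ω)
      (fun s i k => mini s i k ω) (s + 1)).1) (fun ω i k => mini (s + 1) i k ω) Pr := by
  rw [IndepFun_iff_Indep]
  have h1 := hs.indep_sampleAlgebra (disjoint_compl_left
    (a := {j | ∃ i k, j = Sum.inr (s + 1, i, k)}))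
  refine indep_of_indep_of_le_left (indep_of_indep_of_le_right h1 ?_) ?_
  · refine Measurable.comap_le (m₁ := sampleAlgebra train mini _) ?_
    refine measurable_tuple (mΩ := sampleAlgebra train mini _) fun i k => ?_
    exact measurable_sampleAlgebra (j := Sum.inr (s + 1, i, k)) ⟨i, k, rfl⟩
  · refine Measurable.comap_le (m₁ := sampleAlgebra train mini _) ?_
    refine hA.measurable_coda_succ (mΩ := sampleAlgebra train mini _) γ η T I m s
      (train := train) (mini := mini) (fun r _ t k => ?_) fun r hr i k => ?_
    · exact measurable_sampleAlgebra (j := Sum.inl (r, t, k)) (by simp)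
    · refine measurable_sampleAlgebra (j := Sum.inr (r, i, k)) ?_
      simp
      omega

theorem IsSampling.iIndepFun_mini (hs : IsSampling Pr P train mini) (s : ℕ) :
    iIndepFun (fun j : ℕ × Fin K => mini s j.1 j.2) Pr :=
  hs.indep.precomp (g := fun j : ℕ × Fin K => Sum.inr (s, j.1, j.2)) fun i j hij => by
    simpa [Prod.ext_iff] using hij

end sampling

variable [∀ k, IsProbabilityMeasure (P k)]
  {Ω : Type*} {mΩ : MeasurableSpace Ω} {Pr : Measure Ω} [IsProbabilityMeasure Pr]
  {train mini : ℕ → ℕ → Fin K → Ω → X × Bool}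

/-- The parameters of CoDA satisfy the requirements of the analysis of one stage. -/
structure GoodSchedule (p Gh Lh L1 : ℝ) (K : ℕ) (γ : ℝ) (η : ℕ → ℝ) (T I m : ℕ → ℕ) : Prop where
  gamma_pos : 0 < γ
  step_pos : ∀ s, 1 ≤ s → 0 < η s
  step_le : ∀ s, 1 ≤ s → η s ≤ 1 / 2
  period_pos : ∀ s, 1 ≤ s → 1 ≤ I s
  period_le : ∀ s, 1 ≤ s → (((I s : ℝ) - 1) * η s) ^ 2 ≤ η s / K
  length_ge : ∀ s, 1 ≤ s → 16 * γ ≤ η s * T s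
  length_le : ∀ s, 1 ≤ s → η s * T s ≤ 1
  batch_pos : ∀ s, 1 ≤ s → 1 ≤ m s
  bias_le : 960 * γ ^ 2 * biasCoef p Gh Lh ≤ 1
  smooth_le : 32 * L1 * γ ≤ 1

theorem GoodSchedule.length_pos {γ : ℝ} {η : ℕ → ℝ} {T I m : ℕ → ℕ}
    (hg : GoodSchedule p Gh Lh L1 K γ η T I m) (s : ℕ) (hs : 1 ≤ s) : 1 ≤ T s := by
  by_contra hneg
  have : T s = 0 := by omega
  have h1 := hg.length_ge s hs
  rw [this] at h1
  have := hg.gamma_pos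
  norm_num at h1
  linarith

/-- The expected optimality gap after `s` stages. -/
def expGap (p : ℝ) (h : Weights d → X → ℝ) (P : Fin K → Measure (X × Bool)) (Pr : Measure Ω)
    (it : Ω → Primal d × ℝ) : ℝ :=
  ∫ ω, (phi p h P (it ω).1 - phiStar p h P) ∂Pr

/-- The expected squared error of the dual variable. -/
def expDualError (p : ℝ) (h : Weights d → X → ℝ) (P : Fin K → Measure (X × Bool)) (Pr : Measure Ω)
    (it : Ω → Primal d × ℝ) : ℝ :=
  ∫ ω, ((it ω).2 - dualOpt p h P (wPart (it ω).1)) ^ 2 ∂Pr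

theorem Assumptions.bddMeas_phi_sub (hA : Assumptions p Gh Lh L1 μ Δ₀ h P) (hK : 0 < K)
    (hp0 : 0 < p) (hp1 : p < 1) {u : Ω → Primal d} (hu : Measurable u)
    (hub : ∀ ω, u ω ∈ unitBox d) : BddMeas fun ω => phi p h P (u ω) - phiStar p h P :=
  BddMeas.sub ⟨(hA.measurable_phi hK hp0 hp1).comp hu, 9, fun ω =>
      hA.abs_phi_le hK hp0 hp1 (unitBox_subset_box d (hub ω))⟩ (BddMeas.const _)

/-- `stage_bound` together with the PL inequality, which turns -(3/4)γ‖∇φ‖² into -(3/2)γμ times the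
gap. -/
theorem Assumptions.expGap_succ_le (hA : Assumptions p Gh Lh L1 μ Δ₀ h P) (hK : 0 < K)
    (hp0 : 0 < p) (hp1 : p < 1) (hGh : 0 ≤ Gh) (hLh : 0 ≤ Lh) (hL1 : 0 ≤ L1)
    {γ : ℝ} {η : ℕ → ℝ} {T I m : ℕ → ℕ}
    (hg : GoodSchedule p Gh Lh L1 K γ η T I m) (hs : IsSampling Pr P train mini) (s : ℕ) :
    expGap p h P Pr (fun ω => coda p h γ η T I m (fun s t k => train s t k ω)
        (fun s i k => mini s i k ω) (s + 1))
      ≤ (1 - 3 / 2 * γ * μ) * expGap p h P Pr (fun ω => coda p h γ η T I m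
          (fun s t k => train s t k ω) (fun s i k => mini s i k ω) s)
        + 20 * dualCoef p Gh Lh * γ * expDualError p h P Pr (fun ω => coda p h γ η T I m
          (fun s t k => train s t k ω) (fun s i k => mini s i k ω) s)
        + stageNoise p Gh Lh γ * (η (s + 1) / K) := by
  have hmem := fun s ω => hA.coda_mem (I := I) (m := m) hK hp0 hp1 hGh hg.gamma_pos hg.step_pos
    hg.step_le hg.length_pos (fun s t k => train s t k ω) (fun s i k => mini s i k ω) s
  have hfr := hs.freshSamples hA γ η T I m s
  have h1 := hA.stage_bound (I := I (s + 1)) (T := T (s + 1)) hK hp0 hp1 hGh hLh hL1 hg.gamma_pos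
    (hg.step_pos (s + 1) (by omega)) (hg.step_le _ (by omega)) (hg.period_pos _ (by omega))
    (hg.period_le _ (by omega)) (hg.length_ge _ (by omega)) (hg.length_le _ (by omega)) hg.bias_le
    hg.smooth_le (fun ω => (hmem s ω).1) (fun ω => (hmem s ω).2) hfr
  have hB0 := (hA.bddMeas_phi_sub hK hp0 hp1 hfr.measurable_primal fun ω => (hmem s ω).1)
  have hB1 := (hA.bddMeas_phi_sub hK hp0 hp1 (hs.freshSamples hA γ η T I m (s + 1)).measurable_primal
    fun ω => (hmem (s + 1) ω).1)
  have hPL : μ * expGap p h P Pr (fun ω => coda p h γ η T I m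
      (fun s t k => train s t k ω) (fun s i k => mini s i k ω) s)
      ≤ 1 / 2 * ∫ ω, ‖phiGrad p h P (coda p h γ η T I m
      (fun s t k => train s t k ω) (fun s i k => mini s i k ω) s).1‖ ^ 2 ∂Pr := by
    have hgB : BddMeas fun ω => phiGrad p h P (coda p h γ η T I m
      (fun s t k => train s t k ω) (fun s i k => mini s i k ω) s).1 :=
      ⟨hA.measurable_phiGrad.comp hfr.measurable_primal, _,
      fun ω => hA.norm_phiGrad_le hp0 hp1 hGh (unitBox_subset_box d (hmem s ω).1)⟩
    rw [expGap, ← integral_const_mul, ← integral_const_mul]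
    refine integral_mono (hB0.const_mul μ).integrable (hgB.norm_sq.const_mul (1 / 2)).integrable
      fun ω => ?_
    have := hA.phi_PL _ (unitBox_subset_box d (hmem s ω).1)
    rwa [hA.gradient_phi hK hp0 hp1 (unitBox_subset_box d (hmem s ω).1)] at this
  have e : ∀ s, expGap p h P Pr (fun ω => coda p h γ η T I m
      (fun s t k => train s t k ω) (fun s i k => mini s i k ω) s)
      = ∫ ω, phi p h P (coda p h γ η T I m
      (fun s t k => train s t k ω) (fun s i k => mini s i k ω) s).1 ∂Pr - phiStar p h P := fun s => by
    have hB : BddMeas fun ω => phi p h P (coda p h γ η T I m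
      (fun s t k => train s t k ω) (fun s i k => mini s i k ω) s).1 :=
      ⟨(hA.measurable_phi hK hp0 hp1).comp (hs.freshSamples hA γ η T I m s).measurable_primal, 9,
        fun ω => hA.abs_phi_le hK hp0 hp1 (unitBox_subset_box d (hmem s ω).1)⟩
    rw [expGap, integral_sub hB.integrable (integrable_const _)]
    simp
  have e1 := e (s + 1)
  have e0 := e s
  rw [expDualError]
  have hγ := hg.gamma_pos
  have h2 := mul_le_mul_of_nonneg_left hPL (by positivity : 0 ≤ 3 / 2 * γ)
  rw [e1]
  refine (sub_le_sub_right h1 _).trans ?_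
  rw [e0] at h2 ⊢
  linarith

theorem Assumptions.expDualError_succ_le (hA : Assumptions p Gh Lh L1 μ Δ₀ h P) (hK : 0 < K)
    (hp0 : 0 < p) (hp1 : p < 1)
    {γ : ℝ} {η : ℕ → ℝ} {T I m : ℕ → ℕ} (hs : IsSampling Pr P train mini) (s : ℕ)
    (hm : 1 ≤ m (s + 1)) :
    expDualError p h P Pr (fun ω => coda p h γ η T I m (fun s t k => train s t k ω)
        (fun s i k => mini s i k ω) (s + 1))
      ≤ 32 / (K * (m (s + 1) * (p * (1 - p)) ^ 2)) + 4 * (max p (1 - p) ^ m (s + 1)) ^ 2 :=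
  hA.integral_dualEstimate_indep_le hK hp0 hp1 (hs.measurable_mini (s + 1)) (hs.law_mini (s + 1))
    (hs.iIndepFun_mini (s + 1)) (hs.freshSamples hA γ η T I m (s + 1)).measurable_primal
    (hs.indepFun_mini hA γ η T I m s) hm

theorem Assumptions.expGap_zero (hA : Assumptions p Gh Lh L1 μ Δ₀ h P) (hK : 0 < K)
    (hp0 : 0 < p) (hp1 : p < 1) :
    0 ≤ expGap p h P Pr (fun _ => (0, 0)) ∧ expGap p h P Pr (fun _ => (0, 0)) ≤ Δ₀ ∧
      p * (1 - p) * expDualError p h P Pr (fun _ => (0, 0))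
        ≤ 2 * expGap p h P Pr (fun _ => (0, 0)) := by
  have hw : wPart (0 : Primal d) = 0 := by ext; simp [wPart]
  have h1 := hA.dualOpt_zero_sq_le hK hp0 hp1
  simp only [expGap, expDualError, integral_const, probReal_univ, one_smul, zero_sub, neg_sq, hw]
  exact ⟨sub_nonneg.mpr (hA.phiStar_le hK hp0 hp1 _), hA.init_gap, h1⟩

end outer

/-! ### The parameter schedule -/

section schedule

variable {p Gh Lh L1 μ Lv η₀ c : ℝ} {K : ℕ}

theorem rate_eq (hLv : 0 < Lv) (hμ : 0 < μ) : rate μ Lv = μ / (5 * Lv + μ) := by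
  rw [rate]
  field_simp

theorem rate_pos (hLv : 0 < Lv) (hμ : 0 < μ) : 0 < rate μ Lv := by
  rw [rate_eq hLv hμ]; positivity

theorem rate_lt_one (hLv : 0 < Lv) (hμ : 0 < μ) : rate μ Lv < 1 := by
  rw [rate_eq hLv hμ, div_lt_one (by positivity)]; linarith

theorem inv_rate (hLv : 0 < Lv) (hμ : 0 < μ) : (5 * Lv + μ) / μ = 1 / rate μ Lv := by
  rw [rate_eq hLv hμ, one_div_div]

/-- With γ = 1/(2L_v) a stage contracts by 1 - (3/4)μ/L_v; this bound makes that at most 1 - c ≤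
e^{-c}. -/
theorem rate_le (hLv : 0 < Lv) (hμ : 0 < μ) : rate μ Lv ≤ 3 / 4 * (μ / Lv) := by
  have : 0 < μ / Lv := by positivity
  rw [rate, div_le_iff₀ (by positivity)]
  nlinarith

theorem stepSize_pos (hK : 0 < K) (hη₀ : 0 < η₀) (s : ℕ) : 0 < stepSize K η₀ c s := by
  have : (0 : ℝ) < K := by exact_mod_cast hK
  rw [stepSize]; positivity

theorem stepSize_le (hη₀ : 0 < η₀) (hc : 0 ≤ c) {s : ℕ} (hs : 1 ≤ s) :
    stepSize K η₀ c s ≤ η₀ * K := by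
  have h1 : (1 : ℝ) ≤ s := by exact_mod_cast hs
  rw [stepSize]
  refine mul_le_of_le_one_right (by positivity) (Real.exp_le_one_iff.mpr ?_)
  have : 0 ≤ ((s : ℝ) - 1) * c := mul_nonneg (by linarith) hc
  linarith

/-- The noise level η_s/K is free of K and decays at the same rate as the gap, which is why the
final recursion is resonant and yields the factor S. -/
theorem stepSize_succ_div (hK : 0 < K) (s : ℕ) :
    stepSize K η₀ c (s + 1) / K = η₀ * Real.exp (-c) ^ s := by
  have : (0 : ℝ) < K := by exact_mod_cast hK
  rw [stepSize, ← Real.exp_nat_mul]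
  push_cast
  rw [show -(((s : ℝ) + 1 - 1) * c) = s * -c by ring]
  field_simp

theorem stageLength_eq (hη₀ : 0 < η₀) (s : ℕ) :
    stageLength K Gh Lv η₀ c s = ⌈max 8 (8 * Gh ^ 2) / Lv / stepSize K η₀ c s⌉₊ := by
  rw [stageLength, stepSize, Real.exp_neg]
  congr 1
  field_simp

theorem le_stepSize_mul_stageLength (hK : 0 < K) (hη₀ : 0 < η₀) (s : ℕ) :
    max 8 (8 * Gh ^ 2) / Lv ≤ stepSize K η₀ c s * stageLength K Gh Lv η₀ c s := by
  have h := stepSize_pos (c := c) hK hη₀ s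
  rw [stageLength_eq hη₀, ← div_le_iff₀' h]
  exact Nat.le_ceil _

theorem stepSize_mul_stageLength_le (hK : 0 < K) (hη₀ : 0 < η₀) (hLv : 0 < Lv) (s : ℕ) :
    stepSize K η₀ c s * stageLength K Gh Lv η₀ c s
      ≤ max 8 (8 * Gh ^ 2) / Lv + stepSize K η₀ c s := by
  have h := stepSize_pos (c := c) hK hη₀ s
  have h8 : (0 : ℝ) < max 8 (8 * Gh ^ 2) := lt_max_of_lt_left (by norm_num)
  rw [stageLength_eq hη₀, ← le_div_iff₀' h, add_div, div_self h.ne']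
  exact (Nat.ceil_lt_add_one (by positivity)).le

/-- From I - 1 ≤ 1/√(Kη): the squared drift is at most η²/(Kη) = η/K. -/
theorem commPeriod_le (hK : 0 < K) (hη₀ : 0 < η₀) (s : ℕ) :
    (((commPeriod K η₀ c s : ℝ) - 1) * stepSize K η₀ c s) ^ 2 ≤ stepSize K η₀ c s / K := by
  have h := stepSize_pos (c := c) hK hη₀ s
  have hK' : (0 : ℝ) < K := by exact_mod_cast hK
  rw [commPeriod]
  set η := stepSize K η₀ c s
  have hs : 0 < √((K : ℝ) * η) := Real.sqrt_pos.mpr (by positivity)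
  have h1 : ((max 1 ⌊1 / √((K : ℝ) * η)⌋₊ : ℕ) : ℝ) - 1 ≤ 1 / √((K : ℝ) * η) := by
    push_cast
    rw [sub_le_iff_le_add]
    have := Nat.floor_le (by positivity : 0 ≤ 1 / √((K : ℝ) * η))
    refine max_le ?_ ?_
    · have : 0 ≤ 1 / √((K : ℝ) * η) := by positivity
      linarith
    · linarith
  have h0 : 0 ≤ ((max 1 ⌊1 / √((K : ℝ) * η)⌋₊ : ℕ) : ℝ) - 1 := by
    rw [sub_nonneg]; exact_mod_cast le_max_left _ _
  rw [mul_pow]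
  refine (mul_le_mul_of_nonneg_right (pow_le_pow_left₀ h0 h1 2) (sq_nonneg η)).trans_eq ?_
  rw [div_pow, Real.sq_sqrt (by positivity)]
  field_simp

/-- The rate of decay of the probability that a minibatch misses a class. -/
def classRate (p : ℝ) : ℝ := Real.log (1 / max p (1 - p))

theorem max_class_mem (hp0 : 0 < p) (hp1 : p < 1) : 0 < max p (1 - p) ∧ max p (1 - p) < 1 :=
  ⟨lt_max_of_lt_left hp0, max_lt hp1 (by linarith)⟩

theorem classRate_pos (hp0 : 0 < p) (hp1 : p < 1) : 0 < classRate p := by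
  obtain ⟨h0, h1⟩ := max_class_mem hp0 hp1
  exact Real.log_pos ((one_lt_div h0).mpr h1)

theorem batchConst_nonneg (hp0 : 0 < p) (hp1 : p < 1) : 0 ≤ batchConst (max p (1 - p)) := by
  have h1 := (max_class_mem hp0 hp1).1
  have h2 : 0 < Real.log (1 / max p (1 - p)) := classRate_pos hp0 hp1
  rw [batchConst]
  positivity

theorem exp_neg_classRate_mul (hp0 : 0 < p) (hp1 : p < 1) (m : ℕ) :
    max p (1 - p) ^ m = Real.exp (-(m * classRate p)) := by
  have h1 := (max_class_mem hp0 hp1).1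
  rw [classRate, one_div, Real.log_inv, mul_neg, neg_neg, Real.exp_nat_mul, Real.exp_log h1]

/-- The minibatches are so large that the dual error is of the order of the noise level. -/
theorem batchSize_bound (hK : 0 < K) (hp0 : 0 < p) (hp1 : p < 1) (hη₀ : 0 < η₀) {s : ℕ}
    (hT0 : 0 < stageLength K Gh Lv η₀ c (s + 1))
    (hT1 : stepSize K η₀ c (s + 1) * stageLength K Gh Lv η₀ c (s + 1) ≤ 1) :
    1 ≤ batchSize K p Gh Lv η₀ c s ∧
      32 / (K * (batchSize K p Gh Lv η₀ c s * (p * (1 - p)) ^ 2))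
        + 4 * (max p (1 - p) ^ batchSize K p Gh Lv η₀ c s) ^ 2
      ≤ (32 + 4 / classRate p) * (stepSize K η₀ c (s + 1) / K) := by
  have hη := stepSize_pos (c := c) hK hη₀ (s + 1)
  have hK' : (0 : ℝ) < K := by exact_mod_cast hK
  have hT0' : (0 : ℝ) < stageLength K Gh Lv η₀ c (s + 1) := by exact_mod_cast hT0
  have hC := batchConst_nonneg hp0 hp1
  have hl := classRate_pos hp0 hp1
  have hle := Nat.le_ceil (max ((1 + batchConst (max p (1 - p)))
        / (stepSize K η₀ c (s + 1) ^ 2 * (stageLength K Gh Lv η₀ c (s + 1) : ℝ)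
            * p ^ 2 * (1 - p) ^ 2)) (Real.log K / Real.log (1 / max p (1 - p))))
  rw [exp_neg_classRate_mul hp0 hp1]
  rw [← batchSize, ← classRate] at hle
  generalize batchSize K p Gh Lv η₀ c s = m at *
  generalize (stageLength K Gh Lv η₀ c (s + 1) : ℝ) = T at *
  generalize stepSize K η₀ c (s + 1) = η at *
  generalize classRate p = l at *
  have hq : 0 < 1 - p := by linarith
  have hkap : p * (1 - p) ≤ 1 := by nlinarith
  have h1 := (le_max_left _ _).trans hle
  have h2 := (le_max_right _ _).trans hle
  have hm0 : (0 : ℝ) < m := lt_of_lt_of_le (by positivity) h1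
  -- From the first entry of the maximum, discarding the nonnegative batch constant and using ηT ≤
  -- 1.
  have h3 : 1 ≤ m * (η * (p * (1 - p)) ^ 2) := by
    rw [div_le_iff₀ (by positivity)] at h1
    have e1 : (m : ℝ) * (η ^ 2 * T * p ^ 2 * (1 - p) ^ 2)
        = (η * T) * (m * (η * (p * (1 - p)) ^ 2)) := by ring
    have e2 : (η * T) * (m * (η * (p * (1 - p)) ^ 2)) ≤ m * (η * (p * (1 - p)) ^ 2) :=
      mul_le_of_le_one_left (by positivity) hT1
    linarith
  -- The squared bias is split into two equal factors: the log K entry makes one of them at most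
  -- 1/K, the first entry makes the other at most η/l through e^{-x} ≤ 1/x.
  have h4 : Real.exp (-(m * l)) ≤ 1 / K := by
    rw [div_le_iff₀ hl] at h2
    rw [Real.exp_neg, one_div]
    refine inv_anti₀ hK' ?_
    calc (K : ℝ) = Real.exp (Real.log K) := (Real.exp_log hK').symm
      _ ≤ _ := Real.exp_le_exp.mpr h2
  have h5 : Real.exp (-(m * l)) ≤ η / l := by
    have e1 : m * l ≤ Real.exp (m * l) := by linarith [Real.add_one_le_exp ((m : ℝ) * l)]
    have e2 : (p * (1 - p)) ^ 2 ≤ 1 := pow_le_one₀ (by positivity) hkap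
    have e3 : 1 ≤ m * η := h3.trans (by
      rw [← mul_assoc]
      exact mul_le_of_le_one_right (by positivity) e2)
    rw [Real.exp_neg, ← one_div, div_le_div_iff₀ (Real.exp_pos _) hl, one_mul]
    nlinarith
  constructor
  · exact_mod_cast hm0
  · have h6 : 32 / (K * (m * (p * (1 - p)) ^ 2)) ≤ 32 * (η / K) := by
      rw [div_le_iff₀ (by positivity)]
      have : 32 * (η / K) * (K * (m * (p * (1 - p)) ^ 2)) = 32 * (m * (η * (p * (1 - p)) ^ 2)) := by
        field_simp
      linarith
    have h7 : Real.exp (-(m * l)) ^ 2 ≤ 1 / K * (η / l) := by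
      rw [sq]
      exact mul_le_mul h4 h5 (Real.exp_pos _).le (by positivity)
    have h8 : (32 + 4 / l) * (η / K) = 32 * (η / K) + 4 * (1 / K * (η / l)) := by
      field_simp
    linarith

/-- The smoothness parameter `L_v` with which CoDA is run. -/
def smoothConst (p Gh Lh L1 : ℝ) : ℝ :=
  16 + 16 * Gh ^ 2 + 16 * L1 + 240 * biasCoef p Gh Lh + 80 * (dualCoef p Gh Lh * dualBound p)

/-- One summand for each requirement: stage lengths with ηT ≤ 1, the descent inequality, the
bootstrap of the bias, and a coefficient of the dual error of at most p(1-p)/8. -/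
theorem smoothConst_ge (hp0 : 0 < p) (hp1 : p < 1) (hL1 : 0 ≤ L1) :
    16 + 16 * Gh ^ 2 ≤ smoothConst p Gh Lh L1 ∧ 16 * L1 ≤ smoothConst p Gh Lh L1 ∧
      240 * biasCoef p Gh Lh ≤ smoothConst p Gh Lh L1 ∧
      80 * (dualCoef p Gh Lh * dualBound p) ≤ smoothConst p Gh Lh L1 := by
  have h1 : 0 ≤ biasCoef p Gh Lh := biasCoef_nonneg
  have h2 : 0 ≤ dualCoef p Gh Lh := dualCoef_nonneg
  have h3 := one_le_dualBound hp0 hp1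
  have h4 : 0 ≤ dualCoef p Gh Lh * dualBound p := mul_nonneg h2 (by linarith)
  have h5 := sq_nonneg Gh
  rw [smoothConst]
  refine ⟨?_, ?_, ?_, ?_⟩ <;> linarith

theorem goodSchedule (hK : 0 < K) (hp0 : 0 < p) (hp1 : p < 1) (hL1 : 0 ≤ L1) (hη₀ : 0 < η₀)
    (hc : 0 ≤ c) (hη : η₀ * K ≤ 8 / smoothConst p Gh Lh L1) :
    GoodSchedule p Gh Lh L1 K (1 / (2 * smoothConst p Gh Lh L1)) (stepSize K η₀ c)
      (stageLength K Gh (smoothConst p Gh Lh L1) η₀ c) (commPeriod K η₀ c)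
      (batchSize K p Gh (smoothConst p Gh Lh L1) η₀ c) := by
  obtain ⟨l1, l2, l3, l4⟩ := smoothConst_ge (Gh := Gh) (Lh := Lh) hp0 hp1 hL1
  have hbc : 0 ≤ biasCoef p Gh Lh := biasCoef_nonneg
  generalize smoothConst p Gh Lh L1 = Lv at *
  have hLv : 16 ≤ Lv := by linarith [sq_nonneg Gh]
  have hLv0 : 0 < Lv := by linarith
  have h8 : 8 / Lv ≤ 1 / 2 := by rw [div_le_iff₀ hLv0]; linarith
  have hX : max 8 (8 * Gh ^ 2) ≤ Lv / 2 := max_le (by linarith) (by linarith [sq_nonneg Gh])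
  have hX8 : (8 : ℝ) ≤ max 8 (8 * Gh ^ 2) := le_max_left _ _
  have hge : ∀ s, 16 * (1 / (2 * Lv)) ≤ stepSize K η₀ c s * stageLength K Gh Lv η₀ c s := fun s => by
    refine le_trans ?_ (le_stepSize_mul_stageLength hK hη₀ s)
    rw [show 16 * (1 / (2 * Lv)) = 8 / Lv by field_simp; norm_num]
    exact div_le_div_of_nonneg_right hX8 hLv0.le
  have hstep : ∀ s, 1 ≤ s → stepSize K η₀ c s ≤ 1 / 2 := fun s hs =>
    ((stepSize_le hη₀ hc hs).trans hη).trans h8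
  have hle : ∀ s, 1 ≤ s → stepSize K η₀ c s * stageLength K Gh Lv η₀ c s ≤ 1 := fun s hs => by
    have h1 := stepSize_mul_stageLength_le (Gh := Gh) (c := c) hK hη₀ hLv0 s
    have h2 : max 8 (8 * Gh ^ 2) / Lv ≤ 1 / 2 := by rw [div_le_iff₀ hLv0]; linarith
    linarith [hstep s hs]
  refine ⟨by positivity, fun s _ => stepSize_pos hK hη₀ s, hstep, fun s _ => le_max_left _ _,
    fun s _ => commPeriod_le hK hη₀ s, fun s _ => hge s, hle, fun s _ => ?_, ?_, ?_⟩
  · refine (batchSize_bound hK hp0 hp1 hη₀ ?_ (hle (s + 1) (by omega))).1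
    by_contra hneg
    have h0 : stageLength K Gh Lv η₀ c (s + 1) = 0 := by omega
    have h1 := hge (s + 1)
    rw [h0, Nat.cast_zero, mul_zero] at h1
    have : 0 < 16 * (1 / (2 * Lv)) := by positivity
    linarith
  · have : 960 * (1 / (2 * Lv)) ^ 2 * biasCoef p Gh Lh = 240 * biasCoef p Gh Lh / Lv ^ 2 := by
      field_simp; ring
    rw [this, div_le_one (by positivity)]
    nlinarith
  · rw [show 32 * L1 * (1 / (2 * Lv)) = 16 * L1 / Lv by field_simp; ring, div_le_one hLv0]
    exact l2

/-- A linear recursion with a larger initial step. -/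
theorem linear_recursion_le {a : ℕ → ℝ} {E N : ℝ} (hE : 0 ≤ E)
    (h0 : a 1 ≤ (E + 1 / 4) * a 0 + N) (hs : ∀ s, 1 ≤ s → a (s + 1) ≤ E * a s + N * E ^ s) (S : ℕ) :
    a (S + 1) ≤ E ^ S * ((E + 1 / 4) * a 0 + (S + 1) * N) := by
  induction S with
  | zero => simpa using h0
  | succ S ih =>
    refine (hs (S + 1) (by omega)).trans ?_
    have := mul_le_mul_of_nonneg_left ih hE
    rw [pow_succ]
    push_cast
    linarith

end schedule

/-! ### Accuracy after sufficiently many stages -/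

section accuracy

variable {p Gh Lh L1 μ Δ₀ η₀ : ℝ}

/-- The noise constant of the outer recursion. -/
def noiseConst (p Gh Lh L1 : ℝ) : ℝ :=
  32 + 4 / classRate p + stageNoise p Gh Lh (1 / (2 * smoothConst p Gh Lh L1))

theorem noiseConst_pos (hp0 : 0 < p) (hp1 : p < 1) (hL1 : 0 ≤ L1) :
    0 < noiseConst p Gh Lh L1 := by
  obtain ⟨l1, -, -, -⟩ := smoothConst_ge (Gh := Gh) (Lh := Lh) hp0 hp1 hL1
  have hLv : 0 < smoothConst p Gh Lh L1 := by linarith [sq_nonneg Gh]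
  have h1 : 0 ≤ biasCoef p Gh Lh := biasCoef_nonneg
  have h2 : 0 ≤ driftCoef p Gh Lh := driftCoef_nonneg
  have h3 := classRate_pos hp0 hp1
  rw [noiseConst, stageNoise]
  positivity

variable {d K : ℕ} {X : Type*} [MeasurableSpace X]
  {h : Weights d → X → ℝ} {P : Fin K → Measure (X × Bool)} [∀ k, IsProbabilityMeasure (P k)]
  {Ω : Type*} {mΩ : MeasurableSpace Ω} {Pr : Measure Ω} [IsProbabilityMeasure Pr]
  {train mini : ℕ → ℕ → Fin K → Ω → X × Bool}

/-- The gap obeys a linear recursion with factor e^{-c} and inhomogeneity of order η₀e^{-cs}; the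
dual error of the minibatch is absorbed in the latter. Only the first stage differs, where the dual
error is charged to the initial gap. -/
theorem Assumptions.integral_gap_codaIterate_le (hA : Assumptions p Gh Lh L1 μ Δ₀ h P)
    (hK : 0 < K) (hp0 : 0 < p) (hp1 : p < 1) (hGh : 0 ≤ Gh) (hLh : 0 ≤ Lh) (hL1 : 0 ≤ L1)
    (hμ : 0 < μ) (hη₀ : 0 < η₀) (hη : η₀ * K ≤ 8 / smoothConst p Gh Lh L1)
    (hs : IsSampling Pr P train mini) (S : ℕ) :
    ∫ ω, (phi p h P (codaIterate p Gh (smoothConst p Gh Lh L1) μ η₀ h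
        (fun s t k => train s t k ω) (fun s i k => mini s i k ω) (S + 1)) - phiStar p h P) ∂Pr
      ≤ Real.exp (-rate μ (smoothConst p Gh Lh L1)) ^ S
        * ((Real.exp (-rate μ (smoothConst p Gh Lh L1)) + 1 / 4) * Δ₀
          + (S + 1) * (noiseConst p Gh Lh L1 * η₀)) := by
  simp only [codaIterate]
  obtain ⟨l1, -, -, l4⟩ := smoothConst_ge (Gh := Gh) (Lh := Lh) hp0 hp1 hL1
  have hLv0 : 0 < smoothConst p Gh Lh L1 := by linarith [sq_nonneg Gh]
  have hc0 := rate_pos hLv0 hμ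
  have hc1 := rate_le hLv0 hμ
  have hg := goodSchedule hK hp0 hp1 hL1 hη₀ hc0.le hη
  have hdual := fun s => hA.expDualError_succ_le (γ := 1 / (2 * smoothConst p Gh Lh L1))
    (η := stepSize K η₀ (rate μ (smoothConst p Gh Lh L1)))
    (T := stageLength K Gh (smoothConst p Gh Lh L1) η₀ (rate μ (smoothConst p Gh Lh L1)))
    (I := commPeriod K η₀ (rate μ (smoothConst p Gh Lh L1)))
    (m := batchSize K p Gh (smoothConst p Gh Lh L1) η₀ (rate μ (smoothConst p Gh Lh L1)))
    hK hp0 hp1 hs s (hg.batch_pos (s + 1) (by omega))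
  have hgap := fun s => hA.expGap_succ_le hK hp0 hp1 hGh hLh hL1 hg hs s
  have hbatch := fun s => (batchSize_bound (Gh := Gh) (Lv := smoothConst p Gh Lh L1)
    (c := rate μ (smoothConst p Gh Lh L1)) hK hp0 hp1 hη₀ (s := s)
    (hg.length_pos (s + 1) (by omega)) (hg.length_le (s + 1) (by omega))).2
  obtain ⟨z0, z1, z2⟩ := hA.expGap_zero (Pr := Pr) hK hp0 hp1
  have hdc : 0 ≤ dualCoef p Gh Lh := dualCoef_nonneg
  have hdb := one_le_dualBound hp0 hp1
  have hkd := dualBound_mul hp0 hp1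
  have hl := classRate_pos hp0 hp1
  have hnonneg : ∀ it : Ω → Primal d × ℝ, 0 ≤ expGap p h P Pr it := fun it =>
    integral_nonneg fun ω => sub_nonneg.mpr (hA.phiStar_le hK hp0 hp1 _)
  have hstep : ∀ s, stepSize K η₀ (rate μ (smoothConst p Gh Lh L1)) (s + 1) / K
      = η₀ * Real.exp (-rate μ (smoothConst p Gh Lh L1)) ^ s := fun s => stepSize_succ_div hK s
  have hnc : noiseConst p Gh Lh L1
      = 32 + 4 / classRate p + stageNoise p Gh Lh (1 / (2 * smoothConst p Gh Lh L1)) := rfl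
  generalize stageNoise p Gh Lh (1 / (2 * smoothConst p Gh Lh L1)) = N at *
  generalize smoothConst p Gh Lh L1 = Lv at *
  generalize rate μ Lv = c at *
  have hE1 : Real.exp (-c) ≤ 1 := Real.exp_le_one_iff.mpr (by linarith)
  have hE2 : 1 - 3 / 2 * (1 / (2 * Lv)) * μ ≤ Real.exp (-c) := by
    have e1 : 3 / 2 * (1 / (2 * Lv)) * μ = 3 / 4 * (μ / Lv) := by ring
    rw [e1]
    linarith [Real.add_one_le_exp (-c)]
  have hE0 : 0 < Real.exp (-c) := Real.exp_pos _
  generalize Real.exp (-c) = E at *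
  have hD0 : 0 ≤ 20 * dualCoef p Gh Lh * (1 / (2 * Lv)) := by positivity
  -- In the first stage the factor p(1-p)/8, against an initial dual error with p(1-p)·b₀ ≤ 2a₀,
  -- costs a₀/4.
  have hD1 : 20 * dualCoef p Gh Lh * (1 / (2 * Lv)) ≤ p * (1 - p) / 8 := by
    have e1 : 20 * dualCoef p Gh Lh * (1 / (2 * Lv)) = 10 * dualCoef p Gh Lh / Lv := by ring
    have hq : 0 ≤ p * (1 - p) := mul_nonneg hp0.le (by linarith)
    rw [e1, div_le_iff₀ hLv0]
    nlinarith [mul_le_mul_of_nonneg_left l4 hq]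
  generalize 20 * dualCoef p Gh Lh * (1 / (2 * Lv)) = D at *
  have hq1 : p * (1 - p) ≤ 1 := by nlinarith
  generalize ha : (fun s => expGap p h P Pr (fun ω => coda p h (1 / (2 * Lv)) (stepSize K η₀ c)
    (stageLength K Gh Lv η₀ c) (commPeriod K η₀ c) (batchSize K p Gh Lv η₀ c)
    (fun s t k => train s t k ω) (fun s i k => mini s i k ω) s)) = a
  generalize hb : (fun s => expDualError p h P Pr (fun ω => coda p h (1 / (2 * Lv))
    (stepSize K η₀ c) (stageLength K Gh Lv η₀ c) (commPeriod K η₀ c) (batchSize K p Gh Lv η₀ c)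
    (fun s t k => train s t k ω) (fun s i k => mini s i k ω) s)) = b
  have ha' := fun s => congrFun ha s
  have hb' := fun s => congrFun hb s
  simp only [ha', hb', hstep] at hgap hdual
  have ha0 : ∀ s, 0 ≤ a s := fun s => by rw [← ha' s]; exact hnonneg _
  have a0 : expGap p h P Pr (fun _ : Ω => ((0 : Primal d), (0 : ℝ))) = a 0 := ha' 0
  have b0 : expDualError p h P Pr (fun _ : Ω => ((0 : Primal d), (0 : ℝ))) = b 0 := hb' 0
  rw [a0] at z1 z2
  rw [b0] at z2
  have hb0 : 0 ≤ b 0 := by rw [← hb' 0]; exact integral_nonneg fun ω => sq_nonneg _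
  have hN4 : 0 ≤ 32 + 4 / classRate p := by positivity
  have h1 : a 1 ≤ (E + 1 / 4) * a 0 + noiseConst p Gh Lh L1 * η₀ := by
    have e1 := hgap 0
    have e2 := mul_le_mul_of_nonneg_right hE2 (ha0 0)
    have e3 := mul_le_mul_of_nonneg_right hD1 hb0
    simp only [zero_add, pow_zero, mul_one] at e1
    have e4 : 0 ≤ (32 + 4 / classRate p) * η₀ := by positivity
    rw [hnc]
    linarith
  have h2 : ∀ s, 1 ≤ s → a (s + 1) ≤ E * a s + noiseConst p Gh Lh L1 * η₀ * E ^ s := by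
    intro s hs1
    obtain ⟨r, rfl⟩ : ∃ r, s = r + 1 := ⟨s - 1, by omega⟩
    have e1 := hgap (r + 1)
    have e2 := mul_le_mul_of_nonneg_right hE2 (ha0 (r + 1))
    have e3 := (hdual r).trans (hbatch (r + 1))
    rw [hstep] at e3
    have e4 := mul_le_mul_of_nonneg_left e3 hD0
    have e5 : 0 ≤ (32 + 4 / classRate p) * (η₀ * E ^ (r + 1)) := by positivity
    have e6 : D * ((32 + 4 / classRate p) * (η₀ * E ^ (r + 1)))
        ≤ (32 + 4 / classRate p) * (η₀ * E ^ (r + 1)) :=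
      mul_le_of_le_one_left e5 (by linarith)
    rw [hnc]
    linarith
  have h3 := linear_recursion_le hE0.le h1 h2 S
  have h4 : ∫ ω, (phi p h P (coda p h (1 / (2 * Lv)) (stepSize K η₀ c)
      (stageLength K Gh Lv η₀ c) (commPeriod K η₀ c) (batchSize K p Gh Lv η₀ c)
      (fun s t k => train s t k ω) (fun s i k => mini s i k ω) (S + 1)).1 - phiStar p h P) ∂Pr
      = a (S + 1) := ha' (S + 1)
  have hgoal : a (S + 1) ≤ E ^ S * ((E + 1 / 4) * Δ₀ + (S + 1) * (noiseConst p Gh Lh L1 * η₀)) :=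
    h3.trans (mul_le_mul_of_nonneg_left (by
      have := mul_le_mul_of_nonneg_left z1 (by linarith : 0 ≤ E + 1 / 4)
      linarith) (by positivity))
  rw [← h4] at hgoal
  exact hgoal

theorem Assumptions.integrable_gap_codaIterate (hA : Assumptions p Gh Lh L1 μ Δ₀ h P)
    (hK : 0 < K) (hp0 : 0 < p) (hp1 : p < 1) (hGh : 0 ≤ Gh) (hL1 : 0 ≤ L1)
    (hμ : 0 < μ) (hη₀ : 0 < η₀) (hη : η₀ * K ≤ 8 / smoothConst p Gh Lh L1)
    (hs : IsSampling Pr P train mini) (S : ℕ) :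
    Integrable (fun ω => phi p h P (codaIterate p Gh (smoothConst p Gh Lh L1) μ η₀ h
        (fun s t k => train s t k ω) (fun s i k => mini s i k ω) S) - phiStar p h P) Pr := by
  obtain ⟨l1, -, -, -⟩ := smoothConst_ge (Gh := Gh) (Lh := Lh) hp0 hp1 hL1
  have hLv0 : 0 < smoothConst p Gh Lh L1 := by linarith [sq_nonneg Gh]
  have hg := goodSchedule hK hp0 hp1 hL1 hη₀ (rate_pos hLv0 hμ).le hη
  exact (hA.bddMeas_phi_sub hK hp0 hp1 (hs.freshSamples hA _ _ _ _ _ S).measurable_primal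
    fun ω => (hA.coda_mem hK hp0 hp1 hGh hg.gamma_pos hg.step_pos hg.step_le hg.length_pos
      _ _ S).1).integrable

/-- The requirement on the number of stages makes both parts of the error small. -/
theorem accuracy_arith {c N E' ε : ℝ} (hc0 : 0 < c) (hc1 : c < 1) (hN : 0 < N)
    (hE' : 12 * N ≤ E') (hΔ : 0 < Δ₀) (hη₀ : 0 < η₀) (hε : 0 < ε) {S : ℕ}
    (hS : 1 / c * max (Real.log (2 * Δ₀ / ε)) (Real.log ((S + 1 : ℕ) : ℝ)
      + Real.log (2 * η₀ / ε * E')) ≤ ((S + 1 : ℕ) : ℝ)) :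
    Real.exp (-c) ^ S * ((Real.exp (-c) + 1 / 4) * Δ₀ + (S + 1) * (N * η₀)) ≤ ε := by
  have hE'0 : 0 < E' := by linarith
  have hS0 : (0 : ℝ) < ((S + 1 : ℕ) : ℝ) := by positivity
  have h1 : max (Real.log (2 * Δ₀ / ε)) (Real.log ((S + 1 : ℕ) : ℝ)
      + Real.log (2 * η₀ / ε * E')) ≤ c * ((S + 1 : ℕ) : ℝ) := by
    rwa [one_div, inv_mul_le_iff₀ hc0] at hS
  have h2 := (Real.log_le_iff_le_exp (by positivity)).mp ((le_max_left _ _).trans h1)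
  have h3 := (le_max_right _ _).trans h1
  rw [← Real.log_mul hS0.ne' (by positivity)] at h3
  have h4 := (Real.log_le_iff_le_exp (by positivity)).mp h3
  -- The hypothesis concerns e^{c(S+1)} but the error decays only like e^{-cS}; the missing factor F
  -- = e^c is below 2.8.
  have e1 : Real.exp (c * ((S + 1 : ℕ) : ℝ)) = Real.exp c * Real.exp c ^ S := by
    rw [← pow_succ', ← Real.exp_nat_mul, mul_comm]
  rw [e1] at h2 h4
  rw [Real.exp_neg, inv_pow]
  have hF1 : Real.exp c ≤ 2.8 := by
    have := Real.exp_one_lt_d9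
    have := Real.exp_le_exp.mpr hc1.le
    linarith
  have hF0 : 0 < Real.exp c := Real.exp_pos c
  generalize Real.exp c = F at *
  have hFS : 0 < F ^ S := by positivity
  rw [inv_mul_le_iff₀ hFS]
  push_cast at h4
  rw [div_le_iff₀ hε] at h2
  have h5 : (S + 1) * (2 * η₀ * E') ≤ F * F ^ S * ε := by
    rw [← div_le_iff₀ hε]
    calc _ = ((S : ℝ) + 1) * (2 * η₀ / ε * E') := by ring
      _ ≤ _ := h4
  have hS1 : (0 : ℝ) < (S : ℝ) + 1 := by positivity
  have h6 : 24 * ((S + 1) * (N * η₀)) ≤ F * F ^ S * ε := by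
    refine le_trans ?_ h5
    have := mul_le_mul_of_nonneg_left hE' (by positivity : 0 ≤ (S + 1) * (2 * η₀))
    linarith
  have hG : 0 < F ^ S * ε := by positivity
  generalize hGd : F ^ S * ε = Gv at *
  rw [mul_assoc, hGd] at h2 h6
  -- The two parts of the error take shares 1/2 + F/8 and F/24 of ε, whose sum is below 1 for F ≤
  -- 2.8.
  have h7 : (F⁻¹ + 1 / 4) * Δ₀ ≤ (1 / 2 + F / 8) * Gv := by
    have : (F⁻¹ + 1 / 4) * (F * Gv / 2) = (1 / 2 + F / 8) * Gv := by field_simp; ring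
    rw [← this]
    exact mul_le_mul_of_nonneg_left (by linarith) (by positivity)
  nlinarith

end accuracy

/-! ### The number of stages, iterations and communication rounds -/

section complexity

variable {μ Lv Δ₀ η₀ ε R₀ E : ℝ}

/-- The constant in the bound on the number of stages. -/
def stageCountConst (R₀ E : ℝ) : ℝ := R₀ * (5 + 2 * Real.log (2 * R₀) + 2 * Real.log E)

theorem one_le_stageCountConst (hR₀ : 1 ≤ R₀) (hE : 1 ≤ E) : 1 ≤ stageCountConst R₀ E := by
  have h1 : 0 ≤ Real.log (2 * R₀) := Real.log_nonneg (by linarith)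
  have h2 : 0 ≤ Real.log E := Real.log_nonneg hE
  rw [stageCountConst]
  nlinarith

theorem one_le_logFactor (hμ : 0 < μ) (hΔ : 0 < Δ₀) (hε : 0 < ε) : 1 ≤ logFactor μ Δ₀ ε := by
  rw [logFactor, Real.le_log_iff_exp_le (by positivity)]
  have h1 := Real.exp_one_lt_d9
  have h2 : 0 < 1 / μ := by positivity
  have h3 : 0 < (Δ₀ + 1) / ε := by positivity
  linarith

/-- Makes an implicit condition n ≥ R(log n + A) explicit: log(n/(2R)) ≤ n/(2R) - 1 absorbs the
logarithm into n/2. -/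
theorem mul_log_add_le {R n A : ℝ} (hR : 0 < R) (hn : 0 < n)
    (h : 2 * R * (Real.log (2 * R) + A) ≤ n) : R * (Real.log n + A) ≤ n := by
  have h1 := Real.log_le_sub_one_of_pos (by positivity : 0 < n / (2 * R))
  rw [Real.log_div hn.ne' (by positivity)] at h1
  have h2 := mul_le_mul_of_nonneg_left h1 hR.le
  have h3 : R * (n / (2 * R) - 1) = n / 2 - R := by field_simp
  rw [h3] at h2
  linarith

/-- There is a smallest sufficient number of stages. It is at most of the order `Λ / μ`, and
`exp (c (S - 1))` is at most of the order of the inverse accuracy. -/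
theorem exists_least_enoughStages {H B σv σα : ℝ} (hLv : 0 < Lv) (hμ : 0 < μ)
    (hR₀ : 5 * Lv + μ ≤ R₀) (hR₀1 : 1 ≤ R₀) (hΔ : 0 < Δ₀) (hη₀ : 0 < η₀) (hη₀1 : η₀ ≤ 1 / 2)
    (hE : E = (6 * H * B ^ 2 + 12 * (σv ^ 2 + σα ^ 2)) / 5) (hE1 : 1 ≤ E) (hε : 0 < ε)
    (hεΔ : ε ≤ Δ₀) :
    ∃ S : ℕ, IsLeast {S' : ℕ | EnoughStages Lv H B σv σα μ Δ₀ η₀ ε S'} S ∧ 1 ≤ S ∧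
      (S : ℝ) ≤ stageCountConst R₀ E * logFactor μ Δ₀ ε / μ ∧
      Real.exp (rate μ Lv) ^ (S - 1) ≤ max (2 * Δ₀ / ε) (S * (2 * η₀ / ε * E)) := by
  have hc := rate_pos hLv hμ
  have hΛ := one_le_logFactor hμ hΔ hε
  have hR : (5 * Lv + μ) / μ ≤ R₀ / μ := div_le_div_of_nonneg_right hR₀ hμ.le
  have hR1 : 1 ≤ (5 * Lv + μ) / μ := by rw [le_div_iff₀ hμ]; linarith
  have hΛd : logFactor μ Δ₀ ε = Real.log (3 + 1 / μ + (Δ₀ + 1) / ε) := rfl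
  have hpμ : 0 < 1 / μ := by positivity
  have hpε : 0 < (Δ₀ + 1) / ε := by positivity
  have hlμ : Real.log (1 / μ) ≤ logFactor μ Δ₀ ε := by
    rw [hΛd]; exact Real.log_le_log hpμ (by linarith)
  have hlε : Real.log (1 / ε) ≤ logFactor μ Δ₀ ε := by
    rw [hΛd]
    refine Real.log_le_log (by positivity) ?_
    have : 1 / ε ≤ (Δ₀ + 1) / ε := div_le_div_of_nonneg_right (by linarith) hε.le
    linarith
  have hlΔ : Real.log (2 * Δ₀ / ε) ≤ 2 * logFactor μ Δ₀ ε := by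
    have h1 : Real.log (Δ₀ / ε) ≤ logFactor μ Δ₀ ε := by
      rw [hΛd]
      refine Real.log_le_log (by positivity) ?_
      have : Δ₀ / ε ≤ (Δ₀ + 1) / ε := div_le_div_of_nonneg_right (by linarith) hε.le
      linarith
    have h2 := Real.log_two_lt_d9
    rw [mul_div_assoc, Real.log_mul (by norm_num) (by positivity)]
    linarith
  have hlE : Real.log (2 * η₀ / ε * E) ≤ Real.log E + logFactor μ Δ₀ ε := by
    have h1 : 2 * η₀ / ε * E ≤ E * (1 / ε) := by
      rw [div_mul_eq_mul_div, mul_one_div]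
      exact div_le_div_of_nonneg_right (by nlinarith) hε.le
    refine (Real.log_le_log (by positivity) h1).trans ?_
    rw [Real.log_mul (by linarith) (by positivity)]
    linarith
  -- R is of order 1/μ, so its logarithm is of order Λ; this is why 1/μ occurs in `logFactor`.
  have hlR : Real.log (2 * ((5 * Lv + μ) / μ)) ≤ Real.log (2 * R₀) + logFactor μ Δ₀ ε := by
    refine (Real.log_le_log (by positivity) (mul_le_mul_of_nonneg_left hR zero_le_two)).trans ?_
    rw [← mul_div_assoc, div_eq_mul_one_div, Real.log_mul (by positivity) (by positivity)]
    linarith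
  have hl1 : 0 ≤ Real.log (2 * R₀) := Real.log_nonneg (by linarith)
  have hl2 : 0 ≤ Real.log E := Real.log_nonneg hE1
  have hinv := inv_rate hLv hμ
  have hsc : stageCountConst R₀ E = R₀ * (5 + 2 * Real.log (2 * R₀) + 2 * Real.log E) := rfl
  have hdef : ∀ S : ℕ, EnoughStages Lv H B σv σα μ Δ₀ η₀ ε S ↔ 1 ≤ S ∧ (5 * Lv + μ) / μ *
      max (Real.log (2 * Δ₀ / ε)) (Real.log S + Real.log (2 * η₀ / ε * E)) ≤ (S : ℝ) := fun S => by
    rw [EnoughStages, hE]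
  simp only [hdef]
  generalize (5 * Lv + μ) / μ = R at *
  generalize logFactor μ Δ₀ ε = Λ at *
  have hR0 : 0 < R := by linarith
  have hRΛ : 1 ≤ R * Λ := by nlinarith
  have hb0 : R * Λ * (4 + 2 * Real.log (2 * R₀) + 2 * Real.log E)
      = R * (4 * Λ) + 2 * R * (Real.log (2 * R₀) * Λ + Real.log E * Λ) := by ring
  have hmul1 : Real.log (2 * R₀) ≤ Real.log (2 * R₀) * Λ := le_mul_of_one_le_right hl1 hΛ
  have hmul2 : Real.log E ≤ Real.log E * Λ := le_mul_of_one_le_right hl2 hΛ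
  have hbig : ∀ n : ℕ, R * Λ * (4 + 2 * Real.log (2 * R₀) + 2 * Real.log E) ≤ n →
      1 ≤ n ∧ R * max (Real.log (2 * Δ₀ / ε)) (Real.log n + Real.log (2 * η₀ / ε * E))
        ≤ (n : ℝ) := by
    intro n hn
    have hn1 : (1 : ℝ) ≤ n := by
      refine le_trans ?_ hn
      nlinarith
    refine ⟨by exact_mod_cast hn1, ?_⟩
    rw [mul_max_of_nonneg _ _ hR0.le]
    refine max_le (le_trans ?_ hn) (mul_log_add_le hR0 (by linarith) (le_trans ?_ hn))
    · have h1 := mul_le_mul_of_nonneg_left hlΔ hR0.le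
      have h2 : 0 ≤ R * Λ * (2 + 2 * Real.log (2 * R₀) + 2 * Real.log E) := by positivity
      linarith
    · have h1 : Real.log (2 * R) + Real.log (2 * η₀ / ε * E)
          ≤ 2 * Λ + (Real.log (2 * R₀) * Λ + Real.log E * Λ) := by linarith
      have h2 := mul_le_mul_of_nonneg_left h1 (by positivity : 0 ≤ 2 * R)
      linarith
  have hex : ∃ n : ℕ, 1 ≤ n ∧ R * max (Real.log (2 * Δ₀ / ε))
      (Real.log n + Real.log (2 * η₀ / ε * E)) ≤ (n : ℝ) := ⟨_, hbig _ (Nat.le_ceil _)⟩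
  classical
  obtain ⟨hS1, hS2⟩ := Nat.find_spec hex
  have hSmin : ∀ n, n < Nat.find hex → ¬ (1 ≤ n ∧ R * max (Real.log (2 * Δ₀ / ε))
      (Real.log n + Real.log (2 * η₀ / ε * E)) ≤ (n : ℝ)) := fun n hn => Nat.find_min hex hn
  have hSle : ∀ n : ℕ, (1 ≤ n ∧ R * max (Real.log (2 * Δ₀ / ε))
      (Real.log n + Real.log (2 * η₀ / ε * E)) ≤ (n : ℝ)) → Nat.find hex ≤ n := fun n hn =>
    Nat.find_min' hex hn
  generalize Nat.find hex = S at *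
  refine ⟨S, ⟨⟨hS1, hS2⟩, fun n hn => hSle n hn⟩, hS1, ?_, ?_⟩
  · have h1 : (S : ℝ) ≤ R * Λ * (5 + 2 * Real.log (2 * R₀) + 2 * Real.log E) := by
      have h2 : S ≤ ⌈R * Λ * (4 + 2 * Real.log (2 * R₀) + 2 * Real.log E)⌉₊ :=
        hSle _ (hbig _ (Nat.le_ceil _))
      have h3 := Nat.ceil_lt_add_one
        (by positivity : 0 ≤ R * Λ * (4 + 2 * Real.log (2 * R₀) + 2 * Real.log E))
      have h4 : (S : ℝ) ≤ ⌈R * Λ * (4 + 2 * Real.log (2 * R₀) + 2 * Real.log E)⌉₊ := by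
        exact_mod_cast h2
      linarith
    refine h1.trans ?_
    rw [hsc]
    have h5 := mul_le_mul_of_nonneg_right hR
      (by positivity : 0 ≤ Λ * (5 + 2 * Real.log (2 * R₀) + 2 * Real.log E))
    calc _ = R * (Λ * (5 + 2 * Real.log (2 * R₀) + 2 * Real.log E)) := by ring
      _ ≤ _ := h5
      _ = _ := by ring
  · obtain ⟨n, rfl⟩ : ∃ n, S = n + 1 := ⟨S - 1, by omega⟩
    rw [Nat.add_sub_cancel]
    -- For S = 1 the claim reduces to 1 ≤ 2Δ₀/ε, which uses ε ≤ Δ₀. Otherwise S - 1 is an admissible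
    -- count that violates the requirement, and exponentiating that failure gives the bound.
    rcases Nat.eq_zero_or_pos n with rfl | hn
    · rw [pow_zero]
      refine le_max_of_le_left ?_
      rw [le_div_iff₀ hε]
      linarith
    · have h1 := hSmin n (by omega)
      push Not at h1
      have h2 := h1 hn
      have hn0 : (0 : ℝ) < n := by exact_mod_cast hn
      rw [hinv, one_div, lt_inv_mul_iff₀ hc] at h2
      have e1 : Real.exp (rate μ Lv) ^ n = Real.exp (rate μ Lv * n) := by
        rw [← Real.exp_nat_mul, mul_comm]
      rw [e1]
      rcases lt_max_iff.mp h2 with h3 | h3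
      · refine le_max_of_le_left ?_
        have := Real.exp_le_exp.mpr h3.le
        rwa [Real.exp_log (by positivity)] at this
      · refine le_max_of_le_right ?_
        rw [← Real.log_mul hn0.ne' (by positivity)] at h3
        have h4 := Real.exp_le_exp.mpr h3.le
        rw [Real.exp_log (by positivity)] at h4
        refine h4.trans (mul_le_mul_of_nonneg_right ?_ (by positivity))
        exact_mod_cast Nat.le_succ n

/-! ### Geometric sums for iterations and communication rounds. -/

theorem geom_sum_exp_le {r : ℝ} (hr : 0 < r) (S : ℕ) :
    ∑ j ∈ Finset.range S, Real.exp r ^ j ≤ 1 / r * Real.exp r ^ S := by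
  have h1 := geom_sum_mul (Real.exp r) S
  have h2 := Real.add_one_le_exp r
  have h3 : 0 ≤ ∑ j ∈ Finset.range S, Real.exp r ^ j :=
    Finset.sum_nonneg fun j _ => by positivity
  rw [one_div, ← div_eq_inv_mul, le_div_iff₀ hr]
  nlinarith

theorem dsgComm_le (T I : ℕ) : (dsgComm T I : ℝ) ≤ T / I := by
  have h1 : dsgComm T I = T / I := by
    rw [dsgComm, ← Nat.card_multiples]
    congr 1
    ext t
    simp [Nat.dvd_iff_mod_eq_zero]
  rw [h1]
  exact Nat.cast_div_le

variable {K : ℕ} {Gh c : ℝ}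

theorem stageLength_le (hK : 0 < K) (hη₀ : 0 < η₀) (hc : 0 ≤ c) (hLv : 0 < Lv)
    (hX : max 8 (8 * Gh ^ 2) ≤ Lv / 2) (hη : η₀ * K ≤ 8 / Lv) {s : ℕ} (hs : 1 ≤ s) :
    (stageLength K Gh Lv η₀ c s : ℝ) ≤ 1 / stepSize K η₀ c s := by
  have h1 := stepSize_mul_stageLength_le (Gh := Gh) (c := c) hK hη₀ hLv s
  have h2 := (stepSize_le (K := K) hη₀ hc hs).trans hη
  have h3 : max 8 (8 * Gh ^ 2) / Lv ≤ 1 / 2 := by rw [div_le_iff₀ hLv]; linarith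
  have h4 : 8 / Lv ≤ 1 / 2 := by
    rw [div_le_iff₀ hLv]
    linarith [le_max_left 8 (8 * Gh ^ 2)]
  rw [le_div_iff₀' (stepSize_pos hK hη₀ s)]
  linarith

/-- With T ≤ 1/η and 1/I ≤ 2√(Kη) the quotient T/I is at most 2√(K/η). The factor 2 pays for
rounding: 1/√(Kη) is below its floor plus 1, hence at most 2I. -/
theorem dsgComm_commPeriod_le (hK : 0 < K) (hη₀ : 0 < η₀) (hc : 0 ≤ c) (hLv : 0 < Lv)
    (hX : max 8 (8 * Gh ^ 2) ≤ Lv / 2) (hη : η₀ * K ≤ 8 / Lv) {s : ℕ} (hs : 1 ≤ s) :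
    (dsgComm (stageLength K Gh Lv η₀ c s) (commPeriod K η₀ c s) : ℝ)
      ≤ 2 * √(K / stepSize K η₀ c s) := by
  have hI : 1 ≤ commPeriod K η₀ c s := le_max_left _ _
  have hη := stageLength_le hK hη₀ hc hLv hX hη hs
  have hp := stepSize_pos (c := c) hK hη₀ s
  have hK' : (0 : ℝ) < K := by exact_mod_cast hK
  refine (dsgComm_le _ _).trans ?_
  have h1 : 1 / √((K : ℝ) * stepSize K η₀ c s) ≤ 2 * commPeriod K η₀ c s := by
    have e1 := Nat.lt_floor_add_one (1 / √((K : ℝ) * stepSize K η₀ c s))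
    have e2 : (⌊1 / √((K : ℝ) * stepSize K η₀ c s)⌋₊ : ℝ) ≤ commPeriod K η₀ c s := by
      exact_mod_cast le_max_right _ _
    have e3 : (1 : ℝ) ≤ commPeriod K η₀ c s := by exact_mod_cast hI
    linarith
  generalize (commPeriod K η₀ c s : ℝ) = I at *
  generalize (stageLength K Gh Lv η₀ c s : ℝ) = T at *
  generalize stepSize K η₀ c s = η at *
  have hs0 : 0 < √((K : ℝ) * η) := Real.sqrt_pos.mpr (by positivity)
  have hI0 : 0 < I := by
    have : 0 < 1 / √((K : ℝ) * η) := by positivity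
    linarith
  rw [div_le_iff₀ hI0]
  refine hη.trans ?_
  have h2 : √((K : ℝ) / η) = √((K : ℝ) * η) / η := by
    rw [show (K : ℝ) / η = (K * η) / η ^ 2 by field_simp, Real.sqrt_div (by positivity),
      Real.sqrt_sq hp.le]
  rw [h2]
  rw [div_le_iff₀ hs0] at h1
  rw [show 2 * (√((K : ℝ) * η) / η) * I = (2 * I * √((K : ℝ) * η)) / η by ring]
  exact div_le_div_of_nonneg_right h1 hp.le

theorem inv_stepSize_succ (hη₀ : 0 < η₀) (hK : 0 < K) (j : ℕ) :
    1 / stepSize K η₀ c (j + 1) = 1 / (η₀ * K) * Real.exp c ^ j := by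
  have h := stepSize_succ_div (η₀ := η₀) (c := c) hK j
  have hK' : (0 : ℝ) < K := by exact_mod_cast hK
  have hF := Real.exp_pos c
  rw [div_eq_iff hK'.ne'] at h
  rw [h, Real.exp_neg, inv_pow]
  field_simp

theorem sum_Icc_one_eq_sum_range (f : ℕ → ℝ) (S : ℕ) :
    ∑ s ∈ Finset.Icc 1 S, f s = ∑ j ∈ Finset.range S, f (j + 1) := by
  induction S with
  | zero => simp
  | succ S ih => rw [Finset.sum_Icc_succ_top (by omega), ih, Finset.sum_range_succ]

theorem exp_pow_le (hc : c < 1) {S : ℕ} (hS : 1 ≤ S) :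
    Real.exp c ^ S ≤ 3 * Real.exp c ^ (S - 1) := by
  obtain ⟨n, rfl⟩ : ∃ n, S = n + 1 := ⟨S - 1, by omega⟩
  rw [Nat.add_sub_cancel, pow_succ']
  refine mul_le_mul_of_nonneg_right ?_ (by positivity)
  have := Real.exp_one_lt_d9
  have := Real.exp_le_exp.mpr hc.le
  linarith

theorem totalIterations_le (hK : 0 < K) (hη₀ : 0 < η₀) (hμ : 0 < μ) (hLv : 0 < Lv)
    (hX : max 8 (8 * Gh ^ 2) ≤ Lv / 2) (hη : η₀ * K ≤ 8 / Lv) {S : ℕ} (hS : 1 ≤ S) :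
    (totalIterations K Gh Lv μ η₀ S : ℝ)
      ≤ 3 * (1 / rate μ Lv) * (1 / (η₀ * K)) * Real.exp (rate μ Lv) ^ (S - 1) := by
  have hc0 := rate_pos hLv hμ
  have hc1 := rate_lt_one hLv hμ
  rw [totalIterations]
  generalize rate μ Lv = c at *
  push_cast
  have hK' : (0 : ℝ) < K := by exact_mod_cast hK
  rw [sum_Icc_one_eq_sum_range fun s => (stageLength K Gh Lv η₀ c s : ℝ)]
  have h1 : ∑ j ∈ Finset.range S, (stageLength K Gh Lv η₀ c (j + 1) : ℝ)
      ≤ ∑ j ∈ Finset.range S, 1 / (η₀ * K) * Real.exp c ^ j := by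
    refine Finset.sum_le_sum fun j _ => ?_
    rw [← inv_stepSize_succ hη₀ hK]
    exact stageLength_le hK hη₀ hc0.le hLv hX hη (by omega)
  rw [← Finset.mul_sum] at h1
  have h2 := (geom_sum_exp_le hc0 S).trans
    (mul_le_mul_of_nonneg_left (exp_pow_le hc1 hS) (by positivity))
  have h3 := mul_le_mul_of_nonneg_left h2 (by positivity : 0 ≤ 1 / (η₀ * K))
  linarith

/-- Rounds per stage grow like e^{c(s-1)/2}, so the geometric ratio is e^{c/2} and its sum costs
2/c; the sum is dominated by the last stage. -/
theorem totalCommunications_le (hK : 0 < K) (hη₀ : 0 < η₀) (hμ : 0 < μ) (hLv : 0 < Lv)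
    (hX : max 8 (8 * Gh ^ 2) ≤ Lv / 2) (hη : η₀ * K ≤ 8 / Lv) {S : ℕ} (hS : 1 ≤ S) :
    (totalCommunications K Gh Lv μ η₀ S : ℝ)
      ≤ 8 * (1 / rate μ Lv) * √(Real.exp (rate μ Lv) ^ (S - 1) / η₀) + 2 * S := by
  have hc0 := rate_pos hLv hμ
  have hc1 := rate_lt_one hLv hμ
  rw [totalCommunications]
  generalize rate μ Lv = c at *
  have hK' : (0 : ℝ) < K := by exact_mod_cast hK
  have hsq : ∀ j : ℕ, √(Real.exp c ^ j) = Real.exp (c / 2) ^ j := fun j => by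
    rw [Real.sqrt_eq_iff_mul_self_eq (by positivity) (by positivity), ← mul_pow, ← Real.exp_add,
      add_halves]
  rw [Nat.cast_sum, sum_Icc_one_eq_sum_range fun s =>
    ((dsgComm (stageLength K Gh Lv η₀ c s) (commPeriod K η₀ c s) + 2 : ℕ) : ℝ)]
  have h1 : ∑ j ∈ Finset.range S, ((dsgComm (stageLength K Gh Lv η₀ c (j + 1))
      (commPeriod K η₀ c (j + 1)) + 2 : ℕ) : ℝ)
      ≤ ∑ j ∈ Finset.range S, (2 / √η₀ * Real.exp (c / 2) ^ j + 2) := by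
    refine Finset.sum_le_sum fun j _ => ?_
    push_cast
    have e1 := dsgComm_commPeriod_le hK hη₀ hc0.le hLv hX hη (s := j + 1) (by omega)
    have e2 : (K : ℝ) / stepSize K η₀ c (j + 1) = Real.exp c ^ j / η₀ := by
      rw [div_eq_mul_one_div, inv_stepSize_succ hη₀ hK]
      field_simp
    rw [e2, Real.sqrt_div (by positivity), hsq] at e1
    refine (add_le_add_left e1 2).trans_eq ?_
    ring
  refine h1.trans ?_
  rw [Finset.sum_add_distrib, ← Finset.mul_sum, Finset.sum_const, Finset.card_range, nsmul_eq_mul]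
  have h2 := geom_sum_exp_le (by positivity : 0 < c / 2) S
  have h3 : Real.exp (c / 2) ^ S ≤ 2 * √(Real.exp c ^ (S - 1)) := by
    rw [← hsq]
    refine (Real.sqrt_le_sqrt (exp_pow_le hc1 hS)).trans ?_
    rw [Real.sqrt_mul (by norm_num)]
    refine mul_le_mul_of_nonneg_right ?_ (Real.sqrt_nonneg _)
    rw [Real.sqrt_le_left (by norm_num)]
    norm_num
  have h4 := mul_le_mul_of_nonneg_left
    (h2.trans (mul_le_mul_of_nonneg_left h3 (by positivity : 0 ≤ 1 / (c / 2))))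
    (by positivity : 0 ≤ 2 / √η₀)
  rw [Real.sqrt_div (by positivity)]
  have h5 : 2 / √η₀ * (1 / (c / 2) * (2 * √(Real.exp c ^ (S - 1))))
      = 8 * (1 / c) * (√(Real.exp c ^ (S - 1)) / √η₀) := by
    have : √η₀ ≠ 0 := (Real.sqrt_pos.mpr hη₀).ne'
    field_simp
    ring
  linarith

/-- The two alternatives for Q = e^{c(S-1)}, gap-limited and noise-limited, produce the two entries
of the maximum. In the second, S contributes the additional Λ/μ. -/
theorem iterations_arith {C Λ S Q : ℝ} (hK : 0 < K) (hη₀ : 0 < η₀) (hμ : 0 < μ)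
    (hLv : 1 ≤ Lv) (hΔ : 0 < Δ₀) (hε : 0 < ε) (hE : 1 ≤ E) (hC : 1 ≤ C) (hΛ : 1 ≤ Λ)
    (hR₀ : 0 ≤ R₀) {R : ℝ} (hR0 : 0 ≤ R) (hR : R ≤ R₀ / μ) (hS : S ≤ C * Λ / μ)
    (hQ : Q ≤ max (2 * Δ₀ / ε) (S * (2 * η₀ / ε * E))) :
    3 * R * (1 / (η₀ * K)) * Q ≤ (2 * C + 16 * R₀ * C * E) * Λ
      * max (Δ₀ / (μ * ε * η₀ * K)) (Lv / (μ ^ 2 * K * ε)) := by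
  have hK' : (0 : ℝ) < K := by exact_mod_cast hK
  have hCE : 1 ≤ C * E := by nlinarith
  have hM1 := le_max_left (Δ₀ / (μ * ε * η₀ * K)) (Lv / (μ ^ 2 * K * ε))
  have hM2 := le_max_right (Δ₀ / (μ * ε * η₀ * K)) (Lv / (μ ^ 2 * K * ε))
  have hM0 : 0 ≤ Δ₀ / (μ * ε * η₀ * K) := by positivity
  generalize max (Δ₀ / (μ * ε * η₀ * K)) (Lv / (μ ^ 2 * K * ε)) = M at *
  have hM : 0 ≤ M := hM0.trans hM1
  have hfin : 6 * (R₀ * (C * E)) * Λ * M ≤ (2 * C + 16 * R₀ * C * E) * Λ * M := by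
    refine mul_le_mul_of_nonneg_right (mul_le_mul_of_nonneg_right ?_ (by linarith)) hM
    have : 0 ≤ R₀ * (C * E) := by positivity
    linarith
  refine le_trans ?_ hfin
  have hRb : 3 * R * (1 / (η₀ * K)) ≤ 3 * (R₀ / μ) * (1 / (η₀ * K)) :=
    mul_le_mul_of_nonneg_right (by linarith) (by positivity)
  have hR1 : 0 ≤ 3 * R * (1 / (η₀ * K)) := by positivity
  rcases le_max_iff.mp hQ with h | h
  · calc 3 * R * (1 / (η₀ * K)) * Q ≤ 3 * (R₀ / μ) * (1 / (η₀ * K)) * (2 * Δ₀ / ε) :=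
          (mul_le_mul_of_nonneg_left h hR1).trans
            (mul_le_mul_of_nonneg_right hRb (by positivity))
      _ = 6 * R₀ * (Δ₀ / (μ * ε * η₀ * K)) := by field_simp; ring
      _ ≤ 6 * R₀ * M := mul_le_mul_of_nonneg_left hM1 (by positivity)
      _ ≤ 6 * R₀ * M * (C * E * Λ) := le_mul_of_one_le_right (by positivity) (by nlinarith)
      _ = _ := by ring
  · have h' : Q ≤ C * Λ / μ * (2 * η₀ / ε * E) :=
      h.trans (mul_le_mul_of_nonneg_right hS (by positivity))
    calc 3 * R * (1 / (η₀ * K)) * Q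
        ≤ 3 * (R₀ / μ) * (1 / (η₀ * K)) * (C * Λ / μ * (2 * η₀ / ε * E)) :=
          (mul_le_mul_of_nonneg_left h' hR1).trans
            (mul_le_mul_of_nonneg_right hRb (by positivity))
      _ = 6 * (R₀ * (C * E)) * Λ * (1 / (μ ^ 2 * K * ε)) := by field_simp; ring
      _ ≤ _ := mul_le_mul_of_nonneg_left
          ((div_le_div_of_nonneg_right hLv (by positivity)).trans hM2) (by positivity)

theorem communications_arith {C Λ S Q : ℝ} (hK : 0 < K) (hη₀ : 0 < η₀) (hμ : 0 < μ)
    (hLv : 1 ≤ Lv) (hΔ : 0 < Δ₀) (hε : 0 < ε) (hE : 1 ≤ E) (hC : 1 ≤ C) (hΛ : 1 ≤ Λ)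
    (hR₀ : 0 ≤ R₀) {R : ℝ} (hR : R ≤ R₀ / μ) (hS : S ≤ C * Λ / μ)
    (hQ : Q ≤ max (2 * Δ₀ / ε) (S * (2 * η₀ / ε * E))) :
    8 * R * √(Q / η₀) + 2 * S ≤ (2 * C + 16 * R₀ * C * E) * Λ
      * max (K / μ + √Δ₀ / (μ * √(η₀ * ε))) (K / μ + √Lv / (μ ^ (3 / 2 : ℝ) * √ε)) := by
  have hK1 : (1 : ℝ) ≤ K := by exact_mod_cast hK
  have hCE : 1 ≤ C * E := by nlinarith
  have hCΛ : 1 ≤ C * E * Λ := by nlinarith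
  have hpow : μ ^ (3 / 2 : ℝ) = μ * √μ := by
    rw [Real.sqrt_eq_rpow, ← Real.rpow_one_add' hμ.le (by norm_num)]
    norm_num
  have hsμ : 0 < √μ := Real.sqrt_pos.mpr hμ
  have hsε : 0 < √ε := Real.sqrt_pos.mpr hε
  have hsη : 0 < √η₀ := Real.sqrt_pos.mpr hη₀
  have hsΔ : 0 ≤ √Δ₀ := Real.sqrt_nonneg _
  rw [max_add_add_left, hpow, Real.sqrt_mul hη₀.le]
  have hM1 := le_max_left (√Δ₀ / (μ * (√η₀ * √ε))) (√Lv / (μ * √μ * √ε))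
  have hM2 := le_max_right (√Δ₀ / (μ * (√η₀ * √ε))) (√Lv / (μ * √μ * √ε))
  have hM0 : 0 ≤ √Δ₀ / (μ * (√η₀ * √ε)) := by positivity
  generalize max (√Δ₀ / (μ * (√η₀ * √ε))) (√Lv / (μ * √μ * √ε)) = M at *
  have hM : 0 ≤ M := hM0.trans hM1
  have hKμ : 1 / μ ≤ K / μ := div_le_div_of_nonneg_right hK1 hμ.le
  have hS2 : 2 * S ≤ 2 * C * Λ * (K / μ) := by
    have e1 : C * Λ / μ = C * Λ * (1 / μ) := by ring
    have e2 := mul_le_mul_of_nonneg_left hKμ (by positivity : 0 ≤ C * Λ)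
    linarith
  have hmain : 8 * R * √(Q / η₀) ≤ 16 * R₀ * C * E * Λ * M := by
    have hRb : 8 * R * √(Q / η₀) ≤ 8 * (R₀ / μ) * √(Q / η₀) :=
      mul_le_mul_of_nonneg_right (by linarith) (Real.sqrt_nonneg _)
    refine hRb.trans ?_
    rcases le_max_iff.mp hQ with h | h
    · have h1 : √(Q / η₀) ≤ 2 * (√Δ₀ / (√η₀ * √ε)) := by
        have e1 : Q / η₀ ≤ 2 ^ 2 * (Δ₀ / (η₀ * ε)) := by
          refine (div_le_div_of_nonneg_right h hη₀.le).trans ?_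
          have : 2 ^ 2 * (Δ₀ / (η₀ * ε)) - 2 * Δ₀ / ε / η₀ = 2 * (Δ₀ / (η₀ * ε)) := by
            field_simp; ring
          have : 0 ≤ 2 * (Δ₀ / (η₀ * ε)) := by positivity
          linarith
        refine (Real.sqrt_le_sqrt e1).trans_eq ?_
        rw [Real.sqrt_mul (by positivity), Real.sqrt_sq (by norm_num), Real.sqrt_div' _
          (by positivity), Real.sqrt_mul hη₀.le]
      calc 8 * (R₀ / μ) * √(Q / η₀) ≤ 8 * (R₀ / μ) * (2 * (√Δ₀ / (√η₀ * √ε))) :=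
            mul_le_mul_of_nonneg_left h1 (by positivity)
        _ = 16 * R₀ * (√Δ₀ / (μ * (√η₀ * √ε))) := by field_simp; ring
        _ ≤ 16 * R₀ * M := mul_le_mul_of_nonneg_left hM1 (by positivity)
        _ ≤ 16 * R₀ * M * (C * E * Λ) := le_mul_of_one_le_right (by positivity) hCΛ
        _ = _ := by ring
    -- Here 2CEΛ ≥ 1 is replaced by its square, so that after taking roots Λ enters linearly instead
    -- of as √Λ.
    · have h' : Q / η₀ ≤ (2 * (C * E * Λ)) ^ 2 * (1 / (μ * ε)) := by
        have e1 := div_le_div_of_nonneg_right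
          (h.trans (mul_le_mul_of_nonneg_right hS (by positivity))) hη₀.le
        have e2 : C * Λ / μ * (2 * η₀ / ε * E) / η₀ = 2 * (C * E * Λ) * (1 / (μ * ε)) := by
          field_simp
        rw [e2] at e1
        refine e1.trans (mul_le_mul_of_nonneg_right ?_ (by positivity))
        nlinarith
      have h1 : √(Q / η₀) ≤ 2 * (C * E * Λ) * (1 / (√μ * √ε)) := by
        refine (Real.sqrt_le_sqrt h').trans_eq ?_
        rw [Real.sqrt_mul (by positivity), Real.sqrt_sq (by positivity), Real.sqrt_div' _
            (by positivity), Real.sqrt_mul hμ.le, Real.sqrt_one]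
      have hL1 : 1 ≤ √Lv := Real.one_le_sqrt.mpr hLv
      calc 8 * (R₀ / μ) * √(Q / η₀) ≤ 8 * (R₀ / μ) * (2 * (C * E * Λ) * (1 / (√μ * √ε))) :=
            mul_le_mul_of_nonneg_left h1 (by positivity)
        _ = 16 * R₀ * C * E * Λ * (1 / (μ * √μ * √ε)) := by field_simp; ring
        _ ≤ _ := mul_le_mul_of_nonneg_left
            ((div_le_div_of_nonneg_right hL1 (by positivity)).trans hM2) (by positivity)
  have h3 : 0 ≤ 2 * C * Λ * M := by positivity
  have h4 : 0 ≤ 16 * R₀ * C * E * Λ * (K / μ) := by positivity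
  linarith

end complexity

end CoDA

end

theorem theorem1 (p Gh Lh L1 : ℝ) (hp0 : 0 < p) (hp1 : p < 1)
    (hGh : 0 ≤ Gh) (hLh : 0 ≤ Lh) (hL1 : 0 ≤ L1) :
    -- constants that depend only on `p`, `G_h`, `L_h`, `L_1`
    ∃ Lv H B σv σα ηmax Cst : ℝ,
      0 < Lv ∧ L1 ≤ Lv ∧ 0 < H ∧ 0 < B ∧ 0 < σv ∧ 0 < σα ∧ 0 < ηmax ∧ 0 < Cst ∧
      ∀ (d K : ℕ) (X : Type*) [MeasurableSpace X] (h : CoDA.Weights d → X → ℝ)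
        (P : Fin K → Measure (X × Bool)) [∀ k, IsProbabilityMeasure (P k)]
        (Ω : Type*) [MeasurableSpace Ω] (Pr : Measure Ω) [IsProbabilityMeasure Pr]
        (train mini : ℕ → ℕ → Fin K → Ω → X × Bool) (μ Δ₀ η₀ : ℝ),
        0 < K → 0 < μ → 0 < Δ₀ → 0 < η₀ → η₀ * K ≤ ηmax →
        CoDA.Assumptions p Gh Lh L1 μ Δ₀ h P →
        CoDA.IsSampling Pr P train mini →
        -- accuracy after sufficiently many stages
        (∀ (ε : ℝ) (S : ℕ), 0 < ε → CoDA.EnoughStages Lv H B σv σα μ Δ₀ η₀ ε S →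
          Integrable (fun ω => CoDA.phi p h P
            (CoDA.codaIterate p Gh Lv μ η₀ h (fun s t k => train s t k ω)
              (fun s i k => mini s i k ω) S) - CoDA.phiStar p h P) Pr ∧
          ∫ ω, (CoDA.phi p h P
            (CoDA.codaIterate p Gh Lv μ η₀ h (fun s t k => train s t k ω)
              (fun s i k => mini s i k ω) S) - CoDA.phiStar p h P) ∂Pr ≤ ε) ∧
        -- iteration and communication complexity of the smallest sufficient number of stages
        (∀ ε : ℝ, 0 < ε → ε ≤ Δ₀ →
          ∃ S : ℕ, IsLeast {S' : ℕ | CoDA.EnoughStages Lv H B σv σα μ Δ₀ η₀ ε S'} S ∧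
            (CoDA.totalIterations K Gh Lv μ η₀ S : ℝ) ≤
              Cst * CoDA.logFactor μ Δ₀ ε *
                max (Δ₀ / (μ * ε * η₀ * K)) (Lv / (μ ^ 2 * K * ε)) ∧
            (CoDA.totalCommunications K Gh Lv μ η₀ S : ℝ) ≤
              Cst * CoDA.logFactor μ Δ₀ ε *
                max (K / μ + √Δ₀ / (μ * √(η₀ * ε)))
                  (K / μ + √Lv / (μ ^ (3 / 2 : ℝ) * √ε))) := by
  have hLc := CoDA.smoothConst_ge (Gh := Gh) (Lh := Lh) hp0 hp1 hL1
  have hLv16 : 16 ≤ CoDA.smoothConst p Gh Lh L1 := by linarith [hLc.1, sq_nonneg Gh]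
  have hL1v : L1 ≤ CoDA.smoothConst p Gh Lh L1 := by linarith [hLc.2.1]
  have hN := CoDA.noiseConst_pos (Gh := Gh) (Lh := Lh) hp0 hp1 hL1
  have hG := CoDA.gradBound_pos hp0 hp1 hGh
  have hD := CoDA.one_le_dualBound hp0 hp1
  have hX : max 8 (8 * Gh ^ 2) ≤ CoDA.smoothConst p Gh Lh L1 / 2 :=
    max_le (by linarith) (by linarith [hLc.1])
  -- An upper bound for 5L_v + μ that does not involve μ, by `mu_le`.
  obtain ⟨R₀, hR₀⟩ : ∃ R₀, R₀ = 5 * CoDA.smoothConst p Gh Lh L1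
    + CoDA.gradBound p Gh ^ 2 * CoDA.dualBound p := ⟨_, rfl⟩
  obtain ⟨E, hE⟩ : ∃ E, E = (6 * (10 * CoDA.noiseConst p Gh Lh L1) * (1 : ℝ) ^ 2
    + 12 * ((1 : ℝ) ^ 2 + (1 : ℝ) ^ 2)) / 5 := ⟨_, rfl⟩
  have hR₀1 : 1 ≤ R₀ := by
    have : 0 ≤ CoDA.gradBound p Gh ^ 2 * CoDA.dualBound p := by positivity
    linarith
  have hE1 : 1 ≤ E := by rw [hE]; linarith
  have hE12 : 12 * CoDA.noiseConst p Gh Lh L1 ≤ E := by rw [hE]; linarith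
  have hC := CoDA.one_le_stageCountConst hR₀1 hE1
  -- H, B, σ_v, σ_α matter only through the combination E, so three of them are set to 1; H = 10N
  -- makes E at least 12N, as `accuracy_arith` requires. The bound 8/L_v on η₀K keeps every step
  -- size at most 1/2.
  refine ⟨CoDA.smoothConst p Gh Lh L1, 10 * CoDA.noiseConst p Gh Lh L1, 1, 1, 1,
    8 / CoDA.smoothConst p Gh Lh L1,
    2 * CoDA.stageCountConst R₀ E + 16 * R₀ * CoDA.stageCountConst R₀ E * E, by linarith, hL1v,
    by linarith, one_pos, one_pos, one_pos, by positivity, by positivity, ?_⟩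
  intro d K X _ h P _ Ω _ Pr _ train mini μ Δ₀ η₀ hK hμ hΔ hη₀ hη hA hs
  have hLv0 : 0 < CoDA.smoothConst p Gh Lh L1 := by linarith
  have hc0 := CoDA.rate_pos hLv0 hμ
  refine ⟨fun ε S hε hS => ⟨hA.integrable_gap_codaIterate hK hp0 hp1 hGh hL1 hμ hη₀ hη hs S, ?_⟩,
    fun ε hε hεΔ => ?_⟩
  · obtain ⟨hS1, hS2⟩ := hS
    obtain ⟨n, rfl⟩ : ∃ n, S = n + 1 := ⟨S - 1, by omega⟩
    rw [CoDA.inv_rate hLv0 hμ, ← hE] at hS2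
    exact (hA.integral_gap_codaIterate_le hK hp0 hp1 hGh hLh hL1 hμ hη₀ hη hs n).trans
      (CoDA.accuracy_arith hc0 (CoDA.rate_lt_one hLv0 hμ) hN hE12 hΔ hη₀ hε hS2)
  · have hμle := hA.mu_le hK hp0 hp1 hGh hμ
    have hη₀1 : η₀ ≤ 1 / 2 := by
      have h1 : (1 : ℝ) ≤ K := by exact_mod_cast hK
      have h2 : 8 / CoDA.smoothConst p Gh Lh L1 ≤ 1 / 2 := by
        rw [div_le_iff₀ hLv0]; linarith
      nlinarith
    obtain ⟨S, hleast, hS1, hSle, hQ⟩ := CoDA.exists_least_enoughStages hLv0 hμ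
      (by linarith : 5 * CoDA.smoothConst p Gh Lh L1 + μ ≤ R₀) hR₀1 hΔ hη₀ hη₀1 hE hE1 hε hεΔ
    have hΛ := CoDA.one_le_logFactor hμ hΔ hε
    have hRle : 1 / CoDA.rate μ (CoDA.smoothConst p Gh Lh L1) ≤ R₀ / μ := by
      rw [← CoDA.inv_rate hLv0 hμ]
      exact div_le_div_of_nonneg_right (by linarith) hμ.le
    refine ⟨S, hleast, ?_, ?_⟩
    · exact (CoDA.totalIterations_le hK hη₀ hμ hLv0 hX hη hS1).trans
        (CoDA.iterations_arith hK hη₀ hμ (by linarith) hΔ hε hE1 hC hΛ (by linarith)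
          (by positivity) hRle hSle hQ)
    · exact (CoDA.totalCommunications_le hK hη₀ hμ hLv0 hX hη hS1).trans
        (CoDA.communications_arith hK hη₀ hμ (by linarith) hΔ hε hE1 hC hΛ (by linarith)
          hRle hSle hQ)
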